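/- Let $N\ge 2$, let $\Omega\subset\mathbb R^N$ be a bounded domain (for instance with $C^2$ boundary), let $\lambda>0$, and let $p,q,\delta,a,b\in C(\overline\Omega)$ with $a,b\ge 0$ (for instance nonnegative weights with compact support in $\Omega$). Put $p^*(x)=\frac{Np(x)}{N-p(x)}$ if $p(x)<N$ and $p^*(x)=\infty$ otherwise, let $f^-=\min_{\overline\Omega}f$ and $f^+=\max_{\overline\Omega}f$ for an exponent $f$, and assume that for all $x\in\overline\Omega$ $$p(x)>1,\qquad 0<1-\delta(x)<p(x)<q(x)<p^*(x),$$ and that $0<1-\delta^+\le 1-\delta^-<p^-\le p^+<q^-\le q^+$. Let $W^{1,p(x)}(\Omega)$ be the space of (classes of) measurable functions $u$ on $\Omega$ with a weak gradient such that $\int_\Omega|u|^{p(x)}dx<\infty$ and $\int_\Omega|\nabla u|^{p(x)}dx<\infty$, normed by $\|u\|=|u|_{p(\cdot)}+|\nabla u|_{p(\cdot)}$ with the Luxemburg norm $|f|_{p(\cdot)}=\inf\{\kappa>0:\int_\Omega|f/\kappa|^{p(x)}dx\le 1\}$, and let $W_0^{1,p(x)}(\Omega)$ be the closure of $C_0^\infty(\Omega)$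 in it. For $u\in W_0^{1,p(x)}(\Omega)$ let $$E_\lambda(u)=\int_\Omega\frac{|\nabla u|^{p(x)}}{p(x)}\,dx-\int_\Omega\frac{a(x)|u|^{q(x)}}{q(x)}\,dx-\lambda\int_\Omega\frac{b(x)(u^+)^{1-\delta(x)}}{1-\delta(x)}\,dx,\qquad \Phi_u(t)=E_\lambda(tu),$$ where $u^+=\max(u,0)$. Write $\langle E_\lambda'(u),\varphi\rangle$ for the directional derivative $\frac{d}{ds}E_\lambda(u+s\varphi)\big|_{s=0}$ (two-sided) when it exists; thus $\langle E'_\lambda(u),u\rangle=\Phi_u'(1)$. Let $$\mathcal N_\lambda=\{u\in W_0^{1,p(x)}(\Omega)\setminus\{0\}:\langle E_\lambda'(u),u\rangle=0\},$$ and let $\mathcal N_\lambda^{+}$, $\mathcal N_\lambda^{-}$, $\mathcal N_\lambda^{0}$ be the sets of those $u\in\mathcal N_\lambda$ for which $\Phi_u''(1)>0$, $\Phi_u''(1)<0$, $\Phi_u''(1)=0$ respectively. Let $u$ be a local minimizer, with respect to the norm $\|\cdot\|$, of $E_\lambda$ on $\mathcal N_\lambda^+$ or of $E_\lambda$ on $\mathcal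 N_\lambda^-$, with $u\notin\mathcal N_\lambda^0$. Then $u$ is a critical point of $E_\lambda$ on $W_0^{1,p(x)}(\Omega)$: for every $\varphi\in W_0^{1,p(x)}(\Omega)$ the derivative $\langle E_\lambda'(u),\varphi\rangle$ exists and equals $0$. -/

import Mathlib

open MeasureTheory
open scoped ContDiff

noncomputable section

namespace PxLaplace

/-- Euclidean space `ℝ^N`. -/
abbrev Sp (N : ℕ) : Type := EuclideanSpace ℝ (Fin N)

/-- The space `S(Ω)` of real measurable functions on `Ω`, two functions being identified when they
agree almost everywhere on `Ω`. -/
abbrev MeasFun {N : ℕ} (Ω : Set (Sp N)) : Type := Sp N →ₘ[volume.restrict Ω] ℝ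

section VariableExponent

variable {N : ℕ} (Ω : Set (Sp N)) (p : Sp N → ℝ)

/-- The modular `ρ_p(f) = ∫_Ω |f(x)|^{p(x)} dx`, with values in `[0, ∞]`, for scalar or vector
valued `f`. -/
def modular {F : Type} [NormedAddCommGroup F] (f : Sp N → F) : ENNReal :=
  ∫⁻ x in Ω, ENNReal.ofReal (‖f x‖ ^ p x)

/-- Membership in the variable exponent Lebesgue space `L^{p(·)}(Ω)`. -/
def MemVarLp {F : Type} [NormedAddCommGroup F] (f : Sp N → F) : Prop :=
  AEStronglyMeasurable f (volume.restrict Ω) ∧ modular Ω p f < ⊤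

/-- The Luxemburg norm `inf {κ > 0 : ∫_Ω |f(x)/κ|^{p(x)} dx ≤ 1}` on `L^{p(·)}(Ω)`. -/
def luxNorm {F : Type} [NormedAddCommGroup F] [NormedSpace ℝ F] (f : Sp N → F) : ℝ :=
  sInf {κ : ℝ | 0 < κ ∧ modular Ω p (fun x => κ⁻¹ • f x) ≤ 1}

/-- `φ ∈ C_0^∞(Ω)`: smooth, with compact support contained in `Ω`. -/
def IsTestFunction (φ : Sp N → ℝ) : Prop :=
  ContDiff ℝ ∞ φ ∧ HasCompactSupport φ ∧ tsupport φ ⊆ Ω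

/-- `g` is the distributional gradient of `f` in `Ω`, both being locally integrable. -/
def HasWeakGrad (f : Sp N → ℝ) (g : Sp N → Sp N) : Prop :=
  LocallyIntegrableOn f Ω ∧ LocallyIntegrableOn g Ω ∧
    ∀ φ : Sp N → ℝ, IsTestFunction Ω φ → ∀ i : Fin N,
      ∫ x in Ω, f x * fderiv ℝ φ x (EuclideanSpace.single i 1) = -∫ x in Ω, g x i * φ x

/-- The weak gradient `∇f` on `Ω` (unique almost everywhere on `Ω` when it exists). -/
def weakGrad (f : Sp N → ℝ) : Sp N → Sp N :=
  Classical.epsilon (HasWeakGrad Ω f)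

/-- Membership in `W^{1,p(·)}(Ω)`. -/
def MemW1p (f : Sp N → ℝ) : Prop :=
  MemVarLp Ω p f ∧ ∃ g : Sp N → Sp N, HasWeakGrad Ω f g ∧ MemVarLp Ω p g

/-- The norm `‖f‖ = |f|_{p(·)} + |∇f|_{p(·)}` of `W^{1,p(·)}(Ω)`. -/
def sobolevNorm (f : Sp N → ℝ) : ℝ :=
  luxNorm Ω p f + luxNorm Ω p (weakGrad Ω f)

/-- `W_0^{1,p(·)}(Ω)`: the closure of `C_0^∞(Ω)` in `W^{1,p(·)}(Ω)`. -/
def W0 : Set (MeasFun Ω) :=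
  {u | MemW1p Ω p u ∧ ∀ ε : ℝ, 0 < ε →
    ∃ φ : Sp N → ℝ, IsTestFunction Ω φ ∧ sobolevNorm Ω p (fun x => u x - φ x) < ε}

end VariableExponent

/-- The data of the problem
`-Δ_{p(x)} u = a(x)|u|^{q(x)-2}u + lam b(x) u^{-δ(x)}` in `Ω`, `u = 0` on `∂Ω`.
Only the values of the functions on the closure of `Ω` matter. -/
structure Problem (N : ℕ) where
  Ω : Set (Sp N)
  p : Sp N → ℝ
  q : Sp N → ℝ
  δ : Sp N → ℝ
  a : Sp N → ℝ
  b : Sp N → ℝ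
  lam : ℝ

namespace Problem

variable {N : ℕ}

/-- The standing assumptions. Since the exponents are continuous on the compact set `closure Ω`,
the last two fields say `1 - δ⁻ < p⁻` and `p⁺ < q⁻`. -/
structure Admissible (P : Problem N) : Prop where
  two_le : 2 ≤ N
  isOpen : IsOpen P.Ω
  isConnected : IsConnected P.Ω
  isBounded : Bornology.IsBounded P.Ω
  lam_pos : 0 < P.lam
  cont_p : ContinuousOn P.p (closure P.Ω)
  cont_q : ContinuousOn P.q (closure P.Ω)
  cont_δ : ContinuousOn P.δ (closure P.Ω)
  cont_a : ContinuousOn P.a (closure P.Ω)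
  cont_b : ContinuousOn P.b (closure P.Ω)
  a_nonneg : ∀ x ∈ closure P.Ω, 0 ≤ P.a x
  b_nonneg : ∀ x ∈ closure P.Ω, 0 ≤ P.b x
  one_lt_p : ∀ x ∈ closure P.Ω, 1 < P.p x
  δ_lt_one : ∀ x ∈ closure P.Ω, 0 < 1 - P.δ x
  one_sub_δ_lt_p : ∀ x ∈ closure P.Ω, 1 - P.δ x < P.p x
  p_lt_q : ∀ x ∈ closure P.Ω, P.p x < P.q x
  /-- `q(x) < p*(x)`, where `p*(x) = N p(x)/(N - p(x))` if `p(x) < N` and `p*(x) = ∞` otherwise. -/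
  q_lt_pstar : ∀ x ∈ closure P.Ω, P.p x < N → P.q x < N * P.p x / (N - P.p x)
  sep_δ_p : ∀ x ∈ closure P.Ω, ∀ y ∈ closure P.Ω, 1 - P.δ x < P.p y
  sep_p_q : ∀ x ∈ closure P.Ω, ∀ y ∈ closure P.Ω, P.p x < P.q y

/-- The energy functional
`E(u) = ∫ |∇u|^p / p - ∫ a |u|^q / q - lam ∫ b (u⁺)^{1-δ} / (1-δ)`. -/
def energy (P : Problem N) (u : MeasFun P.Ω) : ℝ :=
  (∫ x in P.Ω, ‖weakGrad P.Ω u x‖ ^ P.p x / P.p x)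
    - (∫ x in P.Ω, P.a x * |u x| ^ P.q x / P.q x)
    - P.lam * ∫ x in P.Ω, P.b x * (max (u x) 0) ^ (1 - P.δ x) / (1 - P.δ x)

/-- The fiber map `Φ_u(t) = E(t u)`. -/
def fiber (P : Problem N) (u : MeasFun P.Ω) (t : ℝ) : ℝ :=
  P.energy (t • u)

/-- The Nehari manifold `{u ∈ W_0^{1,p(·)}(Ω) \ {0} : ⟨E'(u), u⟩ = 0}`. Here `⟨E'(u), u⟩`, the
derivative of `E` at `u` in the direction `u`, is `Φ_u'(1)`; it is required to exist. -/
def nehari (P : Problem N) : Set (MeasFun P.Ω) :=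
  {u | u ∈ W0 P.Ω P.p ∧ u ≠ 0 ∧ HasDerivAt (P.fiber u) 0 1}

/-- `N^+ = {u ∈ N : Φ_u''(1) > 0}`. -/
def nehariPos (P : Problem N) : Set (MeasFun P.Ω) :=
  {u | u ∈ P.nehari ∧ 0 < deriv (deriv (P.fiber u)) 1}

/-- `N^- = {u ∈ N : Φ_u''(1) < 0}`. -/
def nehariNeg (P : Problem N) : Set (MeasFun P.Ω) :=
  {u | u ∈ P.nehari ∧ deriv (deriv (P.fiber u)) 1 < 0}

/-- `N^0 = {u ∈ N : Φ_u''(1) = 0}`. -/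
def nehariZero (P : Problem N) : Set (MeasFun P.Ω) :=
  {u | u ∈ P.nehari ∧ deriv (deriv (P.fiber u)) 1 = 0}

/-- `u` is a local minimizer of `E` on the set `A`, for the norm of `W_0^{1,p(·)}(Ω)`. -/
def IsLocalMinimizerOn (P : Problem N) (A : Set (MeasFun P.Ω)) (u : MeasFun P.Ω) : Prop :=
  u ∈ A ∧ ∃ r : ℝ, 0 < r ∧ ∀ v ∈ A, sobolevNorm P.Ω P.p ⇑(v - u) < r → P.energy u ≤ P.energy v

/-- `u` is a critical point of `E` on `W_0^{1,p(·)}(Ω)`: in every direction `φ` of this space the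
derivative `⟨E'(u), φ⟩` exists and vanishes. -/
def IsCriticalPoint (P : Problem N) (u : MeasFun P.Ω) : Prop :=
  u ∈ W0 P.Ω P.p ∧
    ∀ φ ∈ W0 P.Ω P.p, HasDerivAt (fun s : ℝ => P.energy (u + s • φ)) 0 0

end Problem

end PxLaplace

end

/-! Split the energy as E = A - λB, where B is the integral of the term with exponent 1 - δ and A
collects the gradient term and the term with exponent q. Along lines u + sφ the part A is
differentiable, but B need not be: its integrand can have infinite slope where u = 0, and on {u > 0}
the formal derivative b u^{-δ} φ is not known in advance to be integrable. Along rays t ↦ tw every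
term is smooth for t > 0, because t enters only through the factor t^{r(x)}.

Smoothness along rays replaces the Lagrange multiplier. For small s the derivative of t ↦ E(t(u +
sφ)) vanishes at some t near 1, by the intermediate value theorem, and the second derivative there
keeps its sign (`IsFiberFamily.exists_isMin`, `IsFiberFamily.exists_isMax`). Hence t(u + sφ) lies on
the same part of the Nehari manifold as u and close to u. On N⁺ this gives E(u) ≤ E(t(u + sφ)) ≤ E(u
+ sφ); on N⁻ it gives E(tu) ≤ E(u) ≤ E(t(u + sφ)). In both cases E(τu) ≤ E(τ(u + sφ)) for some τ
close to 1 (`exists_fiberEnergy_le`).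

Dividing by s > 0, the difference quotient of B at τ is at most that of A divided by λ, and the
latter converges to A'(u)φ / λ jointly as s → 0⁺ and τ → 1. For test functions φ ≥ 0, Fatou's lemma
bounds the integral of b u^{-δ} φ over {u > 0}. Smooth approximations of |φ| extend this to
integrability for every φ in the Sobolev space (`integrable_posPartVariation`); this uses the
subcritical embedding, proved by localizing the Gagliardo-Nirenberg-Sobolev inequality
(`exists_modular_bound`).

With integrability at hand, dominated convergence works on {u > 0}, while on {u ≤ 0} the quotients
of B are nonnegative for every φ. So the integral of b u^{-δ} φ over {u > 0} is at most A'(u)φ / λ.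
Both sides are linear in φ, and the inequality for -φ yields equality. Equality leaves no room for
the contribution of {u ≤ 0}, which must tend to 0 (`IsPosPartData.tendsto_integral_posPartSlope`).
Therefore the right derivative of E at u along φ exists and is 0; the direction -φ gives the left
derivative. -/

namespace PxLaplace

/-- A measurable exponent with values in `[1, R]` on an open set of finite measure. -/
structure IsExponent {N : ℕ} (Ω : Set (Sp N)) (p : Sp N → ℝ) (R : ℝ) : Prop where
  isOpen : IsOpen Ω
  finite : volume Ω < ⊤
  meas : AEMeasurable p (volume.restrict Ω)
  one_le : ∀ x ∈ Ω, 1 ≤ p x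
  le : ∀ x ∈ Ω, p x ≤ R

/-- The constant depends only on the upper bound R of the exponents, so the inequality can be
integrated with r = p(x). -/
theorem norm_add_rpow_le {F : Type*} [NormedAddCommGroup F] (a b : F) {r R : ℝ} (hr : 0 ≤ r)
    (hR : r ≤ R) : ‖a + b‖ ^ r ≤ 2 ^ R * (‖a‖ ^ r + ‖b‖ ^ r) := by
  have h1 : ‖a + b‖ ≤ 2 * max ‖a‖ ‖b‖ := by
    have := norm_add_le a b
    have := le_max_left ‖a‖ ‖b‖
    have := le_max_right ‖a‖ ‖b‖
    linarith
  have h0 : 0 ≤ max ‖a‖ ‖b‖ := le_max_of_le_left (norm_nonneg a)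
  have h2 : (2 : ℝ) ^ r ≤ 2 ^ R := Real.rpow_le_rpow_of_exponent_le (by norm_num) hR
  have h3 : (max ‖a‖ ‖b‖) ^ r ≤ ‖a‖ ^ r + ‖b‖ ^ r := by
    have ha := Real.rpow_nonneg (norm_nonneg a) r
    have hb := Real.rpow_nonneg (norm_nonneg b) r
    rcases max_choice ‖a‖ ‖b‖ with h | h <;> rw [h] <;> linarith
  calc ‖a + b‖ ^ r ≤ (2 * max ‖a‖ ‖b‖) ^ r := Real.rpow_le_rpow (norm_nonneg _) h1 hr
    _ = 2 ^ r * (max ‖a‖ ‖b‖) ^ r := Real.mul_rpow (by norm_num) h0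
    _ ≤ 2 ^ R * (‖a‖ ^ r + ‖b‖ ^ r) := by
      apply mul_le_mul h2 h3 (Real.rpow_nonneg h0 r) (by positivity)

theorem rpow_le_one_add_rpow {x r R : ℝ} (hx : 0 ≤ x) (hr : 0 ≤ r) (hR : r ≤ R) :
    x ^ r ≤ 1 + x ^ R := by
  rcases le_total x 1 with h | h
  · have := Real.rpow_le_one hx h hr
    have := Real.rpow_nonneg hx R
    linarith
  · have := Real.rpow_le_rpow_of_exponent_le h hR
    linarith

/-! ### Modulars and the Luxemburg norm -/

section Modular

variable {N : ℕ} {Ω : Set (Sp N)} {p : Sp N → ℝ} {R : ℝ}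
variable {F : Type} [NormedAddCommGroup F]

theorem IsExponent.isFiniteMeasure (hp : IsExponent Ω p R) :
    IsFiniteMeasure (volume.restrict Ω) :=
  ⟨by simpa using hp.finite⟩

theorem IsExponent.ae (hp : IsExponent Ω p R) :
    ∀ᵐ x ∂(volume.restrict Ω), 1 ≤ p x ∧ p x ≤ R :=
  ae_restrict_of_forall_mem hp.isOpen.measurableSet fun x hx => ⟨hp.one_le x hx, hp.le x hx⟩

theorem IsExponent.aemeasurable_rpow (hp : IsExponent Ω p R) {f : Sp N → F}
    (hf : AEStronglyMeasurable f (volume.restrict Ω)) :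
    AEMeasurable (fun x => ‖f x‖ ^ p x) (volume.restrict Ω) :=
  hf.norm.aemeasurable.pow hp.meas

theorem modular_congr {f g : Sp N → F} (h : f =ᵐ[volume.restrict Ω] g) :
    modular Ω p f = modular Ω p g := by
  refine lintegral_congr_ae ?_
  filter_upwards [h] with x hx
  rw [hx]

theorem modular_add_le (hp : IsExponent Ω p R) {f : Sp N → F} (g : Sp N → F)
    (hf : AEStronglyMeasurable f (volume.restrict Ω)) :
    modular Ω p (fun x => f x + g x) ≤
      ENNReal.ofReal (2 ^ R) * (modular Ω p f + modular Ω p g) := by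
  unfold modular
  rw [← lintegral_add_left' (hp.aemeasurable_rpow hf).ennreal_ofReal, ← lintegral_const_mul' _ _
    ENNReal.ofReal_ne_top]
  refine lintegral_mono_ae ?_
  filter_upwards [hp.ae] with x hx
  rw [← ENNReal.ofReal_add (by positivity) (by positivity), ← ENNReal.ofReal_mul (by positivity)]
  exact ENNReal.ofReal_le_ofReal (norm_add_rpow_le _ _ (by linarith) hx.2)

theorem modular_const_mul_le (hp : IsExponent Ω p R) [NormedSpace ℝ F] (f : Sp N → F) {c d : ℝ}
    (h : ∀ r, 1 ≤ r → r ≤ R → |c| ^ r ≤ d) :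
    modular Ω p (fun x => c • f x) ≤ ENNReal.ofReal d * modular Ω p f := by
  unfold modular
  rw [← lintegral_const_mul' _ _ ENNReal.ofReal_ne_top]
  refine lintegral_mono_ae ?_
  filter_upwards [hp.ae] with x hx
  have h1 := h _ hx.1 hx.2
  have hd : 0 ≤ d := le_trans (by positivity) h1
  rw [← ENNReal.ofReal_mul hd]
  refine ENNReal.ofReal_le_ofReal ?_
  rw [norm_smul, Real.mul_rpow (norm_nonneg _) (norm_nonneg _), Real.norm_eq_abs]
  exact mul_le_mul_of_nonneg_right h1 (by positivity)

theorem modular_smul_le_of_abs_le_one (hp : IsExponent Ω p R) [NormedSpace ℝ F] (f : Sp N → F)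
    {c : ℝ} (hc : |c| ≤ 1) :
    modular Ω p (fun x => c • f x) ≤ ENNReal.ofReal |c| * modular Ω p f := by
  refine modular_const_mul_le hp f fun r hr _ => ?_
  simpa using Real.rpow_le_rpow_of_exponent_ge_of_imp (abs_nonneg c) hc hr (fun _ h => by linarith)

theorem modular_smul_le (hp : IsExponent Ω p R) [NormedSpace ℝ F] (f : Sp N → F) (c : ℝ) :
    modular Ω p (fun x => c • f x) ≤ ENNReal.ofReal (1 + |c| ^ R) * modular Ω p f :=
  modular_const_mul_le hp f fun _ hr hR =>
    rpow_le_one_add_rpow (abs_nonneg c) (by linarith) hR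

theorem MemVarLp.congr {f g : Sp N → F} (hf : MemVarLp Ω p f)
    (h : f =ᵐ[volume.restrict Ω] g) : MemVarLp Ω p g :=
  ⟨hf.1.congr h, by rw [← modular_congr h]; exact hf.2⟩

theorem MemVarLp.add (hp : IsExponent Ω p R) {f g : Sp N → F} (hf : MemVarLp Ω p f)
    (hg : MemVarLp Ω p g) : MemVarLp Ω p (fun x => f x + g x) :=
  ⟨hf.1.add hg.1, (modular_add_le hp g hf.1).trans_lt
    (ENNReal.mul_lt_top ENNReal.ofReal_lt_top (ENNReal.add_lt_top.2 ⟨hf.2, hg.2⟩))⟩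

theorem MemVarLp.smul (hp : IsExponent Ω p R) [NormedSpace ℝ F] {f : Sp N → F}
    (hf : MemVarLp Ω p f) (c : ℝ) : MemVarLp Ω p (fun x => c • f x) :=
  ⟨hf.1.const_smul c, (modular_smul_le hp f c).trans_lt
    (ENNReal.mul_lt_top ENNReal.ofReal_lt_top hf.2)⟩

theorem MemVarLp.integrable_rpow (hp : IsExponent Ω p R) {f : Sp N → F} (hf : MemVarLp Ω p f) :
    Integrable (fun x => ‖f x‖ ^ p x) (volume.restrict Ω) := by
  refine ⟨(hp.aemeasurable_rpow hf.1).aestronglyMeasurable, ?_⟩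
  rw [hasFiniteIntegral_iff_ofReal (Filter.Eventually.of_forall fun x => by positivity)]
  exact hf.2

/-- For κ ≤ 1 and exponents at most R, dividing by κ enlarges the modular by at most κ^{-R}, so κ
itself is admissible in the infimum. -/
theorem luxNorm_le_of_modular_le (hp : IsExponent Ω p R) [NormedSpace ℝ F] {f : Sp N → F}
    {κ : ℝ} (h0 : 0 < κ) (h1 : κ ≤ 1) (h : modular Ω p f ≤ ENNReal.ofReal (κ ^ R)) :
    luxNorm Ω p f ≤ κ := by
  refine csInf_le ⟨0, fun x hx => hx.1.le⟩ ⟨h0, ?_⟩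
  have hκ : 0 < κ ^ R := Real.rpow_pos_of_pos h0 R
  refine (modular_const_mul_le hp f (d := (κ ^ R)⁻¹) fun r _ hR => ?_).trans ?_
  · rw [abs_of_pos (inv_pos.2 h0), Real.inv_rpow h0.le]
    exact inv_anti₀ hκ (Real.rpow_le_rpow_of_exponent_ge h0 h1 hR)
  · refine (mul_le_mul_right h _).trans ?_
    rw [← ENNReal.ofReal_mul (by positivity), inv_mul_cancel₀ hκ.ne', ENNReal.ofReal_one]

theorem luxNorm_nonneg [NormedSpace ℝ F] (f : Sp N → F) : 0 ≤ luxNorm Ω p f :=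
  Real.sInf_nonneg fun _ hx => hx.1.le

/-- Some admissible η < κ exists, and f = η (η⁻¹ f); since the exponents are at least 1, the factor
η ≤ 1 shrinks the modular at least linearly. Together with `luxNorm_le_of_modular_le` this allows
smallness in norm to be replaced by smallness of modulars. -/
theorem modular_le_of_luxNorm_lt (hp : IsExponent Ω p R) [NormedSpace ℝ F] {f : Sp N → F}
    (hf : MemVarLp Ω p f) {κ : ℝ} (h1 : κ ≤ 1) (h : luxNorm Ω p f < κ) :
    modular Ω p f ≤ ENNReal.ofReal κ := by
  -- Finiteness of the modular matters here: the real infimum of the empty set is 0, so a small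
  -- `luxNorm` alone would say nothing.
  have hne : {κ : ℝ | 0 < κ ∧ modular Ω p (fun x => κ⁻¹ • f x) ≤ 1}.Nonempty := by
    set M := (modular Ω p f).toReal
    have hM : 0 ≤ M := ENNReal.toReal_nonneg
    refine ⟨1 + M, by positivity, ?_⟩
    have hc : |(1 + M)⁻¹| ≤ 1 := by
      rw [abs_of_pos (by positivity)]
      exact inv_le_one_of_one_le₀ (by linarith)
    refine (modular_smul_le_of_abs_le_one hp f hc).trans ?_
    rw [← ENNReal.ofReal_toReal hf.2.ne, ← ENNReal.ofReal_mul (abs_nonneg _), ← ENNReal.ofReal_one]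
    refine ENNReal.ofReal_le_ofReal ?_
    rw [abs_of_pos (by positivity), inv_mul_le_iff₀ (by positivity)]
    linarith
  obtain ⟨η, ⟨hη0, hη⟩, hηκ⟩ := exists_lt_of_csInf_lt hne h
  have hη1 : |η| ≤ 1 := by rw [abs_of_pos hη0]; linarith
  have := modular_smul_le_of_abs_le_one hp (fun x => η⁻¹ • f x) hη1
  simp only [smul_smul, mul_inv_cancel₀ hη0.ne', one_smul] at this
  refine this.trans ((mul_le_mul_right hη _).trans ?_)
  rw [mul_one, abs_of_pos hη0]
  exact ENNReal.ofReal_le_ofReal hηκ.le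

theorem luxNorm_congr [NormedSpace ℝ F] {f g : Sp N → F} (h : f =ᵐ[volume.restrict Ω] g) :
    luxNorm Ω p f = luxNorm Ω p g := by
  unfold luxNorm
  congr 1
  ext κ
  rw [Set.mem_ofPred_eq, Set.mem_ofPred_eq, modular_congr (g := fun x => κ⁻¹ • g x)]
  filter_upwards [h] with x hx
  rw [hx]

end Modular

/-! ### Weak gradients -/

section WeakGrad

variable {N : ℕ} {Ω : Set (Sp N)}

theorem IsTestFunction.continuous {φ : Sp N → ℝ} (hφ : IsTestFunction Ω φ) : Continuous φ :=
  hφ.1.continuous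

theorem IsTestFunction.continuous_fderiv_apply {φ : Sp N → ℝ} (hφ : IsTestFunction Ω φ)
    (v : Sp N) : Continuous (fun x => fderiv ℝ φ x v) :=
  (hφ.1.continuous_fderiv (by simp)).clm_apply continuous_const

theorem integrableOn_mul_of_tsupport_subset (hΩ : IsOpen Ω) {h ψ : Sp N → ℝ}
    (hh : LocallyIntegrableOn h Ω) (hψ : Continuous ψ) (hc : HasCompactSupport ψ)
    (hs : tsupport ψ ⊆ Ω) : IntegrableOn (fun x => h x * ψ x) Ω := by
  have h1 : IntegrableOn h (tsupport ψ) := hh.integrableOn_compact_subset hs hc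
  refine (h1.mul_continuousOn hψ.continuousOn hc).of_forall_sdiff_eq_zero hΩ.measurableSet ?_
  intro x hx
  rw [image_eq_zero_of_notMem_tsupport hx.2, mul_zero]

theorem integrableOn_mul_fderiv (hΩ : IsOpen Ω) {h φ : Sp N → ℝ}
    (hh : LocallyIntegrableOn h Ω) (hφ : IsTestFunction Ω φ) (v : Sp N) :
    IntegrableOn (fun x => h x * fderiv ℝ φ x v) Ω := by
  refine integrableOn_mul_of_tsupport_subset hΩ hh (hφ.continuous_fderiv_apply v)
    (hφ.2.1.fderiv_apply ℝ v) ((tsupport_fderiv_apply_subset ℝ v).trans hφ.2.2)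

theorem LocallyIntegrableOn.apply_coord {g : Sp N → Sp N} (hg : LocallyIntegrableOn g Ω)
    (i : Fin N) : LocallyIntegrableOn (fun x => g x i) Ω :=
  (EuclideanSpace.proj i : Sp N →L[ℝ] ℝ).locallyIntegrableOn_comp hg

/-- The fundamental lemma of the calculus of variations, coordinate by coordinate. It makes the
choice made in `weakGrad` harmless. -/
theorem HasWeakGrad.ae_eq (hΩ : IsOpen Ω) {f : Sp N → ℝ} {g g' : Sp N → Sp N}
    (h : HasWeakGrad Ω f g) (h' : HasWeakGrad Ω f g') : g =ᵐ[volume.restrict Ω] g' := by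
  have key : ∀ i : Fin N, ∀ᵐ x ∂(volume : Measure (Sp N)), x ∈ Ω → g x i - g' x i = 0 := by
    intro i
    have hg := LocallyIntegrableOn.apply_coord h.2.1 i
    have hg' := LocallyIntegrableOn.apply_coord h'.2.1 i
    refine hΩ.ae_eq_zero_of_integral_contDiff_smul_eq_zero (hg.sub hg') ?_
    intro φ h1 h2 h3
    rw [← setIntegral_eq_integral_of_forall_compl_eq_zero (s := Ω)]
    · have e1 := h.2.2 φ ⟨h1, h2, h3⟩ i
      have e2 := h'.2.2 φ ⟨h1, h2, h3⟩ i
      have e3 := integral_sub (integrableOn_mul_of_tsupport_subset hΩ hg h1.continuous h2 h3)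
        (integrableOn_mul_of_tsupport_subset hΩ hg' h1.continuous h2 h3)
      calc _ = ∫ x in Ω, (g x i * φ x - g' x i * φ x) := by
            congr 1; ext x; simp only [smul_eq_mul]; ring
        _ = 0 := by rw [e3]; linarith
    · intro x hx
      rw [image_eq_zero_of_notMem_tsupport fun h => hx (h3 h), zero_smul]
  rw [Filter.EventuallyEq, ae_restrict_iff' hΩ.measurableSet]
  filter_upwards [ae_all_iff.2 key] with x hx hxΩ
  ext i
  exact sub_eq_zero.1 (hx i hxΩ)

theorem HasWeakGrad.weakGrad_ae_eq (hΩ : IsOpen Ω) {f : Sp N → ℝ} {g : Sp N → Sp N}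
    (h : HasWeakGrad Ω f g) : weakGrad Ω f =ᵐ[volume.restrict Ω] g :=
  (Classical.epsilon_spec (p := HasWeakGrad Ω f) ⟨g, h⟩).ae_eq hΩ h

theorem HasWeakGrad.hasWeakGrad_weakGrad {f : Sp N → ℝ} {g : Sp N → Sp N}
    (h : HasWeakGrad Ω f g) : HasWeakGrad Ω f (weakGrad Ω f) :=
  Classical.epsilon_spec (p := HasWeakGrad Ω f) ⟨g, h⟩

theorem HasWeakGrad.congr {f f' : Sp N → ℝ} {g g' : Sp N → Sp N}
    (h : HasWeakGrad Ω f g) (hf : f =ᵐ[volume.restrict Ω] f')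
    (hg : g =ᵐ[volume.restrict Ω] g') : HasWeakGrad Ω f' g' := by
  refine ⟨h.1.congr hf, h.2.1.congr hg, fun φ hφ i => ?_⟩
  have e1 : ∫ x in Ω, f' x * fderiv ℝ φ x (EuclideanSpace.single i 1) =
      ∫ x in Ω, f x * fderiv ℝ φ x (EuclideanSpace.single i 1) :=
    integral_congr_ae (by filter_upwards [hf] with x hx; rw [hx])
  have e2 : ∫ x in Ω, g' x i * φ x = ∫ x in Ω, g x i * φ x :=
    integral_congr_ae (by filter_upwards [hg] with x hx; rw [hx])
  rw [e1, e2]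
  exact h.2.2 φ hφ i

theorem HasWeakGrad.add (hΩ : IsOpen Ω) {f f' : Sp N → ℝ} {g g' : Sp N → Sp N}
    (h : HasWeakGrad Ω f g) (h' : HasWeakGrad Ω f' g') :
    HasWeakGrad Ω (fun x => f x + f' x) (fun x => g x + g' x) := by
  refine ⟨h.1.add h'.1, h.2.1.add h'.2.1, fun φ hφ i => ?_⟩
  have hg := LocallyIntegrableOn.apply_coord h.2.1 i
  have hg' := LocallyIntegrableOn.apply_coord h'.2.1 i
  simp only [add_mul, PiLp.add_apply]
  rw [integral_add (integrableOn_mul_fderiv hΩ h.1 hφ _) (integrableOn_mul_fderiv hΩ h'.1 hφ _),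
    integral_add (integrableOn_mul_of_tsupport_subset hΩ hg hφ.continuous hφ.2.1 hφ.2.2)
      (integrableOn_mul_of_tsupport_subset hΩ hg' hφ.continuous hφ.2.1 hφ.2.2),
    h.2.2 φ hφ i, h'.2.2 φ hφ i, neg_add]

theorem HasWeakGrad.smul {f : Sp N → ℝ} {g : Sp N → Sp N} (h : HasWeakGrad Ω f g) (c : ℝ) :
    HasWeakGrad Ω (fun x => c • f x) (fun x => c • g x) := by
  refine ⟨h.1.smul c, h.2.1.smul c, fun φ hφ i => ?_⟩
  simp only [smul_eq_mul, PiLp.smul_apply, mul_assoc, integral_const_mul]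
  rw [h.2.2 φ hφ i, mul_neg]

theorem gradient_apply_coord (φ : Sp N → ℝ) (x : Sp N) (i : Fin N) :
    gradient φ x i = fderiv ℝ φ x (EuclideanSpace.single i 1) := by
  have h : inner ℝ (gradient φ x) (EuclideanSpace.single i (1 : ℝ)) =
      fderiv ℝ φ x (EuclideanSpace.single i 1) := by
    unfold gradient
    exact InnerProductSpace.toDual_symm_apply
  rw [← h, EuclideanSpace.inner_single_right]
  simp

theorem norm_gradient (φ : Sp N → ℝ) (x : Sp N) : ‖gradient φ x‖ = ‖fderiv ℝ φ x‖ := by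
  unfold gradient
  exact LinearIsometryEquiv.norm_map _ _

theorem IsTestFunction.continuous_gradient {φ : Sp N → ℝ} (hφ : IsTestFunction Ω φ) :
    Continuous (gradient φ) :=
  (LinearIsometryEquiv.continuous _).comp (hφ.1.continuous_fderiv (by simp))

theorem IsTestFunction.hasCompactSupport_gradient {φ : Sp N → ℝ} (hφ : IsTestFunction Ω φ) :
    HasCompactSupport (gradient φ) :=
  (hφ.2.1.fderiv (𝕜 := ℝ)).comp_left (map_zero _)

theorem IsTestFunction.hasWeakGrad {φ : Sp N → ℝ} (hφ : IsTestFunction Ω φ) :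
    HasWeakGrad Ω φ (gradient φ) := by
  refine ⟨(hφ.continuous.locallyIntegrable).locallyIntegrableOn _,
    (hφ.continuous_gradient.locallyIntegrable).locallyIntegrableOn _, fun ψ hψ i => ?_⟩
  simp only [gradient_apply_coord]
  rw [setIntegral_eq_integral_of_forall_compl_eq_zero,
    setIntegral_eq_integral_of_forall_compl_eq_zero]
  · refine integral_mul_fderiv_eq_neg_fderiv_mul_of_integrable ?_ ?_ ?_
      (fun x _ => (hφ.1.differentiable (by simp)).differentiableAt)
      (fun x _ => (hψ.1.differentiable (by simp)).differentiableAt)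
    · exact ((hφ.continuous_fderiv_apply _).mul hψ.continuous).integrable_of_hasCompactSupport
        hψ.2.1.mul_left
    · exact (hφ.continuous.mul (hψ.continuous_fderiv_apply _)).integrable_of_hasCompactSupport
        hφ.2.1.mul_right
    · exact (hφ.continuous.mul hψ.continuous).integrable_of_hasCompactSupport hφ.2.1.mul_right
  · intro x hx
    rw [image_eq_zero_of_notMem_tsupport fun h => hx (hψ.2.2 h), mul_zero]
  · intro x hx
    rw [image_eq_zero_of_notMem_tsupport fun h => hx (hφ.2.2 h), zero_mul]

end WeakGrad

/-! ### The space W_0^{1,p(·)} described by modulars -/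

section Sobolev

variable {N : ℕ} {Ω : Set (Sp N)} {p : Sp N → ℝ} {R : ℝ}

theorem memVarLp_of_continuous_of_hasCompactSupport (hp : IsExponent Ω p R) {F : Type}
    [NormedAddCommGroup F] {f : Sp N → F} (hf : Continuous f) (hc : HasCompactSupport f) :
    MemVarLp Ω p f := by
  have := hp.isFiniteMeasure
  obtain ⟨C, hC⟩ := hc.exists_bound_of_continuous hf
  refine ⟨hf.aestronglyMeasurable, ?_⟩
  refine lt_of_le_of_lt (b := ∫⁻ x in Ω, ENNReal.ofReal (1 + |C| ^ R)) (lintegral_mono_ae ?_) ?_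
  · filter_upwards [hp.ae] with x hx
    refine ENNReal.ofReal_le_ofReal ?_
    exact (Real.rpow_le_rpow (norm_nonneg _) ((hC x).trans (le_abs_self C)) (by linarith)).trans
      (rpow_le_one_add_rpow (abs_nonneg C) (by linarith) hx.2)
  · rw [lintegral_const]
    exact ENNReal.mul_lt_top ENNReal.ofReal_lt_top (measure_lt_top _ _)

theorem IsTestFunction.add {φ ψ : Sp N → ℝ} (hφ : IsTestFunction Ω φ)
    (hψ : IsTestFunction Ω ψ) : IsTestFunction Ω (fun x => φ x + ψ x) :=
  ⟨hφ.1.add hψ.1, hφ.2.1.add hψ.2.1, (tsupport_add φ ψ).trans (Set.union_subset hφ.2.2 hψ.2.2)⟩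

theorem IsTestFunction.const_smul {φ : Sp N → ℝ} (hφ : IsTestFunction Ω φ) (c : ℝ) :
    IsTestFunction Ω (fun x => c • φ x) :=
  ⟨hφ.1.const_smul c, hφ.2.1.smul_left (f := fun _ => c),
    (tsupport_smul_subset_right (fun _ => c) φ).trans hφ.2.2⟩

theorem IsTestFunction.gradient_add {φ ψ : Sp N → ℝ} (hφ : IsTestFunction Ω φ)
    (hψ : IsTestFunction Ω ψ) (x : Sp N) :
    gradient (fun x => φ x + ψ x) x = gradient φ x + gradient ψ x := by
  unfold gradient
  rw [← map_add, fderiv_fun_add (hφ.1.differentiable (by simp)).differentiableAt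
    (hψ.1.differentiable (by simp)).differentiableAt]

theorem IsTestFunction.gradient_const_smul {φ : Sp N → ℝ} (hφ : IsTestFunction Ω φ) (c : ℝ)
    (x : Sp N) : gradient (fun x => c • φ x) x = c • gradient φ x := by
  unfold gradient
  rw [fderiv_fun_const_smul (hφ.1.differentiable (by simp)).differentiableAt]
  simp

/-- `f` belongs to `W_0^{1,p(·)}(Ω)` with weak gradient `g`; the approximation by test functions
is expressed by modulars. -/
structure IsSobolevZero (Ω : Set (Sp N)) (p : Sp N → ℝ) (f : Sp N → ℝ) (g : Sp N → Sp N) :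
    Prop where
  mem : MemVarLp Ω p f
  hasWeakGrad : HasWeakGrad Ω f g
  mem_grad : MemVarLp Ω p g
  approx : ∀ ε : ℝ, 0 < ε → ∃ φ : Sp N → ℝ, IsTestFunction Ω φ ∧
    modular Ω p (fun x => f x - φ x) ≤ ENNReal.ofReal ε ∧
    modular Ω p (fun x => g x - gradient φ x) ≤ ENNReal.ofReal ε

theorem IsSobolevZero.congr {f f' : Sp N → ℝ} {g g' : Sp N → Sp N}
    (h : IsSobolevZero Ω p f g) (hf : f =ᵐ[volume.restrict Ω] f')
    (hg : g =ᵐ[volume.restrict Ω] g') : IsSobolevZero Ω p f' g' := by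
  refine ⟨h.mem.congr hf, h.hasWeakGrad.congr hf hg, h.mem_grad.congr hg, fun ε hε => ?_⟩
  obtain ⟨φ, hφ, h1, h2⟩ := h.approx ε hε
  refine ⟨φ, hφ, ?_, ?_⟩
  · rwa [modular_congr (g := fun x => f x - φ x)]
    filter_upwards [hf] with x hx
    rw [hx]
  · rwa [modular_congr (g := fun x => g x - gradient φ x)]
    filter_upwards [hg] with x hx
    rw [hx]

theorem IsTestFunction.isSobolevZero (hp : IsExponent Ω p R) {φ : Sp N → ℝ}
    (hφ : IsTestFunction Ω φ) : IsSobolevZero Ω p φ (gradient φ) := by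
  refine ⟨memVarLp_of_continuous_of_hasCompactSupport hp hφ.continuous hφ.2.1, hφ.hasWeakGrad,
    memVarLp_of_continuous_of_hasCompactSupport hp hφ.continuous_gradient
      hφ.hasCompactSupport_gradient, fun ε _ => ⟨φ, hφ, ?_, ?_⟩⟩
  all_goals
    refine le_trans (le_of_eq ?_) zero_le
    rw [modular, lintegral_eq_zero_iff']
    · filter_upwards [hp.ae] with x hx
      simp [Real.zero_rpow (by linarith : p x ≠ 0)]
    · refine (AEMeasurable.congr (f := fun _ => (0 : ENNReal)) aemeasurable_const ?_)
      filter_upwards [hp.ae] with x hx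
      simp [Real.zero_rpow (by linarith : p x ≠ 0)]

theorem IsSobolevZero.add (hp : IsExponent Ω p R) {f f' : Sp N → ℝ} {g g' : Sp N → Sp N}
    (h : IsSobolevZero Ω p f g) (h' : IsSobolevZero Ω p f' g') :
    IsSobolevZero Ω p (fun x => f x + f' x) (fun x => g x + g' x) := by
  refine ⟨h.mem.add hp h'.mem, h.hasWeakGrad.add hp.isOpen h'.hasWeakGrad,
    h.mem_grad.add hp h'.mem_grad, fun ε hε => ?_⟩
  have hR : (0 : ℝ) < 2 ^ R := by positivity
  have aux : ∀ {A B : ENNReal}, A ≤ ENNReal.ofReal (ε / (2 * 2 ^ R)) →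
      B ≤ ENNReal.ofReal (ε / (2 * 2 ^ R)) →
      ENNReal.ofReal (2 ^ R) * (A + B) ≤ ENNReal.ofReal ε := by
    intro A B hA hB
    refine (mul_le_mul_right (add_le_add hA hB) _).trans ?_
    rw [← ENNReal.ofReal_add (by positivity) (by positivity), ← ENNReal.ofReal_mul hR.le]
    exact ENNReal.ofReal_le_ofReal (le_of_eq (by field_simp; norm_num))
  obtain ⟨φ, hφ, h1, h2⟩ := h.approx (ε / (2 * 2 ^ R)) (by positivity)
  obtain ⟨φ', hφ', h1', h2'⟩ := h'.approx (ε / (2 * 2 ^ R)) (by positivity)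
  refine ⟨_, hφ.add hφ', ?_, ?_⟩
  · refine le_trans ?_ (aux h1 h1')
    have := modular_add_le hp (f := fun x => f x - φ x) (fun x => f' x - φ' x)
      (h.mem.1.sub hφ.continuous.aestronglyMeasurable)
    simpa only [sub_add_sub_comm] using this
  · refine le_trans ?_ (aux h2 h2')
    have := modular_add_le hp (f := fun x => g x - gradient φ x)
      (fun x => g' x - gradient φ' x)
      (h.mem_grad.1.sub hφ.continuous_gradient.aestronglyMeasurable)
    simpa only [sub_add_sub_comm, hφ.gradient_add hφ'] using this

theorem IsSobolevZero.smul (hp : IsExponent Ω p R) {f : Sp N → ℝ} {g : Sp N → Sp N}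
    (h : IsSobolevZero Ω p f g) (c : ℝ) :
    IsSobolevZero Ω p (fun x => c • f x) (fun x => c • g x) := by
  refine ⟨h.mem.smul hp c, h.hasWeakGrad.smul c, h.mem_grad.smul hp c, fun ε hε => ?_⟩
  have hR : (0 : ℝ) < 1 + |c| ^ R := by positivity
  have aux : ∀ {A : ENNReal}, A ≤ ENNReal.ofReal (ε / (1 + |c| ^ R)) →
      ENNReal.ofReal (1 + |c| ^ R) * A ≤ ENNReal.ofReal ε := by
    intro A hA
    refine (mul_le_mul_right hA _).trans ?_
    rw [← ENNReal.ofReal_mul hR.le]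
    exact ENNReal.ofReal_le_ofReal (le_of_eq (by field_simp))
  obtain ⟨φ, hφ, h1, h2⟩ := h.approx (ε / (1 + |c| ^ R)) (by positivity)
  refine ⟨_, hφ.const_smul c, ?_, ?_⟩
  · refine le_trans ?_ (aux h1)
    simpa only [smul_sub] using modular_smul_le hp (fun x => f x - φ x) c
  · refine le_trans ?_ (aux h2)
    simpa only [smul_sub, hφ.gradient_const_smul] using
      modular_smul_le hp (fun x => g x - gradient φ x) c

theorem IsSobolevZero.sobolevNorm_le (hp : IsExponent Ω p R) {f : Sp N → ℝ} {g : Sp N → Sp N}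
    (h : HasWeakGrad Ω f g) {κ : ℝ} (h0 : 0 < κ) (h1 : κ ≤ 1)
    (hf : modular Ω p f ≤ ENNReal.ofReal (κ ^ R))
    (hg : modular Ω p g ≤ ENNReal.ofReal (κ ^ R)) : sobolevNorm Ω p f ≤ κ + κ := by
  refine add_le_add (luxNorm_le_of_modular_le hp h0 h1 hf) ?_
  rw [luxNorm_congr (h.weakGrad_ae_eq hp.isOpen)]
  exact luxNorm_le_of_modular_le hp h0 h1 hg

theorem HasWeakGrad.sub_test (hΩ : IsOpen Ω) {f φ : Sp N → ℝ} {g : Sp N → Sp N}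
    (h : HasWeakGrad Ω f g) (hφ : IsTestFunction Ω φ) :
    HasWeakGrad Ω (fun x => f x - φ x) (fun x => g x - gradient φ x) := by
  have := h.add hΩ (hφ.hasWeakGrad.smul (-1))
  simpa only [neg_smul, one_smul, ← sub_eq_add_neg] using this

theorem IsSobolevZero.mem_W0 (hp : IsExponent Ω p R) {u : MeasFun Ω} {g : Sp N → Sp N}
    (h : IsSobolevZero Ω p u g) : u ∈ W0 Ω p := by
  refine ⟨⟨h.mem, g, h.hasWeakGrad, h.mem_grad⟩, fun ε hε => ?_⟩
  -- Each of the two Luxemburg norms will be at most κ, and 2ε/3 < ε.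
  set κ := min 1 (ε / 3) with hκ
  have h0 : 0 < κ := lt_min one_pos (by positivity)
  obtain ⟨φ, hφ, h1, h2⟩ := h.approx (κ ^ R) (by positivity)
  refine ⟨φ, hφ, ?_⟩
  have := IsSobolevZero.sobolevNorm_le hp (h.hasWeakGrad.sub_test hp.isOpen hφ) h0
    (min_le_left _ _) h1 h2
  have := min_le_right 1 (ε / 3)
  linarith

/-- Converse of `IsSobolevZero.mem_W0`. From here on the norm is needed only for the distance to the
minimizer; all other arguments use modulars, which behave well under integration. -/
theorem isSobolevZero_of_mem_W0 (hp : IsExponent Ω p R) {u : MeasFun Ω} (hu : u ∈ W0 Ω p) :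
    IsSobolevZero Ω p u (weakGrad Ω u) := by
  obtain ⟨⟨h1, g, h2, h3⟩, h4⟩ := hu
  have hg := h2.weakGrad_ae_eq hp.isOpen
  have hG := h2.hasWeakGrad_weakGrad
  refine ⟨h1, hG, h3.congr hg.symm, fun ε hε => ?_⟩
  set κ := min 1 ε with hκ
  have h0 : 0 < κ := lt_min one_pos hε
  obtain ⟨φ, hφ, h⟩ := h4 κ h0
  have hT := hφ.isSobolevZero hp
  have hsub := hG.sub_test hp.isOpen hφ
  unfold sobolevNorm at h
  rw [luxNorm_congr (hsub.weakGrad_ae_eq hp.isOpen)] at h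
  have m1 : MemVarLp Ω p (fun x => u x - φ x) := by
    simpa only [neg_smul, one_smul, ← sub_eq_add_neg] using h1.add hp (hT.mem.smul hp (-1))
  have m2 : MemVarLp Ω p (fun x => weakGrad Ω u x - gradient φ x) := by
    simpa only [neg_smul, one_smul, ← sub_eq_add_neg] using
      (h3.congr hg.symm).add hp (hT.mem_grad.smul hp (-1))
  have n1 := luxNorm_nonneg (Ω := Ω) (p := p) (fun x => u x - φ x)
  have n2 := luxNorm_nonneg (Ω := Ω) (p := p) (fun x => weakGrad Ω u x - gradient φ x)
  refine ⟨φ, hφ, ?_, ?_⟩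
  · exact (modular_le_of_luxNorm_lt hp m1 (min_le_left _ _) (by linarith)).trans
      (ENNReal.ofReal_le_ofReal (min_le_right _ _))
  · exact (modular_le_of_luxNorm_lt hp m2 (min_le_left _ _) (by linarith)).trans
      (ENNReal.ofReal_le_ofReal (min_le_right _ _))

end Sobolev

/-! ### The subcritical Sobolev embedding with variable exponents -/

section Embedding

variable {N : ℕ} {Ω : Set (Sp N)} {p q : Sp N → ℝ} {R S : ℝ}

/-- The exponent whose Sobolev conjugate is q₀ is (1/n + 1/q₀)⁻¹, and subcriticality says that it
lies below p₀. Any P strictly between it (or 1, if larger) and min(p₀, n) leaves room on both sides,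
so that the variable exponents may move a little around p₀ and q₀. -/
theorem exists_sobolev_conjugate_between {n p₀ q₀ : ℝ} (hn : 1 < n) (hp : 1 < p₀) (hq : 0 < q₀)
    (h : p₀ < n → q₀ < n * p₀ / (n - p₀)) :
    ∃ P Q : ℝ, 1 ≤ P ∧ P < p₀ ∧ P < n ∧ q₀ < Q ∧ Q⁻¹ = P⁻¹ - n⁻¹ := by
  have hn0 : 0 < n := by linarith
  have hs : 0 < n⁻¹ + q₀⁻¹ := by positivity
  have key : (n⁻¹ + q₀⁻¹)⁻¹ < min p₀ n := by
    rw [lt_min_iff]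
    constructor
    · rw [inv_lt_comm₀ hs (by linarith)]
      rcases lt_or_ge p₀ n with hlt | hge
      · have h1 := h hlt
        have h2 : 0 < n - p₀ := by linarith
        rw [lt_div_iff₀ h2] at h1
        rw [← sub_pos]
        have : n⁻¹ + q₀⁻¹ - p₀⁻¹ = (n * p₀ - q₀ * (n - p₀)) / (n * p₀ * q₀) := by
          field_simp; ring
        rw [this]
        exact div_pos (by linarith) (by positivity)
      · have : p₀⁻¹ ≤ n⁻¹ := inv_anti₀ hn0 hge
        have : 0 < q₀⁻¹ := by positivity
        linarith
    · rw [inv_lt_comm₀ hs hn0]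
      have : 0 < q₀⁻¹ := by positivity
      linarith
  obtain ⟨P, hP1, hP2⟩ := exists_between (max_lt (lt_min hp hn) key)
  rw [max_lt_iff] at hP1
  rw [lt_min_iff] at hP2
  have hP0 : 0 < P := by linarith
  have h1 : n⁻¹ < P⁻¹ := inv_strictAnti₀ hP0 hP2.2
  have h2 : P⁻¹ < n⁻¹ + q₀⁻¹ := by
    rw [inv_lt_comm₀ hP0 hs]; exact hP1.2
  refine ⟨P, (P⁻¹ - n⁻¹)⁻¹, hP1.1.le, hP2.1, hP2.2, ?_, inv_inv _⟩
  rw [lt_inv_comm₀ hq (by linarith)]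
  linarith

theorem enorm_rpow_eq_ofReal {F : Type*} [NormedAddCommGroup F] (y : F) {r : ℝ} (hr : 0 ≤ r) :
    ‖y‖ₑ ^ r = ENNReal.ofReal (‖y‖ ^ r) := by
  rw [← ofReal_norm, ENNReal.ofReal_rpow_of_nonneg (norm_nonneg _) hr]

theorem norm_fderiv_bump_mul_le {φ : Sp N → ℝ} (hφ : IsTestFunction Ω φ) {c : Sp N}
    (η : ContDiffBump c) {D : ℝ} (hD : ∀ x, ‖fderiv ℝ η x‖ ≤ D) (x : Sp N) :
    ‖fderiv ℝ (fun y => η y * φ y) x‖ ≤ ‖gradient φ x‖ + D * |φ x| := by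
  rw [fderiv_fun_mul (η.contDiff (n := 1)).contDiffAt.differentiableAt_one
    (hφ.1.differentiable (by simp)).differentiableAt, norm_gradient]
  refine (norm_add_le _ _).trans (add_le_add ?_ ?_)
  · rw [norm_smul, Real.norm_eq_abs, abs_of_nonneg η.nonneg]
    exact mul_le_of_le_one_left (norm_nonneg _) η.le_one
  · rw [norm_smul, Real.norm_eq_abs, mul_comm]
    exact mul_le_mul_of_nonneg_right (hD x) (abs_nonneg _)

/-- Local form of the subcritical Sobolev embedding near a point of `closure Ω`. -/
theorem exists_local_modular_bound (hN : 2 ≤ N) (hp : IsExponent Ω p R) {c : Sp N} {P Q ρ : ℝ}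
    (hρ : 0 < ρ) (hP1 : 1 ≤ P) (hPN : P < N) (hPQ : Q⁻¹ = P⁻¹ - (N : ℝ)⁻¹)
    (hloc : ∀ x ∈ Ω, x ∈ Metric.ball c ρ → P ≤ p x ∧ 0 ≤ q x ∧ q x ≤ Q) (M : ENNReal)
    (hM : M ≠ ⊤) :
    ∃ C : ENNReal, C ≠ ⊤ ∧ ∀ φ : Sp N → ℝ, IsTestFunction Ω φ → modular Ω p φ ≤ M →
      modular Ω p (gradient φ) ≤ M →
      ∫⁻ x in Ω ∩ Metric.ball c (ρ / 4), ENNReal.ofReal (‖φ x‖ ^ q x) ≤ C := by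
  have hQ0 : 0 < Q := by
    rw [← inv_pos, hPQ, sub_pos]
    exact inv_strictAnti₀ (by linarith) hPN
  -- A cutoff equal to 1 on the ball of radius ρ/4 and supported in the closed ball of radius ρ/2,
  -- well inside the ball where P ≤ p and q ≤ Q.
  set η : ContDiffBump c := ⟨ρ / 4, ρ / 2, by positivity, by linarith⟩ with hη
  obtain ⟨D', hD'⟩ := ((η.hasCompactSupport).fderiv (𝕜 := ℝ)).exists_bound_of_continuous
    ((η.contDiff (n := 1)).continuous_fderiv (by simp))
  set D := |D'|
  have hD : ∀ x, ‖fderiv ℝ η x‖ ≤ D := fun x => (hD' x).trans (le_abs_self _)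
  have hD0 : 0 ≤ D := abs_nonneg _
  lift P to NNReal using (by linarith)
  lift Q to NNReal using hQ0.le
  set K := SNormLESNormFDerivOfEqConst ℝ (volume : Measure (Sp N)) (P : ℝ)
  -- With |∇(ηφ)| ≤ |∇φ| + D|φ| and y^P ≤ 1 + y^{p(x)}, the P-th power of |∇(ηφ)| is at most A (2 +
  -- |φ|^{p(x)} + |∇φ|^{p(x)}) on Ω; integrating gives the bound B.
  set A : ℝ := 2 ^ (P : ℝ) * (1 + D ^ (P : ℝ)) with hA
  have hA0 : 0 ≤ A := by positivity
  have hDA : D ^ (P : ℝ) ≤ 1 + D ^ (P : ℝ) := by linarith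
  set B : ENNReal := ENNReal.ofReal A * (ENNReal.ofReal 2 * volume Ω + M + M) with hB
  have hBt : B ≠ ⊤ := by
    refine ENNReal.mul_ne_top ENNReal.ofReal_ne_top ?_
    exact ENNReal.add_ne_top.2 ⟨ENNReal.add_ne_top.2
      ⟨ENNReal.mul_ne_top ENNReal.ofReal_ne_top hp.finite.ne, hM⟩, hM⟩
  have hP0 : (P : ℝ) ≠ 0 := by intro h; rw [h] at hP1; linarith
  refine ⟨volume Ω + (K * B ^ ((P : ℝ)⁻¹)) ^ (Q : ℝ), ?_, ?_⟩
  · refine ENNReal.add_ne_top.2 ⟨hp.finite.ne, ENNReal.rpow_ne_top_of_nonneg hQ0.le ?_⟩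
    exact ENNReal.mul_ne_top ENNReal.coe_ne_top (ENNReal.rpow_ne_top_of_nonneg (by positivity) hBt)
  intro φ hφ h1 h2
  set ψ : Sp N → ℝ := fun y => η y * φ y with hψ
  have hψ1 : ContDiff ℝ 1 ψ := (η.contDiff (n := 1)).mul (hφ.1.of_le (by simp))
  have hψc : HasCompactSupport ψ := hφ.2.1.mul_left
  have gns : eLpNorm ψ Q volume ≤ K * eLpNorm (fderiv ℝ ψ) P volume := by
    refine eLpNorm_le_eLpNorm_fderiv_of_eq volume hψ1 hψc (by exact_mod_cast hP1) ?_ ?_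
    · rw [finrank_euclideanSpace_fin]; omega
    · rw [finrank_euclideanSpace_fin, hPQ]; simp
  have hgrad : ∫⁻ x, ‖fderiv ℝ ψ x‖ₑ ^ (P : ℝ) ≤ B := by
    have hpt : ∀ x, ‖fderiv ℝ ψ x‖ₑ ^ (P : ℝ) ≤ Ω.indicator (fun x => ENNReal.ofReal A *
        (ENNReal.ofReal 2 + ENNReal.ofReal (‖φ x‖ ^ p x) +
          ENNReal.ofReal (‖gradient φ x‖ ^ p x))) x := by
      intro x
      refine (enorm_rpow_eq_ofReal (fderiv ℝ ψ x) P.coe_nonneg).le.trans ?_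
      by_cases hx : x ∈ Ω ∩ Metric.ball c ρ
      · rw [Set.indicator_of_mem hx.1,
          ← ENNReal.ofReal_add (by positivity) (by positivity),
          ← ENNReal.ofReal_add (by positivity) (by positivity), ← ENNReal.ofReal_mul hA0]
        refine ENNReal.ofReal_le_ofReal ?_
        have e1 : ‖fderiv ℝ ψ x‖ ≤ ‖‖gradient φ x‖ + D * |φ x|‖ := by
          rw [Real.norm_of_nonneg (by positivity)]
          exact norm_fderiv_bump_mul_le hφ η hD x
        have e2 := norm_add_rpow_le (‖gradient φ x‖) (D * |φ x|) P.coe_nonneg le_rfl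
        have e3 : ‖D * |φ x|‖ ^ (P : ℝ) = D ^ (P : ℝ) * ‖φ x‖ ^ (P : ℝ) := by
          rw [Real.norm_of_nonneg (by positivity), Real.mul_rpow hD0 (abs_nonneg _),
            Real.norm_eq_abs]
        have e4 := rpow_le_one_add_rpow (norm_nonneg (φ x)) P.coe_nonneg (hloc x hx.1 hx.2).1
        have e5 := rpow_le_one_add_rpow (norm_nonneg (gradient φ x)) P.coe_nonneg (hloc x hx.1 hx.2).1
        rw [e3, norm_norm] at e2
        refine (Real.rpow_le_rpow (norm_nonneg _) e1 P.coe_nonneg).trans (e2.trans ?_)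
        rw [hA, mul_assoc]
        refine mul_le_mul_of_nonneg_left ?_ (by positivity)
        calc ‖gradient φ x‖ ^ (P : ℝ) + D ^ (P : ℝ) * ‖φ x‖ ^ (P : ℝ)
            ≤ (1 + D ^ (P : ℝ)) * (1 + ‖gradient φ x‖ ^ p x)
              + (1 + D ^ (P : ℝ)) * (1 + ‖φ x‖ ^ p x) := by
              refine add_le_add (e5.trans ?_) ?_
              · exact le_mul_of_one_le_left (by positivity)
                  (le_add_of_nonneg_right (by positivity))
              · exact mul_le_mul hDA e4 (by positivity) (by positivity)
          _ = _ := by ring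
      -- The support of ηφ lies in the support of φ, hence in Ω, and in the closed ball of radius
      -- ρ/2; elsewhere the derivative vanishes.
      · have : x ∉ tsupport ψ := by
          intro hmem
          refine hx ⟨hφ.2.2 (tsupport_mul_subset_right hmem), ?_⟩
          have := tsupport_mul_subset_left hmem
          rw [η.tsupport_eq] at this
          exact Metric.closedBall_subset_ball (by simp only [hη]; linarith) this
        rw [image_eq_zero_of_notMem_tsupport fun h => this (tsupport_fderiv_subset ℝ h), norm_zero,
          Real.zero_rpow hP0, ENNReal.ofReal_zero]
        exact zero_le
    have hmeas : AEMeasurable (fun x => ENNReal.ofReal 2 + ENNReal.ofReal (‖φ x‖ ^ p x))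
        (volume.restrict Ω) := aemeasurable_const.add
      (hp.aemeasurable_rpow hφ.continuous.aestronglyMeasurable).ennreal_ofReal
    refine (lintegral_mono hpt).trans ?_
    rw [lintegral_indicator hp.isOpen.measurableSet, lintegral_const_mul' _ _ ENNReal.ofReal_ne_top,
      lintegral_add_left' hmeas, lintegral_add_left' aemeasurable_const, setLIntegral_const]
    exact mul_le_mul_right (add_le_add (add_le_add le_rfl h1) h2) _
  have hψQ : ∫⁻ x, ‖ψ x‖ₑ ^ (Q : ℝ) ≤ (K * B ^ ((P : ℝ)⁻¹)) ^ (Q : ℝ) := by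
    have hQ : Q ≠ 0 := by intro h; rw [h] at hQ0; simp at hQ0
    rw [← eLpNorm_nnreal_pow_eq_lintegral hQ]
    refine ENNReal.rpow_le_rpow (gns.trans (mul_le_mul_right ?_ _)) hQ0.le
    rw [ENNReal.le_rpow_inv_iff (by positivity), eLpNorm_nnreal_pow_eq_lintegral (by
      exact_mod_cast hP0)]
    exact hgrad
  calc ∫⁻ x in Ω ∩ Metric.ball c (ρ / 4), ENNReal.ofReal (‖φ x‖ ^ q x)
      ≤ ∫⁻ x in Ω ∩ Metric.ball c (ρ / 4), (1 + ‖ψ x‖ₑ ^ (Q : ℝ)) := by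
        refine setLIntegral_mono' (hp.isOpen.measurableSet.inter measurableSet_ball) ?_
        intro x hx
        have hη1 : η x = 1 := η.one_of_mem_closedBall (Metric.ball_subset_closedBall hx.2)
        have hl := hloc x hx.1 (Metric.ball_subset_ball (by linarith) hx.2)
        rw [enorm_rpow_eq_ofReal _ hQ0.le, ← ENNReal.ofReal_one,
          ← ENNReal.ofReal_add (by positivity) (by positivity), hψ]
        refine ENNReal.ofReal_le_ofReal ?_
        simp only [hη1, one_mul]
        exact rpow_le_one_add_rpow (norm_nonneg _) hl.2.1 hl.2.2
    _ = volume (Ω ∩ Metric.ball c (ρ / 4)) +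
          ∫⁻ x in Ω ∩ Metric.ball c (ρ / 4), ‖ψ x‖ₑ ^ (Q : ℝ) := by
        rw [lintegral_add_left' aemeasurable_const, setLIntegral_const, one_mul]
    _ ≤ _ := add_le_add (measure_mono Set.inter_subset_left)
        ((setLIntegral_le_lintegral _ _).trans hψQ)

/-- The subcritical Sobolev embedding for test functions, in modular form. -/
theorem exists_modular_bound (hN : 2 ≤ N) (hp : IsExponent Ω p R) (hb : Bornology.IsBounded Ω)
    (hpc : ContinuousOn p (closure Ω)) (hqc : ContinuousOn q (closure Ω))
    (hp1 : ∀ x ∈ closure Ω, 1 < p x) (hpq : ∀ x ∈ closure Ω, p x < q x)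
    (hcrit : ∀ x ∈ closure Ω, p x < N → q x < N * p x / (N - p x)) (M : ENNReal) (hM : M ≠ ⊤) :
    ∃ C : ENNReal, C ≠ ⊤ ∧ ∀ φ : Sp N → ℝ, IsTestFunction Ω φ → modular Ω p φ ≤ M →
      modular Ω p (gradient φ) ≤ M → modular Ω q φ ≤ C := by
  -- Constant exponents P < p(c) and Q > q(c) chosen at the point c still separate p and q on a
  -- small ball, by continuity. Compactness of the closure then leaves finitely many balls.
  have hloc : ∀ c ∈ closure Ω, ∃ ρ : ℝ, 0 < ρ ∧ ∃ C : ENNReal, C ≠ ⊤ ∧ ∀ φ : Sp N → ℝ,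
      IsTestFunction Ω φ → modular Ω p φ ≤ M → modular Ω p (gradient φ) ≤ M →
      ∫⁻ x in Ω ∩ Metric.ball c ρ, ENNReal.ofReal (‖φ x‖ ^ q x) ≤ C := by
    intro c hc
    have hn : (1 : ℝ) < N := by exact_mod_cast hN
    have h1 := hp1 c hc
    have h2 := hpq c hc
    obtain ⟨P, Q, hP1, hPp, hPN, hqQ, hPQ⟩ :=
      exists_sobolev_conjugate_between hn h1 (by linarith) (hcrit c hc)
    have ev := ((hpc c hc).eventually (lt_mem_nhds hPp)).and
      ((hqc c hc).eventually (gt_mem_nhds hqQ))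
    obtain ⟨ρ, hρ, hball⟩ := Metric.mem_nhdsWithin_iff.1 ev
    obtain ⟨C, hC, h⟩ := exists_local_modular_bound (q := q) (c := c) hN hp hρ hP1 hPN hPQ
      (fun x hx hxb => by
        have hxc := subset_closure hx
        have h3 := hball ⟨hxb, hxc⟩
        have h4 := hp1 x hxc
        have h5 := hpq x hxc
        exact ⟨h3.1.le, by linarith, h3.2.le⟩) M hM
    exact ⟨ρ / 4, by positivity, C, hC, h⟩
  choose! ρ hρ C hC hφC using hloc
  obtain ⟨t, ht, hcov⟩ := (hb.isCompact_closure).elim_nhds_subcover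
    (fun c => Metric.ball c (ρ c)) fun c hc => Metric.ball_mem_nhds c (hρ c hc)
  refine ⟨∑ c : t, C c, ENNReal.sum_ne_top.2 fun c _ => hC c (ht c c.2), fun φ hφ h1 h2 => ?_⟩
  have hsub : Ω ⊆ ⋃ c : t, Ω ∩ Metric.ball c (ρ c) := by
    intro x hx
    have := hcov (subset_closure hx)
    simp only [Set.mem_iUnion] at this ⊢
    obtain ⟨c, hc, hxc⟩ := this
    exact ⟨⟨c, hc⟩, hx, hxc⟩
  calc modular Ω q φ ≤ ∫⁻ x in ⋃ c : t, Ω ∩ Metric.ball c (ρ c),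
        ENNReal.ofReal (‖φ x‖ ^ q x) := lintegral_mono_set hsub
    _ ≤ ∑' c : t, ∫⁻ x in Ω ∩ Metric.ball c (ρ c), ENNReal.ofReal (‖φ x‖ ^ q x) :=
        lintegral_iUnion_le _ _
    _ = ∑ c : t, ∫⁻ x in Ω ∩ Metric.ball c (ρ c), ENNReal.ofReal (‖φ x‖ ^ q x) :=
        tsum_fintype _
    _ ≤ ∑ c : t, C c := Finset.sum_le_sum fun c _ => hφC c (ht c c.2) φ hφ h1 h2

/-- The modulars are summable, so the series of the integrands is finite almost everywhere and its
terms tend to 0; taking p(x)-th roots finishes. The geometric rate avoids passing to a subsequence.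
-/
theorem tendsto_zero_of_modular_le (hp : IsExponent Ω p R) {f : ℕ → Sp N → ℝ}
    (hf : ∀ n, AEStronglyMeasurable (f n) (volume.restrict Ω))
    (h : ∀ n, modular Ω p (f n) ≤ (2⁻¹ : ENNReal) ^ n) :
    ∀ᵐ x ∂(volume.restrict Ω), Filter.Tendsto (fun n => f n x) Filter.atTop (nhds 0) := by
  have hm : ∀ n, AEMeasurable (fun x => ENNReal.ofReal (‖f n x‖ ^ p x)) (volume.restrict Ω) :=
    fun n => (hp.aemeasurable_rpow (hf n)).ennreal_ofReal
  have hsum : ∫⁻ x in Ω, ∑' n, ENNReal.ofReal (‖f n x‖ ^ p x) ≠ ⊤ := by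
    rw [lintegral_tsum hm]
    refine ne_top_of_le_ne_top ?_ (ENNReal.tsum_le_tsum h)
    rw [ENNReal.tsum_geometric]
    simp
  filter_upwards [ae_lt_top' (AEMeasurable.tsum hm) hsum, hp.ae] with x hx hpx
  have h1 := ENNReal.tendsto_atTop_zero_of_tsum_ne_top hx.ne
  have h2 : Filter.Tendsto (fun n => ‖f n x‖ ^ p x) Filter.atTop (nhds 0) := by
    have := (ENNReal.tendsto_toReal ENNReal.zero_ne_top).comp h1
    simpa [Function.comp_def, ENNReal.toReal_ofReal (Real.rpow_nonneg (abs_nonneg _) _)]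
      using this
  have h3 := h2.rpow_const (p := (p x)⁻¹) (Or.inr (inv_nonneg.2 (by linarith)))
  rw [Real.zero_rpow (inv_ne_zero (by linarith))] at h3
  rw [tendsto_zero_iff_norm_tendsto_zero]
  refine h3.congr fun n => ?_
  rw [← Real.rpow_mul (norm_nonneg _), mul_inv_cancel₀ (by linarith), Real.rpow_one]

/-- A function of `W_0^{1,p(·)}` is the almost everywhere limit of test functions which are bounded
in `W^{1,p(·)}`. -/
theorem IsSobolevZero.exists_seq (hp : IsExponent Ω p R) {f : Sp N → ℝ} {g : Sp N → Sp N}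
    (h : IsSobolevZero Ω p f g) :
    ∃ (φ : ℕ → Sp N → ℝ) (M : ENNReal), M ≠ ⊤ ∧ (∀ n, IsTestFunction Ω (φ n)) ∧
      (∀ n, modular Ω p (φ n) ≤ M) ∧ (∀ n, modular Ω p (gradient (φ n)) ≤ M) ∧
      ∀ᵐ x ∂(volume.restrict Ω),
        Filter.Tendsto (fun n => φ n x) Filter.atTop (nhds (f x)) := by
  have h2n : ∀ n : ℕ, ENNReal.ofReal ((2⁻¹ : ℝ) ^ n) = 2⁻¹ ^ n := fun n => by
    rw [ENNReal.ofReal_pow (by norm_num), ENNReal.ofReal_inv_of_pos (by norm_num)]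
    simp
  have := fun n : ℕ => h.approx ((2⁻¹ : ℝ) ^ n) (by positivity)
  choose φ hφ h1 h2 using this
  simp only [h2n] at h1 h2
  have hle : ∀ n : ℕ, (2⁻¹ : ENNReal) ^ n ≤ 1 := fun n =>
    pow_le_one₀ zero_le (ENNReal.inv_le_one.2 (by norm_num))
  have hneg : ∀ {F : Type} [NormedAddCommGroup F] (v w : Sp N → F),
      modular Ω p (fun x => w x - v x) = modular Ω p (fun x => v x - w x) := by
    intro F _ v w
    unfold modular
    simp only [norm_sub_rev]
  set M₁ := ENNReal.ofReal (2 ^ R) * (modular Ω p f + 1)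
  set M₂ := ENNReal.ofReal (2 ^ R) * (modular Ω p g + 1)
  refine ⟨φ, M₁ + M₂, ?_, hφ, fun n => ?_, fun n => ?_, ?_⟩
  · refine ENNReal.add_ne_top.2 ⟨?_, ?_⟩ <;>
    refine ENNReal.mul_ne_top ENNReal.ofReal_ne_top (ENNReal.add_ne_top.2 ⟨?_, by simp⟩)
    · exact h.mem.2.ne
    · exact h.mem_grad.2.ne
  · have := modular_add_le hp (fun x => φ n x - f x) h.mem.1
    simp only [add_sub_cancel] at this
    rw [hneg] at this
    refine this.trans (le_trans ?_ le_self_add)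
    exact mul_le_mul_right (add_le_add le_rfl ((h1 n).trans (hle n))) _
  · have := modular_add_le hp (fun x => gradient (φ n) x - g x) h.mem_grad.1
    simp only [add_sub_cancel] at this
    rw [hneg] at this
    refine this.trans (le_trans ?_ le_add_self)
    exact mul_le_mul_right (add_le_add le_rfl ((h2 n).trans (hle n))) _
  · filter_upwards [tendsto_zero_of_modular_le hp
      (fun n => h.mem.1.sub (hφ n).continuous.aestronglyMeasurable) h1] with x hx
    simpa using (tendsto_const_nhds (x := f x)).sub hx

/-- The modular bound for test functions passes to the almost everywhere limit by Fatou's lemma. -/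
theorem IsSobolevZero.memVarLp_of_subcritical (hN : 2 ≤ N) (hp : IsExponent Ω p R)
    (hq : IsExponent Ω q S) (hb : Bornology.IsBounded Ω)
    (hpc : ContinuousOn p (closure Ω)) (hqc : ContinuousOn q (closure Ω))
    (hp1 : ∀ x ∈ closure Ω, 1 < p x) (hpq : ∀ x ∈ closure Ω, p x < q x)
    (hcrit : ∀ x ∈ closure Ω, p x < N → q x < N * p x / (N - p x))
    {f : Sp N → ℝ} {g : Sp N → Sp N} (h : IsSobolevZero Ω p f g) : MemVarLp Ω q f := by
  refine ⟨h.mem.1, ?_⟩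
  obtain ⟨φ, M, hM, hφ, h1, h2, hlim⟩ := h.exists_seq hp
  obtain ⟨C, hC, hbound⟩ := exists_modular_bound hN hp hb hpc hqc hp1 hpq hcrit M hM
  have hle : modular Ω q f ≤ C := by
    calc modular Ω q f
        = ∫⁻ x in Ω, Filter.liminf (fun n => ENNReal.ofReal (‖φ n x‖ ^ q x)) Filter.atTop := by
          refine lintegral_congr_ae ?_
          filter_upwards [hlim, hq.ae] with x hx hqx
          refine (Filter.Tendsto.liminf_eq ?_).symm
          exact (ENNReal.continuous_ofReal.tendsto _).comp
            (hx.norm.rpow_const (Or.inr (by linarith)))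
      _ ≤ Filter.liminf (fun n => modular Ω q (φ n)) Filter.atTop :=
          lintegral_liminf_le' fun n => (hq.aemeasurable_rpow
            (hφ n).continuous.aestronglyMeasurable).ennreal_ofReal
      _ ≤ C := by
          refine Filter.liminf_le_of_le (by isBoundedDefault) fun b hb' => ?_
          obtain ⟨n, hn⟩ := hb'.exists
          exact hn.trans (hbound (φ n) (hφ n) (h1 n) (h2 n))
  exact hle.trans_lt hC.lt_top

end Embedding

/-! ### Families of fiber maps and their critical points -/

section Calculus

open Filter Topology

/-- `F s t` is twice differentiable in `t > 0` with derivatives `F₁`, `F₂`, which are jointly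
continuous at the points `(0, t)`. -/
structure IsFiberFamily (F F₁ F₂ : ℝ → ℝ → ℝ) : Prop where
  hasDerivAt : ∀ s t, 0 < t → HasDerivAt (F s) (F₁ s t) t
  hasDerivAt_deriv : ∀ s t, 0 < t → HasDerivAt (F₁ s) (F₂ s t) t
  tendsto_deriv : ∀ t, 0 < t →
    Tendsto (fun z : ℝ × ℝ => F₁ z.1 z.2) (𝓝 0 ×ˢ 𝓝 t) (𝓝 (F₁ 0 t))
  tendsto_deriv_deriv : ∀ t, 0 < t →
    Tendsto (fun z : ℝ × ℝ => F₂ z.1 z.2) (𝓝 0 ×ˢ 𝓝 t) (𝓝 (F₂ 0 t))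

theorem IsFiberFamily.sub {F F₁ F₂ G G₁ G₂ : ℝ → ℝ → ℝ} (hF : IsFiberFamily F F₁ F₂)
    (hG : IsFiberFamily G G₁ G₂) :
    IsFiberFamily (fun s t => F s t - G s t) (fun s t => F₁ s t - G₁ s t)
      (fun s t => F₂ s t - G₂ s t) :=
  ⟨fun s t ht => (hF.1 s t ht).sub (hG.1 s t ht), fun s t ht => (hF.2 s t ht).sub (hG.2 s t ht),
    fun t ht => (hF.3 t ht).sub (hG.3 t ht), fun t ht => (hF.4 t ht).sub (hG.4 t ht)⟩

theorem IsFiberFamily.const_mul {F F₁ F₂ : ℝ → ℝ → ℝ} (hF : IsFiberFamily F F₁ F₂) (c : ℝ) :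
    IsFiberFamily (fun s t => c * F s t) (fun s t => c * F₁ s t) (fun s t => c * F₂ s t) :=
  ⟨fun s t ht => (hF.1 s t ht).const_mul c, fun s t ht => (hF.2 s t ht).const_mul c,
    fun t ht => (hF.3 t ht).const_mul c, fun t ht => (hF.4 t ht).const_mul c⟩

theorem le_of_deriv_strictMonoOn {f f' : ℝ → ℝ} {a b t y : ℝ}
    (hf : ∀ x ∈ Set.Icc a b, HasDerivAt f (f' x) x) (hmono : StrictMonoOn f' (Set.Icc a b))
    (ht : t ∈ Set.Icc a b) (h0 : f' t = 0) (hy : y ∈ Set.Icc a b) : f t ≤ f y := by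
  rcases lt_trichotomy t y with h | h | h
  · have hsub : ∀ x ∈ Set.Icc t y, x ∈ Set.Icc a b := fun x hx =>
      ⟨ht.1.trans hx.1, hx.2.trans hy.2⟩
    obtain ⟨c, hc, he⟩ := exists_hasDerivAt_eq_slope f f' h
      (fun x hx => (hf x (hsub x hx)).continuousAt.continuousWithinAt)
      (fun x hx => hf x (hsub x (Set.Ioo_subset_Icc_self hx)))
    have := hmono ht (hsub c (Set.Ioo_subset_Icc_self hc)) hc.1
    rw [h0, he, div_pos_iff_of_pos_right (by linarith)] at this
    linarith
  · rw [h]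
  · have hsub : ∀ x ∈ Set.Icc y t, x ∈ Set.Icc a b := fun x hx =>
      ⟨hy.1.trans hx.1, hx.2.trans ht.2⟩
    obtain ⟨c, hc, he⟩ := exists_hasDerivAt_eq_slope f f' h
      (fun x hx => (hf x (hsub x hx)).continuousAt.continuousWithinAt)
      (fun x hx => hf x (hsub x (Set.Ioo_subset_Icc_self hx)))
    have := hmono (hsub c (Set.Ioo_subset_Icc_self hc)) ht hc.2
    rw [h0, he] at this
    have h1 : 0 < t - y := by linarith
    rw [div_lt_iff₀ h1, zero_mul] at this
    linarith

/-- A substitute for the implicit function theorem, which is unavailable because F need not be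
differentiable in s. Joint continuity keeps F₂ positive near (0, 1), so F₁ s is strictly increasing
near t = 1; the sign change of F₁ 0 between 1 - d and 1 + d persists for small s, and a zero of F₁ s
is then a minimum of F s on the interval. -/
theorem IsFiberFamily.exists_isMin {F F₁ F₂ : ℝ → ℝ → ℝ} (h : IsFiberFamily F F₁ F₂)
    (h1 : F₁ 0 1 = 0) (h2 : 0 < F₂ 0 1) {η : ℝ} (hη : 0 < η) :
    ∀ᶠ s in 𝓝 0, ∃ t, 0 < t ∧ |t - 1| < η ∧ F₁ s t = 0 ∧ 0 < F₂ s t ∧ F s t ≤ F s 1 ∧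
      F 0 1 ≤ F 0 t := by
  have hbox := (h.tendsto_deriv_deriv 1 one_pos).eventually (lt_mem_nhds h2)
  rw [← nhds_prod_eq, Metric.eventually_nhds_iff] at hbox
  obtain ⟨ε, hε, hbox⟩ := hbox
  set d := min (min ε η) 1 / 2 with hd
  have hd0 : 0 < d := by positivity
  have hdε : d < ε := by
    have := (min_le_left (min ε η) 1).trans (min_le_left ε η); linarith
  have hdη : d < η := by
    have := (min_le_left (min ε η) 1).trans (min_le_right ε η); linarith
  have hd1 : d < 1 := by
    have := min_le_right (min ε η) 1; linarith
  have hpos : ∀ s, |s| < ε → ∀ t ∈ Set.Icc (1 - d) (1 + d), 0 < F₂ s t := by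
    intro s hs t ht
    refine hbox (y := (s, t)) ?_
    rw [Prod.dist_eq, max_lt_iff]
    refine ⟨by simpa [Real.dist_eq] using hs, ?_⟩
    rw [Real.dist_eq]
    exact lt_of_le_of_lt (abs_le.2 ⟨by linarith [ht.1], by linarith [ht.2]⟩) hdε
  have hmono : ∀ s, |s| < ε → StrictMonoOn (F₁ s) (Set.Icc (1 - d) (1 + d)) := by
    intro s hs
    refine strictMonoOn_of_deriv_pos (convex_Icc _ _) (fun t ht =>
      (h.hasDerivAt_deriv s t (by linarith [ht.1])).continuousAt.continuousWithinAt) ?_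
    intro t ht
    have ht' := interior_subset ht
    rw [(h.hasDerivAt_deriv s t (by linarith [ht'.1])).deriv]
    exact hpos s hs t ht'
  have hslice : ∀ t, 0 < t → Tendsto (fun s => F₁ s t) (𝓝 0) (𝓝 (F₁ 0 t)) := fun t ht =>
    (h.tendsto_deriv t ht).comp (tendsto_id.prodMk tendsto_const_nhds)
  have m0 := hmono 0 (by simpa using hε)
  have hm1 : (1 : ℝ) ∈ Set.Icc (1 - d) (1 + d) := ⟨by linarith, by linarith⟩
  have hl : F₁ 0 (1 - d) < 0 := by
    have := m0 ⟨le_rfl, by linarith⟩ hm1 (by linarith)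
    rwa [h1] at this
  have hr : 0 < F₁ 0 (1 + d) := by
    have := m0 hm1 ⟨by linarith, le_rfl⟩ (by linarith)
    rwa [h1] at this
  have hder : ∀ s, ∀ t ∈ Set.Icc (1 - d) (1 + d), HasDerivAt (F s) (F₁ s t) t := fun s t ht =>
    h.hasDerivAt s t (by linarith [ht.1])
  have hs0 : ∀ᶠ s in 𝓝 (0 : ℝ), |s| < ε := by
    filter_upwards [Metric.ball_mem_nhds (0 : ℝ) hε] with s hs
    simpa [Real.dist_eq] using hs
  filter_upwards [hs0, (hslice (1 - d) (by linarith)).eventually (gt_mem_nhds hl),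
    (hslice (1 + d) (by linarith)).eventually (lt_mem_nhds hr)] with s hs hsl hsr
  obtain ⟨t, ht, hst⟩ := intermediate_value_Ioo (f := F₁ s) (by linarith : 1 - d ≤ 1 + d)
    (fun t ht => (h.hasDerivAt_deriv s t (by linarith [ht.1])).continuousAt.continuousWithinAt)
    ⟨hsl, hsr⟩
  have ht' := Set.Ioo_subset_Icc_self ht
  exact ⟨t, by linarith [ht.1], abs_lt.2 ⟨by linarith [ht.1], by linarith [ht.2]⟩, hst,
    hpos s hs t ht', le_of_deriv_strictMonoOn (hder s) (hmono s hs) ht' hst hm1,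
    le_of_deriv_strictMonoOn (hder 0) m0 hm1 h1 ht'⟩

theorem IsFiberFamily.exists_isMax {F F₁ F₂ : ℝ → ℝ → ℝ} (h : IsFiberFamily F F₁ F₂)
    (h1 : F₁ 0 1 = 0) (h2 : F₂ 0 1 < 0) {η : ℝ} (hη : 0 < η) :
    ∀ᶠ s in 𝓝 0, ∃ t, 0 < t ∧ |t - 1| < η ∧ F₁ s t = 0 ∧ F₂ s t < 0 ∧ F s 1 ≤ F s t ∧
      F 0 t ≤ F 0 1 := by
  filter_upwards [(h.const_mul (-1)).exists_isMin (by simp [h1]) (by simpa using h2) hη] with s hs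
  simpa using hs

/-- The base 1 + b + a⁻¹ dominates both s and s⁻¹, so negative exponents are covered too; these
occur after differentiating t^{r(x)} once or twice. -/
theorem rpow_le_of_mem_Icc {a b s e E : ℝ} (ha : 0 < a) (hs : s ∈ Set.Icc a b) (he : |e| ≤ E) :
    s ^ e ≤ (1 + b + a⁻¹) ^ E := by
  have hs0 : 0 < s := ha.trans_le hs.1
  have hE : 0 ≤ E := (abs_nonneg e).trans he
  have hb : 0 < b := hs0.trans_le hs.2
  have hai : 0 < a⁻¹ := inv_pos.2 ha
  rcases le_total 1 s with h | h
  · calc s ^ e ≤ s ^ E := Real.rpow_le_rpow_of_exponent_le h ((le_abs_self e).trans he)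
      _ ≤ _ := Real.rpow_le_rpow hs0.le (by linarith [hs.2]) hE
  · have h1 : 1 ≤ s⁻¹ := (one_le_inv₀ hs0).2 h
    have h2 : s⁻¹ ≤ a⁻¹ := inv_anti₀ ha hs.1
    calc s ^ e = s⁻¹ ^ (-e) := by rw [Real.inv_rpow hs0.le, Real.rpow_neg hs0.le, inv_inv]
      _ ≤ s⁻¹ ^ E := Real.rpow_le_rpow_of_exponent_le h1 ((neg_le_abs e).trans he)
      _ ≤ _ := Real.rpow_le_rpow (by linarith) (by linarith) hE

variable {X : Type*} [MeasurableSpace X] {μ : Measure X}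

theorem aestronglyMeasurable_rpow_mul {r k : X → ℝ} (hr : AEMeasurable r μ)
    (hk : AEStronglyMeasurable k μ) (t : ℝ) : AEStronglyMeasurable (fun x => t ^ r x * k x) μ :=
  ((aemeasurable_const (b := t)).pow hr).aestronglyMeasurable.mul hk

theorem integrable_rpow_mul {r k : X → ℝ} {R : ℝ} (hr : AEMeasurable r μ)
    (hR : ∀ᵐ x ∂μ, |r x| ≤ R) (hk : Integrable k μ) {t : ℝ} (ht : 0 < t) :
    Integrable (fun x => t ^ r x * k x) μ := by
  refine (hk.abs.const_mul ((1 + t + t⁻¹) ^ R)).mono' (aestronglyMeasurable_rpow_mul hr hk.1 t) ?_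
  filter_upwards [hR] with x hx
  rw [norm_mul, Real.norm_of_nonneg (Real.rpow_nonneg ht.le _), Real.norm_eq_abs]
  exact mul_le_mul_of_nonneg_right (rpow_le_of_mem_Icc ht ⟨le_rfl, le_rfl⟩ hx) (abs_nonneg _)

theorem integrable_mul_of_bounded {c k : X → ℝ} {C : ℝ} (hc : AEMeasurable c μ)
    (hC : ∀ᵐ x ∂μ, |c x| ≤ C) (hk : Integrable k μ) : Integrable (fun x => c x * k x) μ :=
  hk.bdd_mul hc.aestronglyMeasurable hC

theorem hasDerivAt_integral_rpow_mul {r k : X → ℝ} {R : ℝ} (hr : AEMeasurable r μ)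
    (hR : ∀ᵐ x ∂μ, |r x| ≤ R) (hk : Integrable k μ) {t : ℝ} (ht : 0 < t) :
    HasDerivAt (fun τ => ∫ x, τ ^ r x * k x ∂μ) (∫ x, t ^ (r x - 1) * (r x * k x) ∂μ) t := by
  have hrk : Integrable (fun x => r x * k x) μ := integrable_mul_of_bounded hr hR hk
  refine (hasDerivAt_integral_of_dominated_loc_of_deriv_le
    (F := fun τ x => τ ^ r x * k x) (F' := fun τ x => τ ^ (r x - 1) * (r x * k x))
    (s := Set.Icc (t / 2) (2 * t))
    (bound := fun x => (1 + 2 * t + (t / 2)⁻¹) ^ (R + 1) * |r x * k x|)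
    (Icc_mem_nhds (by linarith) (by linarith))
    (Eventually.of_forall fun τ => aestronglyMeasurable_rpow_mul hr hk.1 τ)
    (integrable_rpow_mul hr hR hk ht)
    (aestronglyMeasurable_rpow_mul (hr.sub_const 1) hrk.1 t) ?_ (hrk.abs.const_mul _) ?_).2
  · filter_upwards [hR] with x hx τ hτ
    have hτ0 : 0 < τ := lt_of_lt_of_le (by linarith) hτ.1
    rw [norm_mul, Real.norm_of_nonneg (Real.rpow_nonneg hτ0.le _), Real.norm_eq_abs]
    refine mul_le_mul_of_nonneg_right (rpow_le_of_mem_Icc (by linarith) hτ ?_) (abs_nonneg _)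
    exact (abs_sub _ _).trans (by simpa using hx)
  · refine Eventually.of_forall fun x τ hτ => ?_
    have hτ0 : 0 < τ := lt_of_lt_of_le (by linarith) hτ.1
    have := (Real.hasDerivAt_rpow_const (p := r x) (Or.inl hτ0.ne')).mul_const (k x)
    exact this.congr_deriv (by ring)

/-- Dominated convergence for `∫ t^r k_s` jointly in `s` and `t`. -/
theorem tendsto_integral_rpow_mul {r : X → ℝ} {R : ℝ} (hr : AEMeasurable r μ)
    (hR : ∀ᵐ x ∂μ, |r x| ≤ R) {k : ℝ → X → ℝ} {k₀ K : X → ℝ} {l : Filter ℝ}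
    [l.IsCountablyGenerated] (hk : ∀ᶠ s in l, AEStronglyMeasurable (k s) μ)
    (hK : Integrable K μ) (hkK : ∀ᶠ s in l, ∀ᵐ x ∂μ, |k s x| ≤ K x)
    (hlim : ∀ᵐ x ∂μ, Tendsto (fun s => k s x) l (𝓝 (k₀ x))) {t : ℝ} (ht : 0 < t) :
    Tendsto (fun z : ℝ × ℝ => ∫ x, z.2 ^ r x * k z.1 x ∂μ) (l ×ˢ 𝓝 t)
      (𝓝 (∫ x, t ^ r x * k₀ x ∂μ)) := by
  have hIcc : ∀ᶠ τ in 𝓝 t, τ ∈ Set.Icc (t / 2) (2 * t) :=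
    Icc_mem_nhds (by linarith) (by linarith)
  refine tendsto_integral_filter_of_dominated_convergence
    (fun x => (1 + 2 * t + (t / 2)⁻¹) ^ R * K x) ?_ ?_ (hK.const_mul _) ?_
  · filter_upwards [hk.prod_inl (𝓝 t)] with z hz
    exact aestronglyMeasurable_rpow_mul hr hz z.2
  · filter_upwards [hkK.prod_inl (𝓝 t), hIcc.prod_inr l] with z hz hz2
    filter_upwards [hz, hR] with x hx hxR
    have hτ0 : 0 < z.2 := lt_of_lt_of_le (by linarith) hz2.1
    rw [norm_mul, Real.norm_of_nonneg (Real.rpow_nonneg hτ0.le _), Real.norm_eq_abs]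
    exact mul_le_mul (rpow_le_of_mem_Icc (by linarith) hz2 hxR) hx (abs_nonneg _)
      (Real.rpow_nonneg (by positivity) _)
  · filter_upwards [hlim] with x hx
    refine Tendsto.mul ?_ (hx.comp tendsto_fst)
    exact ((Real.continuousAt_rpow_const t (r x) (Or.inl ht.ne')).tendsto).comp tendsto_snd

/-- Differentiation in t falls only on t^{r(x)}. Hence k needs an integrable majorant and continuity
at s = 0, but no derivative in s; this is why the singular term is admitted. -/
theorem isFiberFamily_integral_of_dominated {r K : X → ℝ} {k : ℝ → X → ℝ} {R : ℝ}
    (hr : AEMeasurable r μ) (hR : ∀ᵐ x ∂μ, |r x| ≤ R) (hk : ∀ s, Integrable (k s) μ)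
    (hK : Integrable K μ) (hkK : ∀ᶠ s in 𝓝 0, ∀ᵐ x ∂μ, |k s x| ≤ K x)
    (hlim : ∀ᵐ x ∂μ, Tendsto (fun s => k s x) (𝓝 0) (𝓝 (k 0 x))) :
    IsFiberFamily (fun s t => ∫ x, t ^ r x * k s x ∂μ)
      (fun s t => ∫ x, t ^ (r x - 1) * (r x * k s x) ∂μ)
      (fun s t => ∫ x, t ^ (r x - 1 - 1) * ((r x - 1) * (r x * k s x)) ∂μ) := by
  have hR2 : ∀ᵐ x ∂μ, |r x - 1| ≤ R + 1 := by
    filter_upwards [hR] with x hx; exact (abs_sub _ _).trans (by simpa using hx)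
  have hR3 : ∀ᵐ x ∂μ, |r x - 1 - 1| ≤ R + 1 + 1 := by
    filter_upwards [hR2] with x hx; exact (abs_sub _ _).trans (by simpa using hx)
  have hr2 := hr.sub_const 1
  have hk1 : ∀ s, Integrable (fun x => r x * k s x) μ := fun s =>
    integrable_mul_of_bounded hr hR (hk s)
  have hk2 : ∀ s, Integrable (fun x => (r x - 1) * (r x * k s x)) μ := fun s =>
    integrable_mul_of_bounded hr2 hR2 (hk1 s)
  have hb1 : ∀ᶠ s in 𝓝 0, ∀ᵐ x ∂μ, |r x * k s x| ≤ R * K x := by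
    filter_upwards [hkK] with s hs
    filter_upwards [hR, hs] with x hx hbx
    rw [abs_mul]
    exact mul_le_mul hx hbx (abs_nonneg _) ((abs_nonneg _).trans hx)
  have hb2 : ∀ᶠ s in 𝓝 0, ∀ᵐ x ∂μ, |(r x - 1) * (r x * k s x)| ≤ (R + 1) * (R * K x) := by
    filter_upwards [hb1] with s hs
    filter_upwards [hR2, hs] with x hx hbx
    rw [abs_mul]
    exact mul_le_mul hx hbx (abs_nonneg _) ((abs_nonneg _).trans hx)
  refine ⟨fun s t ht => hasDerivAt_integral_rpow_mul hr hR (hk s) ht,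
    fun s t ht => hasDerivAt_integral_rpow_mul hr2 hR2 (hk1 s) ht, fun t ht => ?_, fun t ht => ?_⟩
  · exact tendsto_integral_rpow_mul hr2 hR2 (k := fun s x => r x * k s x)
      (Eventually.of_forall fun s => (hk1 s).1) (hK.const_mul R) hb1
      (hlim.mono fun x hx => hx.const_mul _) ht
  · exact tendsto_integral_rpow_mul (hr2.sub_const 1) hR3
      (k := fun s x => (r x - 1) * (r x * k s x))
      (Eventually.of_forall fun s => (hk2 s).1) ((hK.const_mul R).const_mul (R + 1)) hb2
      (hlim.mono fun x hx => (hx.const_mul _).const_mul _) ht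

variable {V : Type*} [NormedAddCommGroup V] [NormedSpace ℝ V]

theorem eventually_abs_le_one : ∀ᶠ s in 𝓝 (0 : ℝ), |s| ≤ 1 := by
  filter_upwards [Metric.closedBall_mem_nhds (0 : ℝ) one_pos] with s hs
  simpa [Real.dist_eq] using hs

theorem norm_add_smul_rpow_le (a b : V) {r R s : ℝ} (hr : 0 ≤ r) (hR : r ≤ R) (hs : |s| ≤ 1) :
    ‖a + s • b‖ ^ r ≤ 2 ^ R * (‖a‖ ^ r + ‖b‖ ^ r) := by
  refine (norm_add_rpow_le a (s • b) hr hR).trans ?_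
  have : ‖s • b‖ ≤ ‖b‖ := by
    rw [norm_smul]
    exact mul_le_of_le_one_left (norm_nonneg _) hs
  gcongr

theorem integrable_norm_add_smul_rpow {r : X → ℝ} {R : ℝ} (hr : AEMeasurable r μ)
    (hR : ∀ᵐ x ∂μ, 0 < r x ∧ r x ≤ R) {U Φ : X → V} (hU : AEStronglyMeasurable U μ)
    (hΦ : AEStronglyMeasurable Φ μ) (hUr : Integrable (fun x => ‖U x‖ ^ r x) μ)
    (hΦr : Integrable (fun x => ‖Φ x‖ ^ r x) μ) (s : ℝ) :
    Integrable (fun x => ‖U x + s • Φ x‖ ^ r x) μ := by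
  refine ((hUr.add (hΦr.const_mul (1 + |s| ^ R))).const_mul (2 ^ R)).mono'
    ((hU.add (hΦ.const_smul s)).norm.aemeasurable.pow hr).aestronglyMeasurable ?_
  filter_upwards [hR] with x hx
  rw [Real.norm_of_nonneg (Real.rpow_nonneg (norm_nonneg _) _)]
  refine (norm_add_rpow_le _ _ hx.1.le hx.2).trans ?_
  rw [norm_smul, Real.mul_rpow (norm_nonneg _) (norm_nonneg _), Real.norm_eq_abs]
  have := rpow_le_one_add_rpow (abs_nonneg s) hx.1.le hx.2
  simp only [Pi.add_apply]
  gcongr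

theorem integrable_mul_comp_rpow {r c : X → ℝ} {R C : ℝ} (hr : AEMeasurable r μ)
    (hR : ∀ᵐ x ∂μ, 0 < r x ∧ r x ≤ R) (hc : AEMeasurable c μ) (hC : ∀ᵐ x ∂μ, |c x| ≤ C)
    {n : V → ℝ} (hn : Continuous n) (hn0 : ∀ v, 0 ≤ n v) (hnv : ∀ v, n v ≤ ‖v‖)
    {U Φ : X → V} (hU : AEStronglyMeasurable U μ)
    (hΦ : AEStronglyMeasurable Φ μ) (hUr : Integrable (fun x => ‖U x‖ ^ r x) μ)
    (hΦr : Integrable (fun x => ‖Φ x‖ ^ r x) μ) (s : ℝ) :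
    Integrable (fun x => c x * n (U x + s • Φ x) ^ r x) μ := by
  refine integrable_mul_of_bounded hc hC
    ((integrable_norm_add_smul_rpow hr hR hU hΦ hUr hΦr s).mono'
      ((hn.comp_aestronglyMeasurable (hU.add (hΦ.const_smul s))).aemeasurable.pow
        hr).aestronglyMeasurable ?_)
  filter_upwards [hR] with x hx
  rw [Real.norm_of_nonneg (Real.rpow_nonneg (hn0 _) _)]
  exact Real.rpow_le_rpow (hn0 _) (hnv _) hx.1.le

theorem integral_rpow_mul_slope {r : X → ℝ} {R : ℝ} (hr : AEMeasurable r μ)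
    (hR : ∀ᵐ x ∂μ, 0 < r x ∧ r x ≤ R) {c k k₀ : X → ℝ} (hk : Integrable (fun x => c x * k x) μ)
    (hk₀ : Integrable (fun x => c x * k₀ x) μ) {t : ℝ} (ht : 0 < t) (s : ℝ) :
    (∫ x, t ^ r x * (c x * k x) ∂μ - ∫ x, t ^ r x * (c x * k₀ x) ∂μ) / s =
      ∫ x, t ^ r x * (c x * ((k x - k₀ x) / s)) ∂μ := by
  have hR1 : ∀ᵐ x ∂μ, |r x| ≤ R := by
    filter_upwards [hR] with x hx; rw [abs_of_pos hx.1]; exact hx.2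
  rw [← integral_sub (integrable_rpow_mul hr hR1 hk ht) (integrable_rpow_mul hr hR1 hk₀ ht),
    ← integral_div]
  congr 1
  ext x
  ring

/-- One statement for all three terms of the energy: n is the norm for the gradient and q terms, the
positive part for the singular one. -/
theorem isFiberFamily_integral {r c : X → ℝ} {R C : ℝ} (hr : AEMeasurable r μ)
    (hR : ∀ᵐ x ∂μ, 0 < r x ∧ r x ≤ R) (hc : AEMeasurable c μ) (hC : ∀ᵐ x ∂μ, |c x| ≤ C)
    {n : V → ℝ} (hn : Continuous n) (hn0 : ∀ v, 0 ≤ n v) (hnv : ∀ v, n v ≤ ‖v‖)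
    {U Φ : X → V} (hU : AEStronglyMeasurable U μ)
    (hΦ : AEStronglyMeasurable Φ μ) (hUr : Integrable (fun x => ‖U x‖ ^ r x) μ)
    (hΦr : Integrable (fun x => ‖Φ x‖ ^ r x) μ) :
    IsFiberFamily (fun s t => ∫ x, t ^ r x * (c x * n (U x + s • Φ x) ^ r x) ∂μ)
      (fun s t => ∫ x, t ^ (r x - 1) * (r x * (c x * n (U x + s • Φ x) ^ r x)) ∂μ)
      (fun s t => ∫ x, t ^ (r x - 1 - 1) *
        ((r x - 1) * (r x * (c x * n (U x + s • Φ x) ^ r x))) ∂μ) := by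
  have hR1 : ∀ᵐ x ∂μ, |r x| ≤ R := by
    filter_upwards [hR] with x hx; rw [abs_of_pos hx.1]; exact hx.2
  refine isFiberFamily_integral_of_dominated (k := fun s x => c x * n (U x + s • Φ x) ^ r x)
    (K := fun x => C * (2 ^ R * (‖U x‖ ^ r x + ‖Φ x‖ ^ r x))) hr hR1
    (integrable_mul_comp_rpow hr hR hc hC hn hn0 hnv hU hΦ hUr hΦr)
    (((hUr.add hΦr).const_mul _).const_mul _) ?_ ?_
  · filter_upwards [eventually_abs_le_one] with s hs
    filter_upwards [hR, hC] with x hx hxC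
    rw [abs_mul, abs_of_nonneg (Real.rpow_nonneg (hn0 _) _)]
    refine mul_le_mul hxC ?_ (Real.rpow_nonneg (hn0 _) _) ((abs_nonneg _).trans hxC)
    exact (Real.rpow_le_rpow (hn0 _) (hnv _) hx.1.le).trans
      (norm_add_smul_rpow_le _ _ hx.1.le hx.2 hs)
  · filter_upwards [hR] with x hx
    have : Continuous fun s : ℝ => n (U x + s • Φ x) := by fun_prop
    exact ((this.tendsto 0).rpow_const (Or.inr hx.1.le)).const_mul _

end Calculus

/-! ### Difference quotients in s: pointwise bounds and limits of integrals -/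

section Slopes

open Filter Topology

theorem abs_rpow_sub_rpow_le {x y m r : ℝ} (hr : 1 ≤ r) (hx : x ∈ Set.Icc 0 m)
    (hy : y ∈ Set.Icc 0 m) : |x ^ r - y ^ r| ≤ r * m ^ (r - 1) * |x - y| := by
  refine (convex_Icc 0 m).norm_image_sub_le_of_norm_hasDerivWithin_le (f := fun z => z ^ r)
    (f' := fun z => r * z ^ (r - 1))
    (fun z _ => (Real.hasDerivAt_rpow_const (Or.inr hr)).hasDerivWithinAt) (fun z hz => ?_) hy hx
  rw [Real.norm_of_nonneg (mul_nonneg (by linarith) (Real.rpow_nonneg hz.1 _))]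
  exact mul_le_mul_of_nonneg_left (Real.rpow_le_rpow hz.1 hz.2 (by linarith)) (by linarith)

theorem abs_rpow_sub_one_le {y α : ℝ} (hy : 0 ≤ y) (hα : 0 ≤ α) (hα1 : α ≤ 1) :
    |y ^ α - 1| ≤ |y - 1| := by
  rcases le_total 1 y with h | h
  · have h1 := Real.one_le_rpow h hα
    have h2 := Real.rpow_le_rpow_of_exponent_le h hα1
    rw [Real.rpow_one] at h2
    rw [abs_of_nonneg (by linarith), abs_of_nonneg (by linarith)]
    linarith
  · have h1 := Real.rpow_le_one hy h hα
    have h2 : y ≤ y ^ α := by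
      rcases hy.eq_or_lt with rfl | hy0
      · exact Real.rpow_nonneg le_rfl _
      · simpa using Real.rpow_le_rpow_of_exponent_ge hy0 h hα1
    rw [abs_of_nonpos (by linarith), abs_of_nonpos (by linarith)]
    linarith

/-- By scaling to u = 1. The weight u^{α-1} is that of the singular first variation itself, so
integrability of the latter is exactly what domination will require. -/
theorem abs_rpow_sub_rpow_le_of_le_one {x u α : ℝ} (hx : 0 ≤ x) (hu : 0 < u) (hα : 0 ≤ α)
    (hα1 : α ≤ 1) : |x ^ α - u ^ α| ≤ u ^ (α - 1) * |x - u| := by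
  have h := abs_rpow_sub_one_le (div_nonneg hx hu.le) hα hα1
  have e1 : x ^ α - u ^ α = u ^ α * ((x / u) ^ α - 1) := by
    rw [Real.div_rpow hx hu.le, mul_sub, mul_one, mul_div_cancel₀ _ (Real.rpow_pos_of_pos hu α).ne']
  have e2 : x / u - 1 = (x - u) / u := by field_simp
  rw [e1, abs_mul, abs_of_pos (Real.rpow_pos_of_pos hu α), Real.rpow_sub_one hu.ne']
  rw [e2, abs_div, abs_of_pos hu] at h
  calc u ^ α * |(x / u) ^ α - 1| ≤ u ^ α * (|x - u| / u) :=
        mul_le_mul_of_nonneg_left h (Real.rpow_nonneg hu.le _)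
    _ = _ := by ring

section Pointwise

variable {X : Type*}

/-- The difference quotient of `s ↦ c ((u + s φ)⁺)^α`. -/
noncomputable def posPartSlope (c α u φ : X → ℝ) (s : ℝ) (x : X) : ℝ :=
  c x * ((max (u x + s • φ x) 0 ^ α x - max (u x) 0 ^ α x) / s)

/-- The integrand `c α u^{α-1} φ` on `{u > 0}`, extended by zero. -/
noncomputable def posPartVariation (c α u φ : X → ℝ) (x : X) : ℝ :=
  {x | 0 < u x}.indicator (fun x => c x * (α x * u x ^ (α x - 1) * φ x)) x

variable {c α u φ : X → ℝ} {R : ℝ}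

/-- Where u ≤ 0 the value at s = 0 is already the minimum 0, so the quotient has a sign for every
direction φ. -/
theorem posPartSlope_nonneg_of_nonpos {s : ℝ} {x : X} (hs : 0 < s) (hc : 0 ≤ c x) (hα : 0 < α x)
    (hu : u x ≤ 0) : 0 ≤ posPartSlope c α u φ s x := by
  unfold posPartSlope
  rw [max_eq_right hu, Real.zero_rpow hα.ne', sub_zero]
  have := Real.rpow_nonneg (le_max_right (u x + s • φ x) 0) (α x)
  positivity

theorem posPartSlope_nonneg {s : ℝ} {x : X} (hs : 0 < s) (hc : 0 ≤ c x) (hα : 0 < α x)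
    (hφ : 0 ≤ φ x) : 0 ≤ posPartSlope c α u φ s x := by
  refine mul_nonneg hc (div_nonneg (sub_nonneg.2 ?_) hs.le)
  refine Real.rpow_le_rpow (le_max_right _ _) (max_le_max ?_ le_rfl) hα.le
  have : 0 ≤ s • φ x := mul_nonneg hs.le hφ
  linarith

theorem tendsto_posPartSlope {x : X} (hu : 0 < u x) :
    Tendsto (fun s => posPartSlope c α u φ s x) (𝓝[>] 0)
      (𝓝 (c x * (α x * u x ^ (α x - 1) * φ x))) := by
  have h1 : HasDerivAt (fun s : ℝ => u x + s • φ x) (φ x) 0 := by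
    simpa using ((hasDerivAt_id (0 : ℝ)).smul_const (φ x)).const_add (u x)
  have h2 := h1.rpow_const (p := α x) (Or.inl (by simpa using hu.ne'))
  have hpos : ∀ᶠ s : ℝ in 𝓝 0, 0 < u x + s • φ x :=
    h1.continuousAt.eventually (lt_mem_nhds (by simpa using hu))
  have h3 : HasDerivAt (fun s : ℝ => max (u x + s • φ x) 0 ^ α x)
      (φ x * α x * (u x + (0 : ℝ) • φ x) ^ (α x - 1)) 0 := by
    refine h2.congr_of_eventuallyEq ?_
    filter_upwards [hpos] with s hs
    rw [max_eq_left hs.le]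
  have h4 := h3.tendsto_slope_zero
  simp only [zero_add, zero_mul, add_zero, smul_eq_mul, inv_mul_eq_div] at h4
  have hle : 𝓝[>] (0 : ℝ) ≤ 𝓝[≠] 0 := nhdsWithin_mono _ fun s hs => ne_of_gt hs
  have h5 := (h4.mono_left hle).const_mul (c x)
  rw [show φ x * α x * u x ^ (α x - 1) = α x * u x ^ (α x - 1) * φ x by ring] at h5
  simpa only [posPartSlope, smul_eq_mul] using h5

/-- Both regimes of the variable exponent are covered by one sum: for α ≤ 1 concavity gives the
first, possibly singular term; for α ≥ 1 the mean value inequality on [0, |u| + |φ|] gives the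
second, which is integrable by assumption on u and φ. -/
theorem abs_posPartSlope_le {x : X} {s : ℝ} (hs0 : 0 < s) (hs1 : s ≤ 1) (hu : 0 < u x)
    (hα : 0 < α x) (hR : α x ≤ R) :
    |(max (u x + s • φ x) 0 ^ α x - max (u x) 0 ^ α x) / s| ≤
      u x ^ (α x - 1) * |φ x| + R * (2 ^ R * (‖u x‖ ^ α x + ‖φ x‖ ^ α x)) := by
  have hR0 : 0 ≤ R := by linarith
  rw [max_eq_left hu.le]
  set z := max (u x + s • φ x) 0 with hz
  have hz0 : 0 ≤ z := le_max_right _ _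
  have hzu : |z - u x| ≤ s * |φ x| := by
    have := abs_max_sub_max_le_abs (u x + s • φ x) (u x) 0
    rwa [max_eq_left hu.le, add_sub_cancel_left, smul_eq_mul, abs_mul, abs_of_pos hs0] at this
  have n1 : 0 ≤ u x ^ (α x - 1) * |φ x| := by positivity
  have n2 : 0 ≤ R * (2 ^ R * (‖u x‖ ^ α x + ‖φ x‖ ^ α x)) := by positivity
  rw [abs_div, abs_of_pos hs0, div_le_iff₀ hs0]
  rcases le_total (α x) 1 with h1 | h1
  · calc |z ^ α x - u x ^ α x| ≤ u x ^ (α x - 1) * (s * |φ x|) :=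
          (abs_rpow_sub_rpow_le_of_le_one hz0 hu hα.le h1).trans (by gcongr)
      _ = u x ^ (α x - 1) * |φ x| * s := by ring
      _ ≤ _ := mul_le_mul_of_nonneg_right (by linarith) hs0.le
  · set M := ‖u x‖ + ‖φ x‖ with hM
    have hux : ‖u x‖ = u x := Real.norm_of_nonneg hu.le
    have hMpos : 0 < M := by rw [hM, hux]; positivity
    have huM : u x ≤ M := by rw [hM, hux]; linarith [norm_nonneg (φ x)]
    have hφM : |φ x| ≤ M := by rw [hM, Real.norm_eq_abs (φ x)]; linarith [norm_nonneg (u x)]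
    have hzM : z ≤ M := by
      refine max_le ?_ hMpos.le
      rw [hM, hux]
      refine add_le_add le_rfl ?_
      rw [smul_eq_mul, Real.norm_eq_abs]
      calc s * φ x ≤ |s * φ x| := le_abs_self _
        _ = s * |φ x| := by rw [abs_mul, abs_of_pos hs0]
        _ ≤ |φ x| := mul_le_of_le_one_left (abs_nonneg _) hs1
    have h5 : M ^ α x ≤ 2 ^ R * (‖u x‖ ^ α x + ‖φ x‖ ^ α x) := by
      have := norm_add_rpow_le ‖u x‖ ‖φ x‖ hα.le hR
      rwa [norm_norm, norm_norm, ← hM, Real.norm_of_nonneg hMpos.le] at this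
    calc |z ^ α x - u x ^ α x| ≤ α x * M ^ (α x - 1) * (s * |φ x|) :=
          (abs_rpow_sub_rpow_le h1 ⟨hz0, hzM⟩ ⟨hu.le, huM⟩).trans (by gcongr)
      _ ≤ α x * M ^ (α x - 1) * (s * M) := by gcongr
      _ = α x * M ^ α x * s := by
          rw [mul_comm s M, ← mul_assoc, mul_assoc (α x), ← Real.rpow_add_one hMpos.ne',
            sub_add_cancel]
      _ ≤ R * (2 ^ R * (‖u x‖ ^ α x + ‖φ x‖ ^ α x)) * s := by gcongr
      _ ≤ _ := mul_le_mul_of_nonneg_right (by linarith) hs0.le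

end Pointwise

section NormPointwise

variable {W : Type*} [NormedAddCommGroup W] [InnerProductSpace ℝ W]

theorem abs_norm_add_smul_rpow_sub_le (a b : W) {r R s : ℝ} (hr : 1 ≤ r) (hR : r ≤ R)
    (hs0 : s ≠ 0) (hs : |s| ≤ 1) :
    |(‖a + s • b‖ ^ r - ‖a‖ ^ r) / s| ≤ R * (2 ^ R * (‖a‖ ^ r + ‖b‖ ^ r)) := by
  have ha := norm_nonneg a
  have hb := norm_nonneg b
  have h1 : ‖a + s • b‖ ≤ ‖a‖ + ‖b‖ := by
    refine (norm_add_le _ _).trans (add_le_add le_rfl ?_)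
    rw [norm_smul]
    exact mul_le_of_le_one_left hb hs
  have h2 : |‖a + s • b‖ - ‖a‖| ≤ |s| * ‖b‖ := by
    refine (abs_norm_sub_norm_le _ _).trans (le_of_eq ?_)
    rw [add_sub_cancel_left, norm_smul, Real.norm_eq_abs]
  have h3 := abs_rpow_sub_rpow_le hr ⟨norm_nonneg (a + s • b), h1⟩ ⟨ha, le_add_of_nonneg_right hb⟩
  have h4 : (‖a‖ + ‖b‖) ^ (r - 1) * ‖b‖ ≤ (‖a‖ + ‖b‖) ^ r := by
    rcases (add_nonneg ha hb).eq_or_lt with h | h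
    · have : ‖b‖ = 0 := by linarith
      rw [this, mul_zero]
      exact Real.rpow_nonneg (by linarith) _
    · calc (‖a‖ + ‖b‖) ^ (r - 1) * ‖b‖ ≤ (‖a‖ + ‖b‖) ^ (r - 1) * (‖a‖ + ‖b‖) := by
            gcongr; linarith
        _ = _ := by rw [← Real.rpow_add_one h.ne', sub_add_cancel]
  have h5 : (‖a‖ + ‖b‖) ^ r ≤ 2 ^ R * (‖a‖ ^ r + ‖b‖ ^ r) := by
    have := norm_add_rpow_le ‖a‖ ‖b‖ (by linarith : 0 ≤ r) hR
    rwa [norm_norm, norm_norm, Real.norm_of_nonneg (add_nonneg ha hb)] at this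
  rw [abs_div, div_le_iff₀ (abs_pos.2 hs0)]
  calc |‖a + s • b‖ ^ r - ‖a‖ ^ r| ≤ r * (‖a‖ + ‖b‖) ^ (r - 1) * (|s| * ‖b‖) :=
        h3.trans (mul_le_mul_of_nonneg_left h2 (by positivity))
    _ = r * ((‖a‖ + ‖b‖) ^ (r - 1) * ‖b‖) * |s| := by ring
    _ ≤ R * (2 ^ R * (‖a‖ ^ r + ‖b‖ ^ r)) * |s| := by
        refine mul_le_mul_of_nonneg_right ?_ (abs_nonneg s)
        exact mul_le_mul hR (h4.trans h5) (by positivity) (by linarith)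

theorem tendsto_norm_add_smul_rpow_slope (a b : W) {r : ℝ} (hr : 1 < r) :
    Tendsto (fun s : ℝ => (‖a + s • b‖ ^ r - ‖a‖ ^ r) / s) (𝓝[≠] 0)
      (𝓝 (r * ‖a‖ ^ (r - 2) * inner ℝ a b)) := by
  have h1 : HasDerivAt (fun s : ℝ => a + s • b) b 0 := by
    simpa using ((hasDerivAt_id (0 : ℝ)).smul_const b).const_add a
  have h2 := hasFDerivAt_norm_rpow (a + (0 : ℝ) • b) hr
  have h3 := (h2.comp_hasDerivAt 0 h1).tendsto_slope_zero
  simp only [Function.comp_def, zero_add, zero_smul, add_zero, smul_eq_mul] at h3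
  simpa only [inv_mul_eq_div, smul_apply, innerSL_apply_apply, smul_eq_mul]
    using h3

theorem abs_norm_rpow_mul_inner_le (a b : W) {r R : ℝ} (hr : 1 < r) (hR : r ≤ R) :
    |r * ‖a‖ ^ (r - 2) * inner ℝ a b| ≤ R * (‖a‖ ^ r + ‖b‖ ^ r) := by
  have hb := norm_nonneg b
  -- The exponent r - 2 may be negative, so a = 0 is treated apart; there the inner product
  -- vanishes.
  rcases (norm_nonneg a).eq_or_lt with h | h
  · have : a = 0 := norm_eq_zero.1 h.symm
    have hR0 : 0 ≤ R := by linarith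
    rw [this, inner_zero_left, mul_zero, abs_zero]
    positivity
  · have h1 : ‖a‖ ^ (r - 2) * |inner ℝ a b| ≤ ‖a‖ ^ r + ‖b‖ ^ r := by
      set m := max ‖a‖ ‖b‖
      have hm : 0 < m := lt_max_of_lt_left h
      have e1 : m ^ r ≤ ‖a‖ ^ r + ‖b‖ ^ r := by
        have ha' := Real.rpow_nonneg h.le r
        have hb' := Real.rpow_nonneg hb r
        rcases max_choice ‖a‖ ‖b‖ with h' | h' <;> simp only [m, h'] <;> linarith
      calc ‖a‖ ^ (r - 2) * |inner ℝ a b| ≤ ‖a‖ ^ (r - 2) * (‖a‖ * ‖b‖) := by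
            gcongr; exact abs_real_inner_le_norm a b
        _ = ‖a‖ ^ (r - 1) * ‖b‖ := by
            rw [← mul_assoc, ← Real.rpow_add_one h.ne']; congr 2; ring
        _ ≤ m ^ (r - 1) * m := by
            gcongr
            · exact le_max_left _ _
            · exact le_max_right _ _
        _ = m ^ r := by rw [← Real.rpow_add_one hm.ne', sub_add_cancel]
        _ ≤ _ := e1
    rw [abs_mul, abs_mul, abs_of_pos (by linarith), abs_of_pos (Real.rpow_pos_of_pos h _), mul_assoc]
    exact mul_le_mul hR h1 (by positivity) (by linarith)

end NormPointwise

variable {X : Type*} [MeasurableSpace X] {μ : Measure X}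

section Norm

variable {W : Type*} [NormedAddCommGroup W] [InnerProductSpace ℝ W]

/-- The difference quotients of `s ↦ ∫ c ‖U + s Φ‖^r`, with a factor `t^r`, converge as `s → 0`
and `t → 1`. -/
theorem tendsto_integral_norm_rpow_slope {r c : X → ℝ} {R C : ℝ} (hr : AEMeasurable r μ)
    (hR : ∀ᵐ x ∂μ, 1 < r x ∧ r x ≤ R) (hc : AEMeasurable c μ) (hC : ∀ᵐ x ∂μ, |c x| ≤ C)
    {U Φ : X → W} (hU : AEStronglyMeasurable U μ) (hΦ : AEStronglyMeasurable Φ μ)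
    (hUr : Integrable (fun x => ‖U x‖ ^ r x) μ) (hΦr : Integrable (fun x => ‖Φ x‖ ^ r x) μ) :
    Tendsto (fun z : ℝ × ℝ => ∫ x, z.2 ^ r x *
        (c x * ((‖U x + z.1 • Φ x‖ ^ r x - ‖U x‖ ^ r x) / z.1)) ∂μ) (𝓝[>] 0 ×ˢ 𝓝 1)
      (𝓝 (∫ x, c x * (r x * ‖U x‖ ^ (r x - 2) * inner ℝ (U x) (Φ x)) ∂μ)) := by
  have hR1 : ∀ᵐ x ∂μ, |r x| ≤ R := by
    filter_upwards [hR] with x hx; rw [abs_of_pos (by linarith)]; exact hx.2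
  have hle : 𝓝[>] (0 : ℝ) ≤ 𝓝[≠] 0 := nhdsWithin_mono _ fun s hs => ne_of_gt hs
  have := tendsto_integral_rpow_mul hr hR1 (l := 𝓝[>] (0 : ℝ)) (t := 1)
    (k := fun s x => c x * ((‖U x + s • Φ x‖ ^ r x - ‖U x‖ ^ r x) / s))
    (k₀ := fun x => c x * (r x * ‖U x‖ ^ (r x - 2) * inner ℝ (U x) (Φ x)))
    (K := fun x => C * (R * (2 ^ R * (‖U x‖ ^ r x + ‖Φ x‖ ^ r x)))) ?_ ?_ ?_ ?_ one_pos
  · simpa only [Real.one_rpow, one_mul] using this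
  · refine Eventually.of_forall fun s => hc.aestronglyMeasurable.mul ?_
    exact ((((hU.add (hΦ.const_smul s)).norm.aemeasurable.pow hr).sub
      (hU.norm.aemeasurable.pow hr)).div_const s).aestronglyMeasurable
  · exact (((hUr.add hΦr).const_mul _).const_mul _).const_mul _
  · filter_upwards [hle.trans nhdsWithin_le_nhds eventually_abs_le_one, self_mem_nhdsWithin]
      with s hs hs0
    filter_upwards [hR, hC] with x hx hxC
    rw [abs_mul]
    exact mul_le_mul hxC (abs_norm_add_smul_rpow_sub_le _ _ hx.1.le hx.2 (ne_of_gt hs0) hs)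
      (abs_nonneg _) ((abs_nonneg _).trans hxC)
  · filter_upwards [hR] with x hx
    exact ((tendsto_norm_add_smul_rpow_slope (U x) (Φ x) hx.1).mono_left hle).const_mul _

theorem abs_integral_norm_rpow_mul_inner_le {r c : X → ℝ} {R C : ℝ}
    (hR : ∀ᵐ x ∂μ, 1 < r x ∧ r x ≤ R) (hC : ∀ᵐ x ∂μ, |c x| ≤ C) {U Φ : X → W}
    (hUr : Integrable (fun x => ‖U x‖ ^ r x) μ) (hΦr : Integrable (fun x => ‖Φ x‖ ^ r x) μ) :
    |∫ x, c x * (r x * ‖U x‖ ^ (r x - 2) * inner ℝ (U x) (Φ x)) ∂μ| ≤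
      C * (R * (∫ x, ‖U x‖ ^ r x ∂μ + ∫ x, ‖Φ x‖ ^ r x ∂μ)) := by
  rw [← integral_add hUr hΦr, ← integral_const_mul, ← integral_const_mul]
  rw [← Real.norm_eq_abs]
  refine norm_integral_le_of_norm_le (((hUr.add hΦr).const_mul _).const_mul _) ?_
  filter_upwards [hR, hC] with x hx hxC
  rw [Real.norm_eq_abs, abs_mul]
  exact mul_le_mul hxC (abs_norm_rpow_mul_inner_le _ _ hx.1 hx.2) (abs_nonneg _)
    ((abs_nonneg _).trans hxC)

end Norm

section PositivePart

/-- Standing assumptions on the data of the integral `∫ c ((u + s φ)⁺)^α`. -/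
structure IsPosPartData (μ : Measure X) (c α u φ : X → ℝ) (m R C : ℝ) : Prop where
  pos : 0 < m
  aemeasurable_exp : AEMeasurable α μ
  exp_mem : ∀ᵐ x ∂μ, m ≤ α x ∧ α x ≤ R
  aemeasurable_coeff : AEMeasurable c μ
  coeff_mem : ∀ᵐ x ∂μ, 0 ≤ c x ∧ c x ≤ C
  aemeasurable_left : AEMeasurable u μ
  aemeasurable_right : AEMeasurable φ μ
  integrable_left : Integrable (fun x => ‖u x‖ ^ α x) μ
  integrable_right : Integrable (fun x => ‖φ x‖ ^ α x) μ

variable {c α u φ : X → ℝ} {m R C : ℝ}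

theorem IsPosPartData.nullMeasurableSet (h : IsPosPartData μ c α u φ m R C) :
    NullMeasurableSet {x | 0 < u x} μ :=
  nullMeasurableSet_lt aemeasurable_const h.aemeasurable_left

theorem IsPosPartData.integrable_posPartSlope (h : IsPosPartData μ c α u φ m R C) (s : ℝ) :
    Integrable (posPartSlope c α u φ s) μ := by
  have hα : ∀ᵐ x ∂μ, 0 < α x ∧ α x ≤ R := by
    filter_upwards [h.exp_mem] with x hx
    exact ⟨h.pos.trans_le hx.1, hx.2⟩
  have key : ∀ τ : ℝ, Integrable (fun x => max (u x + τ • φ x) 0 ^ α x) μ := by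
    intro τ
    refine (integrable_norm_add_smul_rpow h.aemeasurable_exp hα
      h.aemeasurable_left.aestronglyMeasurable h.aemeasurable_right.aestronglyMeasurable
      h.integrable_left h.integrable_right τ).mono'
      (((h.aemeasurable_left.add (h.aemeasurable_right.const_smul τ)).max
        aemeasurable_const).pow h.aemeasurable_exp).aestronglyMeasurable ?_
    filter_upwards [hα] with x hx
    have h0 : 0 ≤ max (u x + τ • φ x) 0 := le_max_right _ _
    rw [Real.norm_of_nonneg (Real.rpow_nonneg h0 _)]
    exact Real.rpow_le_rpow h0 (max_le (le_abs_self _) (norm_nonneg _)) hx.1.le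
  have h0 := key 0
  simp only [zero_smul, add_zero] at h0
  refine integrable_mul_of_bounded h.aemeasurable_coeff (C := C) ?_ (((key s).sub h0).div_const s)
  filter_upwards [h.coeff_mem] with x hx
  rw [abs_of_nonneg hx.1]
  exact hx.2

theorem IsPosPartData.aestronglyMeasurable_posPartVariation
    (h : IsPosPartData μ c α u φ m R C) :
    AEStronglyMeasurable (posPartVariation c α u φ) μ := by
  refine AEStronglyMeasurable.indicator₀ ?_ h.nullMeasurableSet
  exact (h.aemeasurable_coeff.mul ((h.aemeasurable_exp.mul (h.aemeasurable_left.pow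
    (h.aemeasurable_exp.sub_const 1))).mul h.aemeasurable_right)).aestronglyMeasurable

/-- Fatou's lemma for nonnegative directions. -/
theorem IsPosPartData.lintegral_posPartVariation_le (h : IsPosPartData μ c α u φ m R C)
    (hφ : ∀ x, 0 ≤ φ x) {l : Filter (ℝ × ℝ)} [l.NeBot] [l.IsCountablyGenerated]
    (hl : l ≤ 𝓝[>] 0 ×ˢ 𝓝 1) {q : ℝ × ℝ → ℝ} {L : ℝ} (hq : Tendsto q l (𝓝 L))
    (hle : ∀ᶠ z in l, ∫ x, z.2 ^ α x * posPartSlope c α u φ z.1 x ∂μ ≤ q z) :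
    ∫⁻ x, ENNReal.ofReal (posPartVariation c α u φ x) ∂μ ≤ ENNReal.ofReal L := by
  have hfst : Tendsto Prod.fst l (𝓝[>] 0) := tendsto_fst.mono_left hl
  have hsnd : Tendsto Prod.snd l (𝓝 1) := tendsto_snd.mono_left hl
  have hR1 : ∀ᵐ x ∂μ, |α x| ≤ R := by
    filter_upwards [h.exp_mem] with x hx
    rw [abs_of_pos (h.pos.trans_le hx.1)]; exact hx.2
  calc ∫⁻ x, ENNReal.ofReal (posPartVariation c α u φ x) ∂μ
      ≤ ∫⁻ x, liminf (fun z : ℝ × ℝ =>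
          ENNReal.ofReal (z.2 ^ α x * posPartSlope c α u φ z.1 x)) l ∂μ := by
        refine lintegral_mono fun x => ?_
        by_cases hu : 0 < u x
        · have h1 : Tendsto (fun z : ℝ × ℝ => z.2 ^ α x * posPartSlope c α u φ z.1 x) l
              (𝓝 (1 ^ α x * (c x * (α x * u x ^ (α x - 1) * φ x)))) :=
            (((Real.continuousAt_rpow_const 1 (α x) (Or.inl one_ne_zero)).tendsto).comp hsnd).mul
              ((tendsto_posPartSlope hu).comp hfst)
          have h2 : Tendsto (fun z : ℝ × ℝ =>
              ENNReal.ofReal (z.2 ^ α x * posPartSlope c α u φ z.1 x)) l _ :=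
            (ENNReal.continuous_ofReal.tendsto _).comp h1
          rw [h2.liminf_eq, Real.one_rpow, one_mul, posPartVariation,
            Set.indicator_of_mem (show x ∈ {x | 0 < u x} from hu)]
        -- The set {u ≤ 0} is simply discarded, although the quotients may blow up there.
        · rw [posPartVariation, Set.indicator_of_notMem (show x ∉ {x | 0 < u x} from hu),
            ENNReal.ofReal_zero]
          exact zero_le
    _ ≤ liminf (fun z : ℝ × ℝ =>
          ∫⁻ x, ENNReal.ofReal (z.2 ^ α x * posPartSlope c α u φ z.1 x) ∂μ) l :=
        lintegral_liminf_le' fun z => (aestronglyMeasurable_rpow_mul h.aemeasurable_exp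
          (h.integrable_posPartSlope z.1).1 z.2).aemeasurable.ennreal_ofReal
    _ ≤ liminf (fun z => ENNReal.ofReal (q z)) l := by
        refine liminf_le_liminf ?_
        filter_upwards [hle, hfst.eventually self_mem_nhdsWithin,
          hsnd.eventually (lt_mem_nhds one_pos)] with z hz hz1 hz2
        rw [← ofReal_integral_eq_lintegral_ofReal
          (integrable_rpow_mul h.aemeasurable_exp hR1 (h.integrable_posPartSlope z.1) hz2)]
        · exact ENNReal.ofReal_le_ofReal hz
        · filter_upwards [h.exp_mem, h.coeff_mem] with x hx hxc
          exact mul_nonneg (Real.rpow_nonneg hz2.le _)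
            (posPartSlope_nonneg hz1 hxc.1 (h.pos.trans_le hx.1) (hφ x))
    _ = ENNReal.ofReal L := ((ENNReal.continuous_ofReal.tendsto _).comp hq).liminf_eq

/-- Dominated convergence on {u > 0}. The majorant contains the first variation itself, divided by
the lower bound m of α, since the pointwise bound has u^{α-1} without the factor α. -/
theorem IsPosPartData.tendsto_integral_indicator (h : IsPosPartData μ c α u φ m R C)
    (hi : Integrable (posPartVariation c α u φ) μ) :
    Tendsto (fun z : ℝ × ℝ => ∫ x, z.2 ^ α x *
        {x | 0 < u x}.indicator (posPartSlope c α u φ z.1) x ∂μ) (𝓝[>] 0 ×ˢ 𝓝 1)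
      (𝓝 (∫ x, posPartVariation c α u φ x ∂μ)) := by
  have hR1 : ∀ᵐ x ∂μ, |α x| ≤ R := by
    filter_upwards [h.exp_mem] with x hx
    rw [abs_of_pos (h.pos.trans_le hx.1)]; exact hx.2
  have := tendsto_integral_rpow_mul h.aemeasurable_exp hR1 (l := 𝓝[>] (0 : ℝ)) (t := 1)
    (k := fun s x => {x | 0 < u x}.indicator (posPartSlope c α u φ s) x)
    (k₀ := posPartVariation c α u φ)
    (K := fun x => m⁻¹ * |posPartVariation c α u φ x| +
      C * (R * (2 ^ R * (‖u x‖ ^ α x + ‖φ x‖ ^ α x)))) ?_ ?_ ?_ ?_ one_pos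
  · simpa only [Real.one_rpow, one_mul] using this
  · exact Eventually.of_forall fun s =>
      (h.integrable_posPartSlope s).1.indicator₀ h.nullMeasurableSet
  · exact (hi.abs.const_mul _).add
      ((((h.integrable_left.add h.integrable_right).const_mul _).const_mul _).const_mul _)
  · filter_upwards [nhdsWithin_le_nhds eventually_abs_le_one, self_mem_nhdsWithin] with s hs hs0
    filter_upwards [h.exp_mem, h.coeff_mem] with x hx hxc
    have hα : 0 < α x := h.pos.trans_le hx.1
    have hC0 : 0 ≤ C := hxc.1.trans hxc.2
    have hR0 : 0 ≤ R := hα.le.trans hx.2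
    have hm := h.pos
    by_cases hu : 0 < u x
    · have hu' : x ∈ {x | 0 < u x} := hu
      rw [posPartVariation, Set.indicator_of_mem hu', Set.indicator_of_mem hu', posPartSlope,
        abs_mul, abs_of_nonneg hxc.1]
      have hup := Real.rpow_nonneg hu.le (α x - 1)
      refine (mul_le_mul_of_nonneg_left
        (abs_posPartSlope_le hs0 ((le_abs_self s).trans hs) hu hα hx.2) hxc.1).trans ?_
      rw [mul_add]
      refine add_le_add ?_ (mul_le_mul_of_nonneg_right hxc.2 (by positivity))
      rw [abs_mul, abs_mul, abs_mul, abs_of_nonneg hxc.1, abs_of_pos hα, abs_of_nonneg hup]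
      have h1 : 1 ≤ m⁻¹ * α x := by
        rw [inv_mul_eq_div, le_div_iff₀ h.pos, one_mul]; exact hx.1
      calc c x * (u x ^ (α x - 1) * |φ x|)
          ≤ (m⁻¹ * α x) * (c x * (u x ^ (α x - 1) * |φ x|)) :=
            le_mul_of_one_le_left (mul_nonneg hxc.1 (by positivity)) h1
        _ = _ := by ring
    · rw [Set.indicator_of_notMem (show x ∉ {x | 0 < u x} from hu), abs_zero]
      positivity
  · refine Eventually.of_forall fun x => ?_
    by_cases hu : 0 < u x
    · simp only [posPartVariation, Set.indicator_of_mem (show x ∈ {x | 0 < u x} from hu)]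
      exact tendsto_posPartSlope hu
    · simp only [posPartVariation, Set.indicator_of_notMem (show x ∉ {x | 0 < u x} from hu)]
      exact tendsto_const_nhds

/-- On {u ≤ 0} the quotient is nonnegative, so t^α may be lowered to κ. With κ = 0 this drops that
set; with κ > 0 it measures its contribution. -/
theorem IsPosPartData.integral_indicator_le (h : IsPosPartData μ c α u φ m R C) {s t : ℝ}
    (hs : 0 < s) (ht : 0 < t) {κ : ℝ} (hκ : ∀ᵐ x ∂μ, κ ≤ t ^ α x) :
    ∫ x, t ^ α x * {x | 0 < u x}.indicator (posPartSlope c α u φ s) x ∂μ +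
      κ * ∫ x, {x | 0 < u x}ᶜ.indicator (posPartSlope c α u φ s) x ∂μ ≤
      ∫ x, t ^ α x * posPartSlope c α u φ s x ∂μ := by
  have hR1 : ∀ᵐ x ∂μ, |α x| ≤ R := by
    filter_upwards [h.exp_mem] with x hx
    rw [abs_of_pos (h.pos.trans_le hx.1)]; exact hx.2
  have hi := h.integrable_posPartSlope s
  have i1 := integrable_rpow_mul h.aemeasurable_exp hR1 (hi.indicator₀ h.nullMeasurableSet) ht
  have i2 := hi.indicator₀ h.nullMeasurableSet.compl
  rw [← integral_const_mul, ← integral_add i1 (i2.const_mul κ)]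
  refine integral_mono_ae (i1.add (i2.const_mul κ))
    (integrable_rpow_mul h.aemeasurable_exp hR1 hi ht) ?_
  filter_upwards [h.exp_mem, h.coeff_mem, hκ] with x hx hxc hxκ
  by_cases hu : 0 < u x
  · simp [hu]
  · have h1 : x ∉ {x | 0 < u x} := hu
    simp only [Set.indicator_of_notMem h1, Set.indicator_of_mem
      (show x ∈ {x | 0 < u x}ᶜ from h1), mul_zero, zero_add]
    exact mul_le_mul_of_nonneg_right hxκ
      (posPartSlope_nonneg_of_nonpos hs hxc.1 (h.pos.trans_le hx.1) (not_lt.1 hu))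

theorem IsPosPartData.integral_compl_nonneg (h : IsPosPartData μ c α u φ m R C) {s : ℝ}
    (hs : 0 < s) : 0 ≤ ∫ x, {x | 0 < u x}ᶜ.indicator (posPartSlope c α u φ s) x ∂μ := by
  refine integral_nonneg_of_ae ?_
  filter_upwards [h.exp_mem, h.coeff_mem] with x hx hxc
  by_cases hu : x ∈ {x | 0 < u x}ᶜ
  · rw [Set.indicator_of_mem hu]
    exact posPartSlope_nonneg_of_nonpos hs hxc.1 (h.pos.trans_le hx.1) (not_lt.1 hu)
  · rw [Set.indicator_of_notMem hu]; rfl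

/-- Counterpart of `IsPosPartData.lintegral_posPartVariation_le` for directions of arbitrary sign;
the price is that integrability is assumed. -/
theorem IsPosPartData.integral_posPartVariation_le (h : IsPosPartData μ c α u φ m R C)
    (hi : Integrable (posPartVariation c α u φ) μ) {l : Filter (ℝ × ℝ)} [l.NeBot]
    (hl : l ≤ 𝓝[>] 0 ×ˢ 𝓝 1) {q : ℝ × ℝ → ℝ} {L : ℝ} (hq : Tendsto q l (𝓝 L))
    (hle : ∀ᶠ z in l, ∫ x, z.2 ^ α x * posPartSlope c α u φ z.1 x ∂μ ≤ q z) :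
    ∫ x, posPartVariation c α u φ x ∂μ ≤ L := by
  have hfst : Tendsto Prod.fst l (𝓝[>] 0) := tendsto_fst.mono_left hl
  have hsnd : Tendsto Prod.snd l (𝓝 1) := tendsto_snd.mono_left hl
  refine le_of_tendsto_of_tendsto ((h.tendsto_integral_indicator hi).mono_left hl) hq ?_
  filter_upwards [hle, hfst.eventually self_mem_nhdsWithin,
    hsnd.eventually (lt_mem_nhds one_pos)] with z hz hz1 hz2
  have := h.integral_indicator_le hz1 hz2 (κ := 0)
    (Eventually.of_forall fun x => Real.rpow_nonneg hz2.le _)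
  rw [zero_mul, add_zero] at this
  exact this.trans hz

/-- If the first variation of the singular integral attains its upper bound, then the difference
quotients converge to it. -/
theorem IsPosPartData.tendsto_integral_posPartSlope (h : IsPosPartData μ c α u φ m R C)
    (hi : Integrable (posPartVariation c α u φ) μ) {q : ℝ × ℝ → ℝ}
    (hq : Tendsto q (𝓝[>] 0 ×ˢ 𝓝 1) (𝓝 (∫ x, posPartVariation c α u φ x ∂μ)))
    (hle : ∀ η : ℝ, 0 < η → ∀ᶠ s in 𝓝[>] (0 : ℝ), ∃ t, |t - 1| < η ∧
      ∫ x, t ^ α x * posPartSlope c α u φ s x ∂μ ≤ q (s, t)) :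
    Tendsto (fun s => ∫ x, posPartSlope c α u φ s x ∂μ) (𝓝[>] 0)
      (𝓝 (∫ x, posPartVariation c α u φ x ∂μ)) := by
  set M := ∫ x, posPartVariation c α u φ x ∂μ
  have hG := h.tendsto_integral_indicator hi
  have hG1 : Tendsto (fun s => ∫ x, {x | 0 < u x}.indicator (posPartSlope c α u φ s) x ∂μ)
      (𝓝[>] 0) (𝓝 M) := by
    have := hG.comp (tendsto_id.prodMk (tendsto_const_nhds (x := (1 : ℝ))))
    simpa only [Function.comp_def, id_eq, Real.one_rpow, one_mul] using this
  -- The contribution of {u ≤ 0} is nonnegative, and κ times it is at most q minus the contribution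
  -- of {u > 0}. Both of these have the same limit, so the difference tends to 0.
  have hbad : Tendsto (fun s => ∫ x, {x | 0 < u x}ᶜ.indicator (posPartSlope c α u φ s) x ∂μ)
      (𝓝[>] 0) (𝓝 0) := by
    rw [Metric.tendsto_nhds]
    intro ε hε
    -- A lower bound for t^α when t ≥ 1/2 and 0 < α ≤ R.
    set κ : ℝ := (1 / 2) ^ R with hκ
    have hκ0 : 0 < κ := by positivity
    have hev : ∀ᶠ z in 𝓝[>] (0 : ℝ) ×ˢ 𝓝 (1 : ℝ), q z -
        ∫ x, z.2 ^ α x * {x | 0 < u x}.indicator (posPartSlope c α u φ z.1) x ∂μ < κ * ε := by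
      have := hq.sub hG
      rw [sub_self] at this
      exact this.eventually (gt_mem_nhds (by positivity))
    obtain ⟨A, hA, B, hB, hAB⟩ := eventually_prod_iff.1 hev
    obtain ⟨η, hη, hηB⟩ := Metric.eventually_nhds_iff.1 hB
    filter_upwards [hA, hle (min η (1 / 2)) (by positivity), self_mem_nhdsWithin]
      with s hsA ⟨t, ht, hst⟩ hs0
    rw [lt_min_iff] at ht
    have ht2 := abs_lt.1 ht.2
    have h1 := hAB hsA (hηB (y := t) (by rw [Real.dist_eq]; exact ht.1))
    have h2 := h.integral_indicator_le (φ := φ) hs0 (by linarith : 0 < t) (κ := κ) (by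
      filter_upwards [h.exp_mem] with x hx
      have hα : 0 < α x := h.pos.trans_le hx.1
      calc κ ≤ (1 / 2) ^ α x := Real.rpow_le_rpow_of_exponent_ge (by norm_num) (by norm_num) hx.2
        _ ≤ t ^ α x := Real.rpow_le_rpow (by norm_num) (by linarith) hα.le)
    have h3 := h.integral_compl_nonneg hs0
    rw [Real.dist_eq, sub_zero, abs_of_nonneg h3]
    refine lt_of_mul_lt_mul_left (a := κ) ?_ hκ0.le
    simp only at h1
    linarith
  have hsum := hG1.add hbad
  rw [add_zero] at hsum
  refine hsum.congr fun s => ?_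
  have hs := h.integrable_posPartSlope s
  rw [← integral_add (hs.indicator₀ h.nullMeasurableSet)
    (hs.indicator₀ h.nullMeasurableSet.compl)]
  refine integral_congr_ae (Eventually.of_forall fun x => ?_)
  exact congrFun (Set.indicator_self_add_compl {x | 0 < u x} (posPartSlope c α u φ s)) x

end PositivePart

end Slopes

/-! ### Uniform bounds on the data -/

open Filter Topology

/-- Uniform bounds for the data of an admissible problem. -/
structure Problem.HasBounds {N : ℕ} (P : Problem N) (m R C : ℝ) : Prop where
  exponent_p : IsExponent P.Ω P.p R
  exponent_q : IsExponent P.Ω P.q R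
  one_lt_p : ∀ᵐ x ∂(volume.restrict P.Ω), 1 < P.p x ∧ P.p x ≤ R
  one_lt_q : ∀ᵐ x ∂(volume.restrict P.Ω), 1 < P.q x ∧ P.q x ≤ R
  pos : 0 < m
  meas_exp : AEMeasurable (fun x => 1 - P.δ x) (volume.restrict P.Ω)
  exp_mem : ∀ᵐ x ∂(volume.restrict P.Ω), m ≤ 1 - P.δ x ∧ 1 - P.δ x ≤ R
  exp_lt : ∀ᵐ x ∂(volume.restrict P.Ω), 1 - P.δ x < P.p x
  meas_p : AEMeasurable (fun x => (P.p x)⁻¹) (volume.restrict P.Ω)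
  meas_q : AEMeasurable (fun x => P.a x / P.q x) (volume.restrict P.Ω)
  meas_sing : AEMeasurable (fun x => P.b x / (1 - P.δ x)) (volume.restrict P.Ω)
  le_p : ∀ᵐ x ∂(volume.restrict P.Ω), |(P.p x)⁻¹| ≤ C
  le_q : ∀ᵐ x ∂(volume.restrict P.Ω), |P.a x / P.q x| ≤ C
  le_sing : ∀ᵐ x ∂(volume.restrict P.Ω), 0 ≤ P.b x / (1 - P.δ x) ∧ P.b x / (1 - P.δ x) ≤ C

theorem Problem.Admissible.exists_hasBounds {N : ℕ} {P : Problem N} (hP : P.Admissible) :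
    ∃ m R C, P.HasBounds m R C := by
  have hK : IsCompact (closure P.Ω) := hP.isBounded.isCompact_closure
  have hne : (closure P.Ω).Nonempty := hP.isConnected.nonempty.closure
  have hm : MeasurableSet P.Ω := hP.isOpen.measurableSet
  have q1 : ∀ x ∈ closure P.Ω, 1 < P.q x := fun x hx =>
    (hP.one_lt_p x hx).trans (hP.p_lt_q x hx)
  have cα : ContinuousOn (fun x => 1 - P.δ x) (closure P.Ω) := continuousOn_const.sub hP.cont_δ
  have cp : ContinuousOn (fun x => (P.p x)⁻¹) (closure P.Ω) :=
    hP.cont_p.inv₀ fun x hx => by linarith [hP.one_lt_p x hx]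
  have cq : ContinuousOn (fun x => P.a x / P.q x) (closure P.Ω) :=
    hP.cont_a.div hP.cont_q fun x hx => by linarith [q1 x hx]
  have cs : ContinuousOn (fun x => P.b x / (1 - P.δ x)) (closure P.Ω) :=
    hP.cont_b.div cα fun x hx => (hP.δ_lt_one x hx).ne'
  obtain ⟨x₀, hx₀, hmin⟩ := hK.exists_isMinOn hne cα
  obtain ⟨R₁, hR₁⟩ := hK.exists_bound_of_continuousOn hP.cont_p
  obtain ⟨R₂, hR₂⟩ := hK.exists_bound_of_continuousOn hP.cont_q
  obtain ⟨R₃, hR₃⟩ := hK.exists_bound_of_continuousOn cα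
  obtain ⟨C₁, hC₁⟩ := hK.exists_bound_of_continuousOn cp
  obtain ⟨C₂, hC₂⟩ := hK.exists_bound_of_continuousOn cq
  obtain ⟨C₃, hC₃⟩ := hK.exists_bound_of_continuousOn cs
  have ae : ∀ {Q : Sp N → Prop}, (∀ x ∈ closure P.Ω, Q x) →
      ∀ᵐ x ∂(volume.restrict P.Ω), Q x := fun h =>
    ae_restrict_of_forall_mem hm fun x hx => h x (subset_closure hx)
  have meas : ∀ {f : Sp N → ℝ}, ContinuousOn f (closure P.Ω) →
      AEMeasurable f (volume.restrict P.Ω) := fun h =>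
    (h.mono subset_closure).aemeasurable hm
  set R := max R₁ (max R₂ R₃) with hR
  have r1 : R₁ ≤ R := le_max_left _ _
  have r2 : R₂ ≤ R := (le_max_left _ _).trans (le_max_right _ _)
  have r3 : R₃ ≤ R := (le_max_right _ _).trans (le_max_right _ _)
  set C := max C₁ (max C₂ C₃) with hC
  have c1 : C₁ ≤ C := le_max_left _ _
  have c2 : C₂ ≤ C := (le_max_left _ _).trans (le_max_right _ _)
  have c3 : C₃ ≤ C := (le_max_right _ _).trans (le_max_right _ _)
  have fin : volume P.Ω < ⊤ := hP.isBounded.measure_lt_top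
  have p2 : ∀ x ∈ closure P.Ω, 1 < P.p x ∧ P.p x ≤ R := fun x hx =>
    ⟨hP.one_lt_p x hx, ((le_abs_self _).trans (hR₁ x hx)).trans r1⟩
  have q2 : ∀ x ∈ closure P.Ω, 1 < P.q x ∧ P.q x ≤ R := fun x hx =>
    ⟨q1 x hx, ((le_abs_self _).trans (hR₂ x hx)).trans r2⟩
  refine ⟨1 - P.δ x₀, R, C, ⟨hP.isOpen, fin, meas hP.cont_p, fun x hx => (p2 x
    (subset_closure hx)).1.le, fun x hx => (p2 x (subset_closure hx)).2⟩,
    ⟨hP.isOpen, fin, meas hP.cont_q, fun x hx => (q2 x (subset_closure hx)).1.le,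
      fun x hx => (q2 x (subset_closure hx)).2⟩, ae p2, ae q2, hP.δ_lt_one x₀ hx₀, meas cα,
    ae fun x hx => ⟨hmin hx, ((le_abs_self _).trans (hR₃ x hx)).trans r3⟩,
    ae hP.one_sub_δ_lt_p, meas cp, meas cq, meas cs, ae fun x hx => (hC₁ x hx).trans c1,
    ae fun x hx => (hC₂ x hx).trans c2, ae fun x hx => ⟨?_, ?_⟩⟩
  · exact div_nonneg (hP.b_nonneg x hx) (hP.δ_lt_one x hx).le
  · exact ((le_abs_self _).trans (hC₃ x hx)).trans c3

/-! ### Fibers through nearby points and the Nehari manifold -/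

section Fiber

variable {N : ℕ}

/-- The part of `E(t (f + s φ))` coming from the gradient and the term with exponent `q`; here `g`
and `γ` are the weak gradients of `f` and `φ`. -/
noncomputable def Problem.regularPart (P : Problem N) (f φ : Sp N → ℝ) (g γ : Sp N → Sp N)
    (s t : ℝ) : ℝ :=
  (∫ x in P.Ω, t ^ P.p x * ((P.p x)⁻¹ * ‖g x + s • γ x‖ ^ P.p x)) -
    ∫ x in P.Ω, t ^ P.q x * (P.a x / P.q x * ‖f x + s • φ x‖ ^ P.q x)

/-- The integral of the term with exponent `1 - δ` at `t (f + s φ)`. -/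
noncomputable def Problem.singularPart (P : Problem N) (f φ : Sp N → ℝ) (s t : ℝ) : ℝ :=
  ∫ x in P.Ω, t ^ (1 - P.δ x) * (P.b x / (1 - P.δ x) * max (f x + s • φ x) 0 ^ (1 - P.δ x))

/-- The energy of `t (f + s φ)`. -/
noncomputable def Problem.fiberEnergy (P : Problem N) (f φ : Sp N → ℝ) (g γ : Sp N → Sp N)
    (s t : ℝ) : ℝ :=
  P.regularPart f φ g γ s t - P.lam * P.singularPart f φ s t

variable {P : Problem N} {m R C : ℝ}

theorem energy_eq_fiberEnergy (hB : P.HasBounds m R C) {f φ : Sp N → ℝ} {g γ : Sp N → Sp N}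
    (hf : HasWeakGrad P.Ω f g) (hφ : HasWeakGrad P.Ω φ γ) {s t : ℝ} (ht : 0 < t)
    {w : MeasFun P.Ω} (hw : w =ᵐ[volume.restrict P.Ω] fun x => t • (f x + s • φ x)) :
    P.energy w = P.fiberEnergy f φ g γ s t := by
  have hg : weakGrad P.Ω w =ᵐ[volume.restrict P.Ω] fun x => t • (g x + s • γ x) := by
    refine HasWeakGrad.weakGrad_ae_eq hB.exponent_p.isOpen (HasWeakGrad.congr ?_ hw.symm .rfl)
    exact (hf.add hB.exponent_p.isOpen (hφ.smul s)).smul t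
  unfold Problem.energy Problem.fiberEnergy Problem.regularPart Problem.singularPart
  congr 1
  · congr 1
    · refine integral_congr_ae ?_
      filter_upwards [hg] with x hx
      rw [hx, norm_smul, Real.norm_of_nonneg ht.le, Real.mul_rpow ht.le (norm_nonneg _)]
      ring
    · refine integral_congr_ae ?_
      filter_upwards [hw] with x hx
      rw [hx, ← Real.norm_eq_abs, norm_smul, Real.norm_of_nonneg ht.le,
        Real.mul_rpow ht.le (norm_nonneg _)]
      ring
  · congr 1
    refine integral_congr_ae ?_
    filter_upwards [hw] with x hx
    have : max (t • (f x + s • φ x)) 0 = t * max (f x + s • φ x) 0 := by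
      rw [mul_max_of_nonneg _ _ ht.le, mul_zero, smul_eq_mul]
    rw [hx, this, Real.mul_rpow ht.le (le_max_right _ _)]
    ring

theorem IsSobolevZero.integrable_grad (hB : P.HasBounds m R C) {f : Sp N → ℝ}
    {g : Sp N → Sp N} (hf : IsSobolevZero P.Ω P.p f g) :
    Integrable (fun x => ‖g x‖ ^ P.p x) (volume.restrict P.Ω) :=
  hf.mem_grad.integrable_rpow hB.exponent_p

theorem IsSobolevZero.memVarLp_q (hP : P.Admissible) (hB : P.HasBounds m R C)
    {f : Sp N → ℝ} {g : Sp N → Sp N} (hf : IsSobolevZero P.Ω P.p f g) :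
    MemVarLp P.Ω P.q f :=
  hf.memVarLp_of_subcritical hP.two_le hB.exponent_p hB.exponent_q hP.isBounded
    hP.cont_p hP.cont_q hP.one_lt_p hP.p_lt_q hP.q_lt_pstar

theorem IsSobolevZero.integrable_q (hP : P.Admissible) (hB : P.HasBounds m R C)
    {f : Sp N → ℝ} {g : Sp N → Sp N} (hf : IsSobolevZero P.Ω P.p f g) :
    Integrable (fun x => ‖f x‖ ^ P.q x) (volume.restrict P.Ω) :=
  (hf.memVarLp_q hP hB).integrable_rpow hB.exponent_q

/-- Since 1 - δ < p, the power is at most 1 + |f|^p, and Ω has finite measure. -/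
theorem IsSobolevZero.integrable_sing (hB : P.HasBounds m R C)
    {f : Sp N → ℝ} {g : Sp N → Sp N} (hf : IsSobolevZero P.Ω P.p f g) :
    Integrable (fun x => ‖f x‖ ^ (1 - P.δ x)) (volume.restrict P.Ω) := by
  have := hB.exponent_p.isFiniteMeasure
  refine ((integrable_const (1 : ℝ)).add (hf.mem.integrable_rpow hB.exponent_p)).mono'
    (hf.mem.1.norm.aemeasurable.pow hB.meas_exp).aestronglyMeasurable ?_
  filter_upwards [hB.exp_mem, hB.exp_lt] with x hx hxp
  rw [Real.norm_of_nonneg (Real.rpow_nonneg (norm_nonneg _) _)]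
  exact rpow_le_one_add_rpow (norm_nonneg _) (hB.pos.le.trans hx.1) hxp.le

theorem Problem.HasBounds.pos_p (hB : P.HasBounds m R C) :
    ∀ᵐ x ∂(volume.restrict P.Ω), 0 < P.p x ∧ P.p x ≤ R :=
  hB.one_lt_p.mono fun _ hx => ⟨by linarith, hx.2⟩

theorem Problem.HasBounds.pos_q (hB : P.HasBounds m R C) :
    ∀ᵐ x ∂(volume.restrict P.Ω), 0 < P.q x ∧ P.q x ≤ R :=
  hB.one_lt_q.mono fun _ hx => ⟨by linarith, hx.2⟩

theorem Problem.HasBounds.pos_exp (hB : P.HasBounds m R C) :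
    ∀ᵐ x ∂(volume.restrict P.Ω), 0 < 1 - P.δ x ∧ 1 - P.δ x ≤ R :=
  hB.exp_mem.mono fun _ hx => ⟨hB.pos.trans_le hx.1, hx.2⟩

theorem Problem.HasBounds.abs_sing_le (hB : P.HasBounds m R C) :
    ∀ᵐ x ∂(volume.restrict P.Ω), |P.b x / (1 - P.δ x)| ≤ C :=
  hB.le_sing.mono fun _ hx => by rw [abs_of_nonneg hx.1]; exact hx.2

theorem max_zero_le_norm (v : ℝ) : max v 0 ≤ ‖v‖ := max_le (le_abs_self v) (norm_nonneg v)

theorem exists_isFiberFamily (hP : P.Admissible) (hB : P.HasBounds m R C) {f φ : Sp N → ℝ}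
    {g γ : Sp N → Sp N} (hf : IsSobolevZero P.Ω P.p f g) (hφ : IsSobolevZero P.Ω P.p φ γ) :
    ∃ F₁ F₂, IsFiberFamily (P.fiberEnergy f φ g γ) F₁ F₂ :=
  ⟨_, _, ((isFiberFamily_integral hB.exponent_p.meas hB.pos_p hB.meas_p hB.le_p continuous_norm
    norm_nonneg (fun _ => le_rfl) hf.mem_grad.1 hφ.mem_grad.1 (hf.integrable_grad hB)
    (hφ.integrable_grad hB)).sub
    (isFiberFamily_integral hB.exponent_q.meas hB.pos_q hB.meas_q hB.le_q continuous_norm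
    norm_nonneg (fun _ => le_rfl) hf.mem.1 hφ.mem.1 (hf.integrable_q hP hB)
    (hφ.integrable_q hP hB))).sub ((isFiberFamily_integral hB.meas_exp hB.pos_exp hB.meas_sing
    hB.abs_sing_le (continuous_id.max continuous_const) (fun v => le_max_right v 0)
    max_zero_le_norm hf.mem.1 hφ.mem.1 (hf.integrable_sing hB)
    (hφ.integrable_sing hB)).const_mul P.lam)⟩

theorem coeFn_smul_add_smul {Ω : Set (Sp N)} (u φ : MeasFun Ω) (s t : ℝ) :
    (t • (u + s • φ) : MeasFun Ω) =ᵐ[volume.restrict Ω] fun x => t • (u x + s • φ x) := by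
  filter_upwards [AEEqFun.coeFn_smul t (u + s • φ), AEEqFun.coeFn_add u (s • φ),
    AEEqFun.coeFn_smul s φ] with x h1 h2 h3
  simp only [h1, h2, h3, Pi.smul_apply, Pi.add_apply]

theorem smul_add_smul_mem_W0 (hB : P.HasBounds m R C) {u φ : MeasFun P.Ω}
    {g γ : Sp N → Sp N} (hu : IsSobolevZero P.Ω P.p u g) (hφ : IsSobolevZero P.Ω P.p φ γ)
    (s t : ℝ) : t • (u + s • φ) ∈ W0 P.Ω P.p :=
  IsSobolevZero.mem_W0 hB.exponent_p (((hu.add hB.exponent_p (hφ.smul hB.exponent_p s)).smul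
    hB.exponent_p t).congr (coeFn_smul_add_smul u φ s t).symm .rfl)

theorem fiber_smul_add_smul (hB : P.HasBounds m R C) {u φ : MeasFun P.Ω}
    {g γ : Sp N → Sp N} (hu : IsSobolevZero P.Ω P.p u g) (hφ : IsSobolevZero P.Ω P.p φ γ)
    (s : ℝ) {t τ : ℝ} (ht : 0 < t) (hτ : 0 < τ) :
    P.fiber (t • (u + s • φ)) τ = P.fiberEnergy u φ g γ s (t * τ) := by
  unfold Problem.fiber
  rw [smul_smul, mul_comm τ t]
  exact energy_eq_fiberEnergy hB hu.hasWeakGrad hφ.hasWeakGrad (mul_pos ht hτ)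
    (coeFn_smul_add_smul u φ s _)

theorem hasDerivAt_fiber (hB : P.HasBounds m R C) {u φ : MeasFun P.Ω}
    {g γ : Sp N → Sp N} (hu : IsSobolevZero P.Ω P.p u g) (hφ : IsSobolevZero P.Ω P.p φ γ)
    {F₁ F₂ : ℝ → ℝ → ℝ} (hF : IsFiberFamily (P.fiberEnergy u φ g γ) F₁ F₂)
    (s : ℝ) {t τ : ℝ} (ht : 0 < t) (hτ : 0 < τ) :
    HasDerivAt (P.fiber (t • (u + s • φ))) (F₁ s (t * τ) * t) τ := by
  have h1 : HasDerivAt (fun τ : ℝ => t * τ) t τ := by simpa using (hasDerivAt_id τ).const_mul t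
  refine ((hF.hasDerivAt s _ (mul_pos ht hτ)).comp τ h1).congr_of_eventuallyEq ?_
  filter_upwards [lt_mem_nhds hτ] with τ' hτ'
  exact fiber_smul_add_smul hB hu hφ s ht hτ'

theorem deriv_deriv_fiber (hB : P.HasBounds m R C) {u φ : MeasFun P.Ω}
    {g γ : Sp N → Sp N} (hu : IsSobolevZero P.Ω P.p u g) (hφ : IsSobolevZero P.Ω P.p φ γ)
    {F₁ F₂ : ℝ → ℝ → ℝ} (hF : IsFiberFamily (P.fiberEnergy u φ g γ) F₁ F₂)
    (s : ℝ) {t : ℝ} (ht : 0 < t) :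
    deriv (deriv (P.fiber (t • (u + s • φ)))) 1 = F₂ s t * t * t := by
  have h1 : HasDerivAt (fun τ : ℝ => t * τ) t 1 := by simpa using (hasDerivAt_id 1).const_mul t
  have h2 : HasDerivAt (fun τ : ℝ => F₁ s (t * τ) * t) (F₂ s (t * 1) * t * t) 1 :=
    (((hF.hasDerivAt_deriv s _ (by simpa using ht)).comp 1 h1)).mul_const t
  have h3 : deriv (P.fiber (t • (u + s • φ))) =ᶠ[𝓝 1] fun τ => F₁ s (t * τ) * t := by
    filter_upwards [lt_mem_nhds one_pos] with τ hτ
    exact (hasDerivAt_fiber hB hu hφ hF s ht hτ).deriv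
  rw [h3.deriv_eq, h2.deriv, mul_one]

/-- The fiber map of 0 is constant. This is how the perturbed points t(u + sφ) are seen to be
nonzero. -/
theorem ne_zero_of_deriv_deriv_fiber_ne_zero {w : MeasFun P.Ω}
    (h : deriv (deriv (P.fiber w)) 1 ≠ 0) : w ≠ 0 := by
  rintro rfl
  refine h ?_
  have : P.fiber (0 : MeasFun P.Ω) = fun _ => P.energy 0 := by
    ext t
    unfold Problem.fiber
    rw [smul_zero]
  rw [this]
  simp

/-- The difference equals (t - 1)u + tsφ, with coefficients at most 2η ≤ 1, so its modular and that
of its gradient are of order η. -/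
theorem exists_sobolevNorm_lt (hB : P.HasBounds m R C) {u φ : MeasFun P.Ω}
    {g γ : Sp N → Sp N} (hu : IsSobolevZero P.Ω P.p u g) (hφ : IsSobolevZero P.Ω P.p φ γ)
    {r : ℝ} (hr : 0 < r) : ∃ η : ℝ, 0 < η ∧ ∀ s t : ℝ, |s| < η → |t - 1| < η →
      sobolevNorm P.Ω P.p ⇑(t • (u + s • φ) - u) < r := by
  have hp := hB.exponent_p
  set κ := min 1 (r / 3) with hκ
  have hκ0 : 0 < κ := lt_min one_pos (by positivity)
  set A : ENNReal := modular P.Ω P.p u + modular P.Ω P.p φ +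
    (modular P.Ω P.p g + modular P.Ω P.p γ) with hA
  have hAt : A ≠ ⊤ := by
    simp only [hA, ne_eq, ENNReal.add_eq_top, not_or]
    exact ⟨⟨hu.mem.2.ne, hφ.mem.2.ne⟩, hu.mem_grad.2.ne, hφ.mem_grad.2.ne⟩
  set a := A.toReal with ha
  have ha0 : 0 ≤ a := ENNReal.toReal_nonneg
  have hAa : A = ENNReal.ofReal a := (ENNReal.ofReal_toReal hAt).symm
  -- Chosen so that 2^R · 2η · a ≤ κ^R; a + 1 in place of a keeps η positive when a = 0.
  set η := min (1 / 2) (κ ^ R / (2 ^ R * (2 * (a + 1)))) with hη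
  have hη0 : 0 < η := lt_min (by norm_num) (by positivity)
  refine ⟨η, hη0, fun s t hs ht => ?_⟩
  have hη2 : η ≤ 1 / 2 := min_le_left _ _
  have ht1 : |t - 1| ≤ 1 := by linarith
  have ht2 : |t| ≤ 2 := by
    have := abs_add_le (t - 1) 1
    simp only [sub_add_cancel, abs_one] at this
    linarith
  have hts : |t * s| ≤ 2 * η := by
    rw [abs_mul]
    exact mul_le_mul ht2 hs.le (abs_nonneg _) (by norm_num)
  have key : ∀ {F : Type} [NormedAddCommGroup F] [NormedSpace ℝ F] (f h : Sp N → F),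
      AEStronglyMeasurable f (volume.restrict P.Ω) →
      modular P.Ω P.p f + modular P.Ω P.p h ≤ A →
      modular P.Ω P.p (fun x => (t - 1) • f x + (t * s) • h x) ≤ ENNReal.ofReal (κ ^ R) := by
    intro F _ _ f h hf hle
    refine (modular_add_le hp _ (hf.const_smul (t - 1))).trans ?_
    calc ENNReal.ofReal (2 ^ R) * (modular P.Ω P.p (fun x => (t - 1) • f x) +
          modular P.Ω P.p (fun x => (t * s) • h x))
        ≤ ENNReal.ofReal (2 ^ R) * (ENNReal.ofReal (2 * η) * modular P.Ω P.p f +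
          ENNReal.ofReal (2 * η) * modular P.Ω P.p h) := by
          refine mul_le_mul_right (add_le_add ?_ ?_) _
          · refine (modular_smul_le_of_abs_le_one hp f ht1).trans (mul_le_mul_left ?_ _)
            exact ENNReal.ofReal_le_ofReal (by linarith)
          · refine (modular_smul_le_of_abs_le_one hp h (by linarith)).trans (mul_le_mul_left ?_ _)
            exact ENNReal.ofReal_le_ofReal hts
      _ ≤ ENNReal.ofReal (2 ^ R) * (ENNReal.ofReal (2 * η) * A) := by
          rw [← mul_add]
          exact mul_le_mul_right (mul_le_mul_right hle _) _
      _ = ENNReal.ofReal (2 ^ R * (2 * η * a)) := by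
          rw [hAa, ← ENNReal.ofReal_mul (by positivity : 0 ≤ 2 * η),
            ← ENNReal.ofReal_mul (by positivity)]
      _ ≤ ENNReal.ofReal (κ ^ R) := by
          refine ENNReal.ofReal_le_ofReal ?_
          have h1 : η * (2 ^ R * (2 * (a + 1))) ≤ κ ^ R :=
            (le_div_iff₀ (by positivity)).1 (min_le_right _ _)
          have h2 : 0 ≤ 2 ^ R * (2 * η) := by positivity
          calc 2 ^ R * (2 * η * a) ≤ η * (2 ^ R * (2 * (a + 1))) := by linarith
            _ ≤ _ := h1
  have hae : (fun x => (t - 1) • u x + (t * s) • φ x) =ᵐ[volume.restrict P.Ω]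
      ⇑(t • (u + s • φ) - u) := by
    filter_upwards [AEEqFun.coeFn_sub (t • (u + s • φ)) u, coeFn_smul_add_smul u φ s t]
      with x h1 h2
    rw [h1, Pi.sub_apply, h2]
    simp only [smul_eq_mul]
    ring
  have hgrad : HasWeakGrad P.Ω ⇑(t • (u + s • φ) - u)
      (fun x => (t - 1) • g x + (t * s) • γ x) :=
    ((hu.hasWeakGrad.smul (t - 1)).add hp.isOpen (hφ.hasWeakGrad.smul (t * s))).congr hae .rfl
  have := IsSobolevZero.sobolevNorm_le hp hgrad hκ0 (min_le_left _ _)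
    (by rw [← modular_congr hae]; exact key _ _ hu.mem.1 le_self_add)
    (key _ _ hu.mem_grad.1 le_add_self)
  have := min_le_right 1 (r / 3)
  linarith

/-- Along the fibers near a local minimizer on one of the two parts of the Nehari manifold, the
energy is not smaller than the energy on the fiber of the minimizer. -/
theorem exists_fiberEnergy_le (hP : P.Admissible) (hB : P.HasBounds m R C)
    {u φ : MeasFun P.Ω} {g γ : Sp N → Sp N}
    (hmin : P.IsLocalMinimizerOn P.nehariPos u ∨ P.IsLocalMinimizerOn P.nehariNeg u)
    (hu : IsSobolevZero P.Ω P.p u g) (hφ : IsSobolevZero P.Ω P.p φ γ) {η : ℝ} (hη : 0 < η) :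
    ∀ᶠ s in 𝓝 (0 : ℝ), ∃ t, 0 < t ∧ |t - 1| < η ∧
      P.fiberEnergy u φ g γ 0 t ≤ P.fiberEnergy u φ g γ s t := by
  obtain ⟨F₁, F₂, hF⟩ := exists_isFiberFamily hP hB hu hφ
  have hw : ∀ s t : ℝ, 0 < t → P.energy (t • (u + s • φ)) = P.fiberEnergy u φ g γ s t :=
    fun s t ht => energy_eq_fiberEnergy hB hu.hasWeakGrad hφ.hasWeakGrad ht
      (coeFn_smul_add_smul u φ s t)
  have hu1 : (1 : ℝ) • (u + (0 : ℝ) • φ) = u := by simp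
  have hE : P.energy u = P.fiberEnergy u φ g γ 0 1 := by
    rw [← hw 0 1 one_pos, hu1]
  have hd1 := hasDerivAt_fiber hB hu hφ hF 0 one_pos one_pos
  have hd2 := deriv_deriv_fiber hB hu hφ hF 0 one_pos
  rw [hu1] at hd1 hd2
  simp only [mul_one] at hd1 hd2
  have hball : ∀ {ρ : ℝ}, 0 < ρ → ∀ᶠ s in 𝓝 (0 : ℝ), |s| < ρ := fun hρ => by
    filter_upwards [Metric.ball_mem_nhds (0 : ℝ) hρ] with s hs
    simpa [Real.dist_eq] using hs
  have hneh : ∀ s t, 0 < t → F₁ s t = 0 → F₂ s t ≠ 0 → t • (u + s • φ) ∈ P.nehari := by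
    intro s t ht h1 h2
    refine ⟨smul_add_smul_mem_W0 hB hu hφ s t, ?_, ?_⟩
    · refine ne_zero_of_deriv_deriv_fiber_ne_zero ?_
      rw [deriv_deriv_fiber hB hu hφ hF s ht]
      exact mul_ne_zero (mul_ne_zero h2 ht.ne') ht.ne'
    · simpa [h1] using hasDerivAt_fiber hB hu hφ hF s ht one_pos
  rcases hmin with ⟨⟨⟨-, -, hd⟩, hpos⟩, r, hr, hmin⟩ | ⟨⟨⟨-, -, hd⟩, hneg⟩, r, hr, hmin⟩
  · obtain ⟨ρ, hρ, hnorm⟩ := exists_sobolevNorm_lt hB hu hφ hr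
    filter_upwards [hF.exists_isMin (hd1.unique hd) (hd2 ▸ hpos) hρ, hball hρ]
      with s ⟨t, ht, htρ, h1, h2, h3, h4⟩ hs
    -- On N⁺ the point of the fiber to compare is 1 itself: E(u) ≤ E(t(u + sφ)) ≤ E(u + sφ), the
    -- last step because t minimizes the fiber map near 1.
    refine ⟨1, one_pos, by simpa using hη, ?_⟩
    rw [← hE]
    refine (hmin _ ⟨hneh s t ht h1 h2.ne', ?_⟩ (hnorm s t hs htρ)).trans ?_
    · rw [deriv_deriv_fiber hB hu hφ hF s ht]
      positivity
    · rw [hw s t ht]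
      exact h3
  · obtain ⟨ρ, hρ, hnorm⟩ := exists_sobolevNorm_lt hB hu hφ hr
    filter_upwards [hF.exists_isMax (hd1.unique hd) (hd2 ▸ hneg) (lt_min hρ hη), hball hρ]
      with s ⟨t, ht, htρ, h1, h2, h3, h4⟩ hs
    rw [lt_min_iff] at htρ
    -- On N⁻ the fiber of u has a local maximum at 1, whence E(tu) ≤ E(u) ≤ E(t(u + sφ)).
    refine ⟨t, ht, htρ.2, h4.trans ?_⟩
    rw [← hE, ← hw s t ht]
    refine hmin _ ⟨hneh s t ht h1 h2.ne, ?_⟩ (hnorm s t hs htρ.1)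
    rw [deriv_deriv_fiber hB hu hφ hF s ht, mul_assoc]
    exact mul_neg_of_neg_of_pos h2 (mul_pos ht ht)

end Fiber

/-! ### Smooth approximation of the absolute value -/

section SmoothAbs

/-- A smooth approximation of the absolute value which vanishes at the origin. -/
noncomputable def smoothAbs (ε y : ℝ) : ℝ := √(y ^ 2 + ε ^ 2) - ε

theorem smoothAbs_nonneg (ε y : ℝ) : 0 ≤ smoothAbs ε y :=
  sub_nonneg.2 (Real.le_sqrt_of_sq_le (by nlinarith [sq_nonneg y]))

theorem smoothAbs_le_abs {ε : ℝ} (hε : 0 < ε) (y : ℝ) : smoothAbs ε y ≤ |y| := by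
  refine sub_le_iff_le_add.2 (Real.sqrt_le_iff.2 ⟨by positivity, ?_⟩)
  nlinarith [sq_abs y, mul_nonneg (abs_nonneg y) hε.le]

theorem smoothAbs_zero {ε : ℝ} (hε : 0 < ε) : smoothAbs ε 0 = 0 := by
  unfold smoothAbs
  rw [zero_pow two_ne_zero, zero_add, Real.sqrt_sq hε.le, sub_self]

theorem contDiff_smoothAbs {ε : ℝ} (hε : 0 < ε) : ContDiff ℝ ∞ (smoothAbs ε) :=
  (((contDiff_id.pow 2).add contDiff_const).sqrt fun y => by
    have : 0 < ε ^ 2 := by positivity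
    simp only [id_eq]
    positivity).sub contDiff_const

theorem hasDerivAt_smoothAbs {ε : ℝ} (hε : 0 < ε) (y : ℝ) :
    HasDerivAt (smoothAbs ε) (y / √(y ^ 2 + ε ^ 2)) y := by
  have h1 : HasDerivAt (fun y : ℝ => y ^ 2 + ε ^ 2) (2 * y) y := by
    simpa using (hasDerivAt_pow 2 y).add_const (ε ^ 2)
  have h2 := (h1.sqrt (by positivity)).sub_const ε
  refine h2.congr_deriv ?_
  rw [mul_div_mul_left _ _ two_ne_zero]

theorem abs_deriv_smoothAbs_le {ε : ℝ} (hε : 0 < ε) (y : ℝ) : |y / √(y ^ 2 + ε ^ 2)| ≤ 1 := by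
  rw [abs_div, abs_of_nonneg (Real.sqrt_nonneg _), div_le_one (by positivity)]
  refine Real.le_sqrt_of_sq_le ?_
  rw [sq_abs]
  nlinarith [sq_nonneg ε]

theorem tendsto_smoothAbs {ε y : ℕ → ℝ} {z : ℝ} (hε : Tendsto ε atTop (𝓝 0))
    (hy : Tendsto y atTop (𝓝 z)) : Tendsto (fun n => smoothAbs (ε n) (y n)) atTop (𝓝 |z|) := by
  have h1 := (((hy.pow 2).add (hε.pow 2)).sqrt).sub hε
  simpa [smoothAbs, Real.sqrt_sq_eq_abs] using h1

variable {N : ℕ} {Ω : Set (Sp N)}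

theorem IsTestFunction.smoothAbs {φ : Sp N → ℝ} (hφ : IsTestFunction Ω φ) {ε : ℝ} (hε : 0 < ε) :
    IsTestFunction Ω (fun x => smoothAbs ε (φ x)) :=
  ⟨(contDiff_smoothAbs hε).comp hφ.1, hφ.2.1.comp_left (smoothAbs_zero hε),
    (tsupport_comp_subset (smoothAbs_zero hε) φ).trans hφ.2.2⟩

theorem IsTestFunction.norm_gradient_smoothAbs_le {φ : Sp N → ℝ} (hφ : IsTestFunction Ω φ) {ε : ℝ}
    (hε : 0 < ε) (x : Sp N) :
    ‖gradient (fun x => PxLaplace.smoothAbs ε (φ x)) x‖ ≤ ‖gradient φ x‖ := by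
  have h := (hasDerivAt_smoothAbs hε (φ x)).comp_hasFDerivAt x
    (hφ.1.differentiable (by simp)).differentiableAt.hasFDerivAt
  rw [norm_gradient, norm_gradient]
  have h2 := h.fderiv
  simp only [Function.comp_def] at h2
  rw [h2, norm_smul]
  exact mul_le_of_le_one_left (norm_nonneg _) (abs_deriv_smoothAbs_le hε _)

end SmoothAbs

/-! ### The first variation of the energy at a minimizer -/

section FirstVariation

variable {N : ℕ} {P : Problem N} {m R C : ℝ}

theorem modular_le_of_norm_le {Ω : Set (Sp N)} {p : Sp N → ℝ} {S : ℝ} (hp : IsExponent Ω p S)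
    {F G : Type} [NormedAddCommGroup F] [NormedAddCommGroup G] {f : Sp N → F} {h : Sp N → G}
    (hle : ∀ x, ‖f x‖ ≤ ‖h x‖) : modular Ω p f ≤ modular Ω p h := by
  refine lintegral_mono_ae ?_
  filter_upwards [hp.ae] with x hx
  exact ENNReal.ofReal_le_ofReal (Real.rpow_le_rpow (norm_nonneg _) (hle x) (by linarith))

theorem integral_rpow_le_of_modular_le {Ω : Set (Sp N)} {p : Sp N → ℝ} {S : ℝ}
    (hp : IsExponent Ω p S) {F : Type} [NormedAddCommGroup F] {f : Sp N → F} (hf : MemVarLp Ω p f)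
    {M : ENNReal} (hM : M ≠ ⊤) (hle : modular Ω p f ≤ M) :
    ∫ x in Ω, ‖f x‖ ^ p x ≤ M.toReal := by
  rw [integral_eq_lintegral_of_nonneg_ae (Eventually.of_forall fun x => by positivity)
    (hf.integrable_rpow hp).1]
  exact ENNReal.toReal_mono hM hle

/-- The derivative of the regular part of the energy at `f` in the direction `φ`. -/
noncomputable def Problem.regularVariation (P : Problem N) (f φ : Sp N → ℝ)
    (g γ : Sp N → Sp N) : ℝ :=
  (∫ x in P.Ω, (P.p x)⁻¹ * (P.p x * ‖g x‖ ^ (P.p x - 2) * inner ℝ (g x) (γ x))) -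
    ∫ x in P.Ω, P.a x / P.q x * (P.q x * ‖f x‖ ^ (P.q x - 2) * inner ℝ (f x) (φ x))

theorem regularVariation_neg (f φ : Sp N → ℝ) (g γ : Sp N → Sp N) :
    P.regularVariation f (fun x => -φ x) g (fun x => -γ x) = -P.regularVariation f φ g γ := by
  unfold Problem.regularVariation
  simp only [inner_neg_right, mul_neg, integral_neg]
  ring

/-- The bound sees the direction only through modular integrals, so it is uniform along sequences
that are bounded in the modular sense. -/
theorem regularVariation_le (hP : P.Admissible) (hB : P.HasBounds m R C)
    {f φ : Sp N → ℝ} {g γ : Sp N → Sp N} (hf : IsSobolevZero P.Ω P.p f g)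
    (hφ : IsSobolevZero P.Ω P.p φ γ) :
    P.regularVariation f φ g γ ≤
      C * (R * ((∫ x in P.Ω, ‖g x‖ ^ P.p x) + ∫ x in P.Ω, ‖γ x‖ ^ P.p x)) +
      C * (R * ((∫ x in P.Ω, ‖f x‖ ^ P.q x) + ∫ x in P.Ω, ‖φ x‖ ^ P.q x)) := by
  have h1 := abs_le.1 (abs_integral_norm_rpow_mul_inner_le hB.one_lt_p hB.le_p
    (hf.integrable_grad hB) (hφ.integrable_grad hB))
  have h2 := abs_le.1 (abs_integral_norm_rpow_mul_inner_le hB.one_lt_q hB.le_q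
    (hf.integrable_q hP hB) (hφ.integrable_q hP hB))
  unfold Problem.regularVariation
  linarith [h1.2, h2.1]

theorem tendsto_regularPart_slope (hP : P.Admissible) (hB : P.HasBounds m R C)
    {f φ : Sp N → ℝ} {g γ : Sp N → Sp N} (hf : IsSobolevZero P.Ω P.p f g)
    (hφ : IsSobolevZero P.Ω P.p φ γ) :
    Tendsto (fun z : ℝ × ℝ =>
        (P.regularPart f φ g γ z.1 z.2 - P.regularPart f φ g γ 0 z.2) / z.1)
      (𝓝[>] 0 ×ˢ 𝓝 1) (𝓝 (P.regularVariation f φ g γ)) := by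
  have h1 := tendsto_integral_norm_rpow_slope hB.exponent_p.meas hB.one_lt_p hB.meas_p hB.le_p
    hf.mem_grad.1 hφ.mem_grad.1 (hf.integrable_grad hB) (hφ.integrable_grad hB)
  have h2 := tendsto_integral_norm_rpow_slope hB.exponent_q.meas hB.one_lt_q hB.meas_q hB.le_q
    hf.mem.1 hφ.mem.1 (hf.integrable_q hP hB) (hφ.integrable_q hP hB)
  have i1 := integrable_mul_comp_rpow hB.exponent_p.meas hB.pos_p hB.meas_p hB.le_p
    continuous_norm norm_nonneg (fun _ => le_rfl) hf.mem_grad.1 hφ.mem_grad.1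
    (hf.integrable_grad hB) (hφ.integrable_grad hB)
  have i2 := integrable_mul_comp_rpow hB.exponent_q.meas hB.pos_q hB.meas_q hB.le_q
    continuous_norm norm_nonneg (fun _ => le_rfl) hf.mem.1 hφ.mem.1
    (hf.integrable_q hP hB) (hφ.integrable_q hP hB)
  refine (h1.sub h2).congr' ?_
  filter_upwards [(lt_mem_nhds one_pos).prod_inr (𝓝[>] (0 : ℝ))] with z hz
  have e1 := integral_rpow_mul_slope hB.exponent_p.meas hB.pos_p (i1 z.1) (i1 0) hz z.1
  have e2 := integral_rpow_mul_slope hB.exponent_q.meas hB.pos_q (i2 z.1) (i2 0) hz z.1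
  simp only [zero_smul, add_zero] at e1 e2
  unfold Problem.regularPart
  simp only [zero_smul, add_zero]
  rw [← e1, ← e2]
  ring

theorem isPosPartData (hB : P.HasBounds m R C) {f φ : Sp N → ℝ} {g γ : Sp N → Sp N}
    (hf : IsSobolevZero P.Ω P.p f g) (hφ : IsSobolevZero P.Ω P.p φ γ) :
    IsPosPartData (volume.restrict P.Ω) (fun x => P.b x / (1 - P.δ x)) (fun x => 1 - P.δ x) f φ
      m R C :=
  ⟨hB.pos, hB.meas_exp, hB.exp_mem, hB.meas_sing, hB.le_sing, hf.mem.1.aemeasurable,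
    hφ.mem.1.aemeasurable, hf.integrable_sing hB, hφ.integrable_sing hB⟩

theorem singularPart_slope (hB : P.HasBounds m R C) {f φ : Sp N → ℝ} {g γ : Sp N → Sp N}
    (hf : IsSobolevZero P.Ω P.p f g) (hφ : IsSobolevZero P.Ω P.p φ γ) (s : ℝ) {t : ℝ}
    (ht : 0 < t) :
    (P.singularPart f φ s t - P.singularPart f φ 0 t) / s =
      ∫ x in P.Ω, t ^ (1 - P.δ x) *
        posPartSlope (fun x => P.b x / (1 - P.δ x)) (fun x => 1 - P.δ x) f φ s x := by
  have i := integrable_mul_comp_rpow hB.meas_exp hB.pos_exp hB.meas_sing hB.abs_sing_le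
    (continuous_id.max continuous_const) (fun v => le_max_right v 0) max_zero_le_norm
    hf.mem.1 hφ.mem.1 (hf.integrable_sing hB) (hφ.integrable_sing hB)
  have e := integral_rpow_mul_slope hB.meas_exp hB.pos_exp (i s) (i 0) ht s
  simp only [id_eq, zero_smul, add_zero] at e
  unfold Problem.singularPart posPartSlope
  simp only [zero_smul, add_zero]
  exact e

/-- The energy on the fibers through `f + s φ` is not smaller than on the fiber through `f`, for
`s` small and suitable points of the fibers close to `f`. -/
def Problem.IsFiberMin (P : Problem N) (f φ : Sp N → ℝ) (g γ : Sp N → Sp N) : Prop :=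
  ∀ η : ℝ, 0 < η → ∀ᶠ s in 𝓝 (0 : ℝ), ∃ t, 0 < t ∧ |t - 1| < η ∧
    P.fiberEnergy f φ g γ 0 t ≤ P.fiberEnergy f φ g γ s t

/-- The inequality E(tf) ≤ E(t(f + sφ)), rearranged and divided by λs > 0. Nothing is known about
how t depends on s, which is why all limits are taken jointly in (s, t). -/
theorem singular_slope_le (hP : P.Admissible) (hB : P.HasBounds m R C)
    {f φ : Sp N → ℝ} {g γ : Sp N → Sp N} (hf : IsSobolevZero P.Ω P.p f g)
    (hφ : IsSobolevZero P.Ω P.p φ γ) (h : P.IsFiberMin f φ g γ) {η : ℝ} (hη : 0 < η) :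
    ∀ᶠ s in 𝓝[>] (0 : ℝ), ∃ t, |t - 1| < η ∧
      ∫ x in P.Ω, t ^ (1 - P.δ x) *
        posPartSlope (fun x => P.b x / (1 - P.δ x)) (fun x => 1 - P.δ x) f φ s x ≤
      (P.regularPart f φ g γ s t - P.regularPart f φ g γ 0 t) / s / P.lam := by
  filter_upwards [nhdsWithin_le_nhds (h η hη), self_mem_nhdsWithin] with s ⟨t, ht, htη, hle⟩ hs
  have hs0 : 0 < s := hs
  refine ⟨t, htη, ?_⟩
  rw [← singularPart_slope hB hf hφ s ht, le_div_iff₀ hP.lam_pos, div_mul_eq_mul_div]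
  refine div_le_div_of_nonneg_right ?_ hs0.le
  unfold Problem.fiberEnergy at hle
  linarith

/-- The pairs `(s, t)` along which the singular difference quotients are controlled form a
nontrivial filter. -/
theorem exists_filter (hP : P.Admissible) (hB : P.HasBounds m R C)
    {f φ : Sp N → ℝ} {g γ : Sp N → Sp N} (hf : IsSobolevZero P.Ω P.p f g)
    (hφ : IsSobolevZero P.Ω P.p φ γ) (h : P.IsFiberMin f φ g γ) :
    ∃ l : Filter (ℝ × ℝ), l.NeBot ∧ l.IsCountablyGenerated ∧ l ≤ 𝓝[>] 0 ×ˢ 𝓝 1 ∧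
      ∀ᶠ z in l, ∫ x in P.Ω, z.2 ^ (1 - P.δ x) *
        posPartSlope (fun x => P.b x / (1 - P.δ x)) (fun x => 1 - P.δ x) f φ z.1 x ≤
      (P.regularPart f φ g γ z.1 z.2 - P.regularPart f φ g γ 0 z.2) / z.1 / P.lam := by
  refine ⟨(𝓝[>] 0 ×ˢ 𝓝 1) ⊓ 𝓟 {z : ℝ × ℝ | ∫ x in P.Ω, z.2 ^ (1 - P.δ x) *
        posPartSlope (fun x => P.b x / (1 - P.δ x)) (fun x => 1 - P.δ x) f φ z.1 x ≤
      (P.regularPart f φ g γ z.1 z.2 - P.regularPart f φ g γ 0 z.2) / z.1 / P.lam}, ?_,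
    inferInstance, inf_le_left, mem_inf_of_right (mem_principal_self _)⟩
  rw [inf_principal_neBot_iff]
  intro U hU
  obtain ⟨A, hA, B, hB', hAB⟩ := eventually_prod_iff.1 hU
  obtain ⟨η, hη, hηB⟩ := Metric.eventually_nhds_iff.1 hB'
  obtain ⟨s, hsA, t, ht, hst⟩ := (hA.and (singular_slope_le hP hB hf hφ h hη)).exists
  exact ⟨(s, t), hAB hsA (hηB (by rwa [Real.dist_eq])), hst⟩

theorem lintegral_variation_le (hP : P.Admissible) (hB : P.HasBounds m R C)
    {f φ : Sp N → ℝ} {g γ : Sp N → Sp N} (hf : IsSobolevZero P.Ω P.p f g)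
    (hφ : IsSobolevZero P.Ω P.p φ γ) (hpos : ∀ x, 0 ≤ φ x) (h : P.IsFiberMin f φ g γ) :
    ∫⁻ x in P.Ω, ENNReal.ofReal (posPartVariation (fun x => P.b x / (1 - P.δ x))
      (fun x => 1 - P.δ x) f φ x) ≤ ENNReal.ofReal (P.regularVariation f φ g γ / P.lam) := by
  obtain ⟨l, hl1, hl2, hl3, hl4⟩ := exists_filter hP hB hf hφ h
  exact (isPosPartData hB hf hφ).lintegral_posPartVariation_le hpos hl3
    (((tendsto_regularPart_slope hP hB hf hφ).mono_left hl3).div_const _) hl4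

theorem abs_posPartVariation {X : Type*} {c α u φ : X → ℝ} {x : X} (hc : 0 ≤ c x)
    (hα : 0 ≤ α x) :
    |posPartVariation c α u φ x| = posPartVariation c α u (fun x => |φ x|) x := by
  by_cases hu : 0 < u x
  · have hu' : x ∈ {x | 0 < u x} := hu
    simp only [posPartVariation, Set.indicator_of_mem hu']
    rw [abs_mul, abs_mul, abs_mul, abs_of_nonneg hc, abs_of_nonneg hα,
      abs_of_nonneg (Real.rpow_nonneg hu.le _)]
  · have hu' : x ∉ {x | 0 < u x} := hu
    simp only [posPartVariation, Set.indicator_of_notMem hu', abs_zero]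

/-- If the fibers through `f` are minimal in the direction of every test function, then the
singular term has an integrable first variation in every direction of `W_0^{1,p(·)}`. -/
theorem integrable_posPartVariation (hP : P.Admissible) (hB : P.HasBounds m R C)
    {f φ : Sp N → ℝ} {g γ : Sp N → Sp N} (hf : IsSobolevZero P.Ω P.p f g)
    (hφ : IsSobolevZero P.Ω P.p φ γ)
    (h : ∀ ψ, IsTestFunction P.Ω ψ → P.IsFiberMin f ψ g (gradient ψ)) :
    Integrable (posPartVariation (fun x => P.b x / (1 - P.δ x)) (fun x => 1 - P.δ x) f φ)
      (volume.restrict P.Ω) := by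
  set V := posPartVariation (fun x => P.b x / (1 - P.δ x)) (fun x => 1 - P.δ x) f with hV
  have hp := hB.exponent_p
  have hq := hB.exponent_q
  obtain ⟨φn, M, hM, hφn, hm1, hm2, hlim⟩ := hφ.exists_seq hp
  obtain ⟨Q, hQ, hbound⟩ := exists_modular_bound hP.two_le hp hP.isBounded hP.cont_p hP.cont_q
    hP.one_lt_p hP.p_lt_q hP.q_lt_pstar M hM
  set ε : ℕ → ℝ := fun n => 1 / ((n : ℝ) + 1) with hε
  have hε0 : ∀ n, 0 < ε n := fun n => by positivity
  have hεlim : Tendsto ε atTop (𝓝 0) := tendsto_one_div_add_atTop_nhds_zero_nat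
  -- Fatou's lemma requires nonnegative directions and |φₙ| need not be smooth. These substitutes
  -- are test functions, are dominated by φₙ together with their gradients, and converge to |φ|
  -- almost everywhere.
  set ψ : ℕ → Sp N → ℝ := fun n x => smoothAbs (ε n) (φn n x) with hψ
  have hψt : ∀ n, IsTestFunction P.Ω (ψ n) := fun n => (hφn n).smoothAbs (hε0 n)
  have hψs : ∀ n, IsSobolevZero P.Ω P.p (ψ n) (gradient (ψ n)) := fun n => (hψt n).isSobolevZero hp
  set K : ℝ := C * (R * ((∫ x in P.Ω, ‖g x‖ ^ P.p x) + M.toReal)) +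
      C * (R * ((∫ x in P.Ω, ‖f x‖ ^ P.q x) + Q.toReal)) with hK
  have hCR : ∀ n, P.regularVariation f (ψ n) g (gradient (ψ n)) ≤ K := by
    intro n
    refine (regularVariation_le hP hB hf (hψs n)).trans ?_
    -- The almost everywhere bounds force R ≥ 0 and C ≥ 0 only because Ω has positive measure.
    have hne : (volume.restrict P.Ω) ≠ 0 := by
      rw [ne_eq, Measure.restrict_eq_zero]
      exact (hP.isOpen.measure_pos volume hP.isConnected.nonempty).ne'
    have : (ae (volume.restrict P.Ω)).NeBot := ae_neBot.2 hne
    obtain ⟨x, hxp, hxC⟩ := (hB.pos_p.and hB.le_p).exists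
    have hR0 : 0 ≤ R := hxp.1.le.trans hxp.2
    have hC0 : 0 ≤ C := (abs_nonneg _).trans hxC
    have b1 : ∫ x in P.Ω, ‖gradient (ψ n) x‖ ^ P.p x ≤ M.toReal :=
      integral_rpow_le_of_modular_le hp (hψs n).mem_grad hM ((modular_le_of_norm_le hp
        fun x => (hφn n).norm_gradient_smoothAbs_le (hε0 n) x).trans (hm2 n))
    have b2 : ∫ x in P.Ω, ‖ψ n x‖ ^ P.q x ≤ Q.toReal := by
      refine integral_rpow_le_of_modular_le hq ((hψs n).memVarLp_q hP hB) hQ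
        ((modular_le_of_norm_le hq fun x => ?_).trans (hbound _ (hφn n) (hm1 n) (hm2 n)))
      rw [Real.norm_of_nonneg (smoothAbs_nonneg _ _)]
      exact smoothAbs_le_abs (hε0 n) _
    exact add_le_add
      (mul_le_mul_of_nonneg_left (mul_le_mul_of_nonneg_left (add_le_add le_rfl b1) hR0) hC0)
      (mul_le_mul_of_nonneg_left (mul_le_mul_of_nonneg_left (add_le_add le_rfl b2) hR0) hC0)
  -- A second use of Fatou's lemma, now along n; the first, along s → 0⁺, is inside
  -- `lintegral_variation_le`.
  have hfin : ∫⁻ x in P.Ω, ENNReal.ofReal (V (fun x => |φ x|) x) ≤ ENNReal.ofReal (K / P.lam) := by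
    calc ∫⁻ x in P.Ω, ENNReal.ofReal (V (fun x => |φ x|) x)
        = ∫⁻ x in P.Ω, liminf (fun n => ENNReal.ofReal (V (ψ n) x)) atTop := by
          refine lintegral_congr_ae ?_
          filter_upwards [hlim] with x hx
          refine (Tendsto.liminf_eq ?_).symm
          refine (ENNReal.continuous_ofReal.tendsto _).comp ?_
          by_cases hu : x ∈ {x | 0 < f x}
          · simp only [hV, posPartVariation, Set.indicator_of_mem hu]
            exact ((tendsto_smoothAbs hεlim hx).const_mul _).const_mul _
          · simp only [hV, posPartVariation, Set.indicator_of_notMem hu]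
            exact tendsto_const_nhds
      _ ≤ liminf (fun n => ∫⁻ x in P.Ω, ENNReal.ofReal (V (ψ n) x)) atTop :=
          lintegral_liminf_le' fun n => ((isPosPartData hB hf
            (hψs n)).aestronglyMeasurable_posPartVariation).aemeasurable.ennreal_ofReal
      _ ≤ ENNReal.ofReal (K / P.lam) := by
          refine Filter.liminf_le_of_le (by isBoundedDefault) fun b hb => ?_
          obtain ⟨n, hn⟩ := hb.exists
          refine hn.trans ((lintegral_variation_le hP hB hf (hψs n)
            (fun x => smoothAbs_nonneg _ _) (h _ (hψt n))).trans (ENNReal.ofReal_le_ofReal ?_))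
          exact div_le_div_of_nonneg_right (hCR n) hP.lam_pos.le
  refine ⟨(isPosPartData hB hf hφ).aestronglyMeasurable_posPartVariation, ?_⟩
  rw [hasFiniteIntegral_iff_norm]
  refine lt_of_le_of_lt (lintegral_mono_ae ?_) (hfin.trans_lt ENNReal.ofReal_lt_top)
  filter_upwards [hB.le_sing, hB.pos_exp] with x hx1 hx2
  exact ENNReal.ofReal_le_ofReal (abs_posPartVariation (c := fun x => P.b x / (1 - P.δ x))
    (α := fun x => 1 - P.δ x) (u := f) (φ := φ) hx1.1 hx2.1.le).le

theorem integral_variation_le (hP : P.Admissible) (hB : P.HasBounds m R C)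
    {f φ : Sp N → ℝ} {g γ : Sp N → Sp N} (hf : IsSobolevZero P.Ω P.p f g)
    (hφ : IsSobolevZero P.Ω P.p φ γ) (h : P.IsFiberMin f φ g γ)
    (hi : Integrable (posPartVariation (fun x => P.b x / (1 - P.δ x)) (fun x => 1 - P.δ x) f φ)
      (volume.restrict P.Ω)) :
    ∫ x in P.Ω, posPartVariation (fun x => P.b x / (1 - P.δ x)) (fun x => 1 - P.δ x) f φ x ≤
      P.regularVariation f φ g γ / P.lam := by
  obtain ⟨l, hl1, -, hl3, hl4⟩ := exists_filter hP hB hf hφ h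
  exact (isPosPartData hB hf hφ).integral_posPartVariation_le hi hl3
    (((tendsto_regularPart_slope hP hB hf hφ).mono_left hl3).div_const _) hl4

theorem posPartVariation_neg {X : Type*} (c α u φ : X → ℝ) (x : X) :
    posPartVariation c α u (fun x => -φ x) x = -posPartVariation c α u φ x := by
  by_cases hu : x ∈ {x | 0 < u x}
  · simp only [posPartVariation, Set.indicator_of_mem hu]
    ring
  · simp only [posPartVariation, Set.indicator_of_notMem hu, neg_zero]

/-- The right derivative of the energy vanishes. -/
theorem tendsto_fiberEnergy_slope (hP : P.Admissible) (hB : P.HasBounds m R C)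
    {f φ : Sp N → ℝ} {g γ : Sp N → Sp N} (hf : IsSobolevZero P.Ω P.p f g)
    (hφ : IsSobolevZero P.Ω P.p φ γ)
    (h : ∀ ψ κ, IsSobolevZero P.Ω P.p ψ κ → P.IsFiberMin f ψ g κ) :
    Tendsto (fun s => (P.fiberEnergy f φ g γ s 1 - P.fiberEnergy f φ g γ 0 1) / s) (𝓝[>] 0)
      (𝓝 0) := by
  have hp := hB.exponent_p
  have hlam := hP.lam_pos
  have hi := integrable_posPartVariation hP hB hf hφ fun ψ hψ => h ψ _ (hψ.isSobolevZero hp)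
  have hφn : IsSobolevZero P.Ω P.p (fun x => -φ x) (fun x => -γ x) := by
    simpa only [neg_smul, one_smul] using hφ.smul hp (-1)
  have hle := integral_variation_le hP hB hf hφ (h _ _ hφ) hi
  have hge := integral_variation_le hP hB hf hφn (h _ _ hφn)
    (hi.neg.congr (Eventually.of_forall fun x => (posPartVariation_neg _ _ _ _ x).symm))
  simp only [posPartVariation_neg, integral_neg, regularVariation_neg, neg_div] at hge
  -- Both variations are odd in φ, so the one-sided inequalities for φ and -φ combine to an
  -- equality.
  have heq := le_antisymm (neg_le_neg_iff.1 hge) hle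
  have hreg := tendsto_regularPart_slope hP hB hf hφ
  -- The equality just found identifies the limit of the regular quotients divided by λ with the
  -- singular variation, which is the hypothesis that makes the set {u ≤ 0} negligible in the limit.
  have hsing := (isPosPartData hB hf hφ).tendsto_integral_posPartSlope hi
    (heq ▸ hreg.div_const P.lam) fun η hη => singular_slope_le hP hB hf hφ (h _ _ hφ) hη
  have hreg1 := hreg.comp (tendsto_id.prodMk (tendsto_const_nhds (x := (1 : ℝ))))
  have hlim := hreg1.sub (hsing.const_mul P.lam)
  rw [← heq, mul_div_cancel₀ _ hlam.ne', sub_self] at hlim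
  refine hlim.congr fun s => ?_
  have e := singularPart_slope hB hf hφ s one_pos
  simp only [Real.one_rpow, one_mul] at e
  unfold Problem.fiberEnergy
  simp only [Function.comp_def, id_eq]
  rw [← e]
  ring

theorem fiberEnergy_congr {f φ φ' : Sp N → ℝ} {g γ : Sp N → Sp N}
    (h : φ =ᵐ[volume.restrict P.Ω] φ') (s t : ℝ) :
    P.fiberEnergy f φ g γ s t = P.fiberEnergy f φ' g γ s t := by
  have h1 : P.regularPart f φ g γ s t = P.regularPart f φ' g γ s t := by
    unfold Problem.regularPart
    congr 1
    refine integral_congr_ae ?_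
    filter_upwards [h] with x hx
    rw [hx]
  have h2 : P.singularPart f φ s t = P.singularPart f φ' s t := by
    refine integral_congr_ae ?_
    filter_upwards [h] with x hx
    rw [hx]
  rw [Problem.fiberEnergy, Problem.fiberEnergy, h1, h2]

theorem isFiberMin_of_isLocalMinimizerOn (hP : P.Admissible) (hB : P.HasBounds m R C)
    {u : MeasFun P.Ω} {g : Sp N → Sp N}
    (hmin : P.IsLocalMinimizerOn P.nehariPos u ∨ P.IsLocalMinimizerOn P.nehariNeg u)
    (hu : IsSobolevZero P.Ω P.p u g) {ψ : Sp N → ℝ} {κ : Sp N → Sp N}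
    (hψ : IsSobolevZero P.Ω P.p ψ κ) : P.IsFiberMin u ψ g κ := by
  intro η hη
  have hae : (AEEqFun.mk ψ hψ.mem.1 : MeasFun P.Ω) =ᵐ[volume.restrict P.Ω] ψ :=
    AEEqFun.coeFn_mk ψ hψ.mem.1
  simpa only [fiberEnergy_congr hae] using
    exists_fiberEnergy_le hP hB hmin hu (hψ.congr hae.symm .rfl) hη

/-- The left derivative along φ is minus the right derivative along -φ, and both one-sided limits
are 0. -/
theorem hasDerivAt_fiberEnergy (hP : P.Admissible) (hB : P.HasBounds m R C)
    {f φ : Sp N → ℝ} {g γ : Sp N → Sp N} (hf : IsSobolevZero P.Ω P.p f g)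
    (hφ : IsSobolevZero P.Ω P.p φ γ)
    (h : ∀ ψ κ, IsSobolevZero P.Ω P.p ψ κ → P.IsFiberMin f ψ g κ) :
    HasDerivAt (fun s => P.fiberEnergy f φ g γ s 1) 0 0 := by
  have hφn : IsSobolevZero P.Ω P.p (fun x => -φ x) (fun x => -γ x) := by
    simpa only [neg_smul, one_smul] using hφ.smul hB.exponent_p (-1)
  have hneg : ∀ s, P.fiberEnergy f (fun x => -φ x) g (fun x => -γ x) (-s) 1 =
      P.fiberEnergy f φ g γ s 1 := by
    intro s
    unfold Problem.fiberEnergy Problem.regularPart Problem.singularPart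
    simp only [smul_neg, neg_smul, neg_neg]
  have hright := tendsto_fiberEnergy_slope hP hB hf hφ h
  have hleft := ((tendsto_fiberEnergy_slope hP hB hf hφn h).comp
    (by simpa using tendsto_neg_nhdsLT (a := (0 : ℝ)))).neg
  have h0 := hneg 0
  rw [neg_zero] at h0
  rw [hasDerivAt_iff_tendsto_slope_zero, ← nhdsLT_sup_nhdsGT, tendsto_sup]
  simp only [zero_add, smul_eq_mul, inv_mul_eq_div]
  refine ⟨?_, hright⟩
  simp only [Function.comp_def, hneg, h0, div_neg, neg_neg, neg_zero] at hleft
  exact hleft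

end FirstVariation

end PxLaplace

theorem lemma3p2 {N : ℕ} (P : PxLaplace.Problem N) (hP : P.Admissible)
    (u : PxLaplace.MeasFun P.Ω)
    (hmin : P.IsLocalMinimizerOn P.nehariPos u ∨ P.IsLocalMinimizerOn P.nehariNeg u)
    (hu : u ∉ P.nehariZero) :
    P.IsCriticalPoint u := by
  obtain ⟨m, R, C, hB⟩ := hP.exists_hasBounds
  have hW : u ∈ PxLaplace.W0 P.Ω P.p := by
    rcases hmin with h | h <;> exact h.1.1.1
  have hu0 := PxLaplace.isSobolevZero_of_mem_W0 hB.exponent_p hW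
  refine ⟨hW, fun φ hφ => ?_⟩
  have hφ0 := PxLaplace.isSobolevZero_of_mem_W0 hB.exponent_p hφ
  have h := PxLaplace.hasDerivAt_fiberEnergy hP hB hu0 hφ0 fun ψ κ hψ =>
    PxLaplace.isFiberMin_of_isLocalMinimizerOn hP hB hmin hu0 hψ
  refine h.congr_of_eventuallyEq (Filter.Eventually.of_forall fun s => ?_)
  refine PxLaplace.energy_eq_fiberEnergy hB hu0.hasWeakGrad hφ0.hasWeakGrad one_pos ?_
  simpa only [one_smul] using PxLaplace.coeFn_smul_add_smul u φ s 1
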